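/- **Poics.** A lattice is a free abelian group $N$ of finite rank, and $N_{\mathbb R}=N\otimes_{\mathbb Z}\mathbb R$. A *poic* is a pair $\sigma=(\sigma,N^\sigma)$ of a lattice $N^\sigma$ and a non-empty set $\sigma\subset N^\sigma_{\mathbb R}$ that spans $N^\sigma_{\mathbb R}$ and is a finite intersection of half-spaces $\{f\ge 0\}$ and $\{g>0\}$ with $f,g\in (N^{\sigma})^\vee$; $d(\sigma)=\operatorname{rk}N^\sigma$ and $\sigma^o$ is the relative interior. A face of $\sigma$ is a non-empty set $\tau=\sigma\cap\{f\ge0\}$ with $f\in (N^\sigma)^\vee$, $f\le 0$ on $\sigma$, with the lattice $N^\sigma\cap\operatorname{Lin}(\tau)$. A morphism $\sigma\to\xi$ is a homomorphism $N^\sigma\to N^\xi$ that maps $\sigma$ into $\xi$; it is a face-embedding if it identifies $\sigma$, with its lattice, with a face of $\xi$. **Poic-complexes.** A *poic-complex* is a functor $\Phi$ from an essentially finite thin category $C_\Phi$ (its objects are called the cones of $\Phi$) to poics that maps all morphisms to face-embeddings and such that for every cone $q$ and every face $\tau$ of $\Phi(q)$ there is, up to isomorphism, exactly one $p\to q$ with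 image $\tau$. Write $N^p$ for the lattice of $\Phi(p)$, $d(p)$ for its rank, and $[\Phi](k)$ for the set of isomorphism classes of $k$-dimensional cones. A morphism $F:\Phi\to\Psi$ is a functor $C_\Phi\to C_\Psi$ with a natural transformation $F_p:\Phi(p)\to\Psi(F(p))$ such that $F_p(\Phi(p))$ never lies in a proper face of $\Psi(F(p))$. A *linear poic-complex* $\Phi_X$ is a poic-complex with a morphism $X$ to the poic-complex consisting of the single cone $(N_{\mathbb R},N)$, for a lattice $N$. A weight $\omega:[\Phi](k)\to\mathbb Z$ is a *Minkowski weight*, $\omega\in M_k(\Phi_X)$, if for every cone $s$ with $d(s)=k-1$ $$\sum_{[s\to t],\ d(t)=k}\omega([t])\,u_{[s\to t]}=0\quad\text{in } N/X_s(N^s),$$ where $u_{[s\to t]}$ is the image under $X_t$ of the generator of $N^t/N^s$ lying in the projection of $N^t\cap\Phi(t)$. A *subdivision* is a morphism $S:\Upsilon\to\Phi$ such that: (1) the functor is essentially surjective, the lattice maps are injective, and $N^t\to N^{S(t)}$ is an isomorphism whenever $d(t)=d(S(t))$; (2) for every cone $s$ of $\Phi$, $\Phi(s)^o$ is the disjoint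 union of the images of $\Upsilon(p)^o$ over the isomorphism classes of cones $p$ with $S(p)\cong s$; (3) for every cone $t$ of $\Upsilon$, each face of the closure of $S_t(\Upsilon(t))$ in $\Phi(S(t))$ is the image of some $q\to t$; in other words, $S_t(\Upsilon(t))$ is closed in $\Phi(S(t))$. For a subdivision $S$ and $\omega\in M_k(\Phi_X)$ put $(S^*\omega)([p])=\omega([S(p)])$ if $d(S(p))=k$ and $(S^*\omega)([p])=0$ otherwise. The group of *tropical $k$-cycles* $Z_k(\Phi_X)$ is the colimit of the groups $M_k(\Upsilon_{X\circ S})$ over all subdivisions $S:\Upsilon\to\Phi$, along the maps $Q^*$ for subdivisions $Q:\Upsilon'\to\Upsilon$ with $S\circ Q=S'$; that is, the quotient of $\bigoplus_S M_k(\Upsilon_{X\circ S})$ by the subgroup generated by the differences $[S,\omega]-[S',Q^*\omega]$. **Weakly embedded cone complexes.** An *integral cone* $(\sigma,M^\sigma)$ is a topological space $\sigma$ with a lattice $M^\sigma$ of continuous real functions on $\sigma$ such that evaluation $\sigma\to\operatorname{Hom}(M^\sigma,\mathbb R)$ is a homeomorphism onto a full-dimensional strictly convex rational polyhedral cone; $N^\sigma=\operatorname{Hom}(M^\sigma,\mathbb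 Z)$. A subcone of $\sigma$ is a subspace that is an integral cone with the restrictions of the functions in $M^\sigma$; a face is a subcone that is the zero set of a non-negative $m\in M^\sigma$. A *cone complex* $\Sigma$ is a topological space $|\Sigma|$ with a finite set $\Sigma$ of integral cones that are closed subspaces covering $|\Sigma|$, such that faces of cones are cones and the intersection of two cones is a union of common faces. It is *weakly embedded* if it comes with a lattice $N$ and a continuous map $\varphi:|\Sigma|\to N_{\mathbb R}$ that is integral linear on every cone; write $\varphi_\sigma:N^\sigma\to N$. A *proper subdivision* $\Sigma'$ of $\Sigma$ is a cone complex with $|\Sigma'|=|\Sigma|$ all of whose cones are subcones of cones of $\Sigma$; it is weakly embedded by the same $\varphi$. A *Minkowski weight* $c\in M_k(\Sigma)$ is a function on the $k$-dimensional cones with $\sum_{\sigma\supset\tau}c(\sigma)u_{\sigma/\tau}=0$ in $N/\varphi_\tau(N^\tau)$ for every $(k-1)$-dimensional cone $\tau$, where $\sigma$ runs over the $k$-dimensional cones containing $\tau$ and $u_{\sigma/\tau}$ is the image under $\varphi_\sigma$ of the generator of $N^\sigma/N^\tau$ lying in the projection of $N^\sigma\cap\sigma$. The group of *tropical $k$-cycles*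 $Z_k(\Sigma)$ is the colimit of the $M_k(\Sigma')$ over all proper subdivisions $\Sigma'$ of $\Sigma$, along the pullbacks to finer proper subdivisions $\Sigma''$ (a $k$-dimensional cone of $\Sigma''$ gets the weight of the $k$-dimensional cone of $\Sigma'$ containing it, or $0$ if there is none). The poic-complex $\mathrm p(\Sigma)$ is the poset of cones of $\Sigma$ ordered by inclusion, with the poic $(\sigma,N^\sigma)$ attached to $\sigma$; the maps $\varphi_\sigma$ make it a linear poic-complex. **Lemma.** Let $\Sigma$ be a weakly embedded cone complex and $k\ge 0$. 1. For every proper subdivision $\Sigma'$ of $\Sigma$ there is exactly one subdivision $S_{\Sigma'}:\mathrm p(\Sigma')\to\mathrm p(\Sigma)$ that maps each point of each cone of $\Sigma'$ to the same point of $|\Sigma|$. 2. A weight on the $k$-dimensional cones of $\Sigma'$ is a Minkowski weight of $\Sigma'$ if and only if the corresponding weight on $\mathrm p(\Sigma')$ is a Minkowski weight of the linear poic-complex $\mathrm p(\Sigma')$. 3. There is exactly one isomorphism of groups $Z_k(\Sigma)\to Z_k(\mathrm p(\Sigma))$ that, for every proper subdivision $\Sigma'$ of $\Sigma$, maps the class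 of each $c\in M_k(\Sigma')$ to the class of the corresponding Minkowski weight on the subdivision $S_{\Sigma'}$ of $\mathrm p(\Sigma)$. -/

import Mathlib

open scoped TensorProduct DirectSum
open Topology

universe u v

namespace Trop

noncomputable section

/-! ### Lattices and partially open integral cones -/

/-- The real vector space `N_ℝ = N ⊗ ℝ` of a lattice `N`. -/
abbrev NR (N : Type u) [AddCommGroup N] : Type u := ℝ ⊗[ℤ] N

/-- `N_ℝ` carries its canonical topology (the Euclidean one when `N` is a lattice). -/
instance NR.topology (N : Type u) [AddCommGroup N] : TopologicalSpace (NR N) :=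
  moduleTopology ℝ (NR N)

/-- The real extension `f_ℝ : N_ℝ → P_ℝ` of an integral linear map `f : N → P`. -/
def realMap {N : Type u} {P : Type v} [AddCommGroup N] [AddCommGroup P] (f : N →ₗ[ℤ] P) :
    NR N →ₗ[ℝ] NR P :=
  f.baseChange ℝ

/-- The real extension `N_ℝ → ℝ` of an integral linear form `f ∈ N^∨`. -/
def realForm {N : Type u} [AddCommGroup N] (f : Module.Dual ℤ N) : NR N →ₗ[ℝ] ℝ :=
  f.baseChange ℝ

@[simp] theorem realForm_tmul {N : Type u} [AddCommGroup N] (f : Module.Dual ℤ N) (r : ℝ) (n : N) :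
    realForm f (r ⊗ₜ[ℤ] n) = (f n : ℝ) * r := by
  simp [realForm]

theorem realForm_realMap {N : Type u} {P : Type v} [AddCommGroup N] [AddCommGroup P]
    (f : N →ₗ[ℤ] P) (g : Module.Dual ℤ P) (x : NR N) :
    realForm g (realMap f x) = realForm (g ∘ₗ f) x := by
  induction x using TensorProduct.induction_on with
  | zero => simp
  | tmul r n => simp [realMap]
  | add x y hx hy => simp only [map_add, hx, hy]

/-- A partially open integral cone of `N_ℝ`: a non-empty finite intersection of closed and open
half-spaces given by integral linear forms. -/
def IsPartiallyOpenCone {N : Type u} [AddCommGroup N] (σ : Set (NR N)) : Prop :=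
  σ.Nonempty ∧ ∃ F G : Set (Module.Dual ℤ N), F.Finite ∧ G.Finite ∧
    σ = {x | (∀ f ∈ F, 0 ≤ realForm f x) ∧ ∀ g ∈ G, 0 < realForm g x}

/-- `τ` is a face of `σ`: it is a non-empty set of the form `σ ∩ {f ≥ 0}`, with `f` integral and
`f ≤ 0` on `σ`. -/
def IsConeFace {N : Type u} [AddCommGroup N] (τ σ : Set (NR N)) : Prop :=
  τ.Nonempty ∧ ∃ f : Module.Dual ℤ N, (∀ x ∈ σ, realForm f x ≤ 0) ∧
    τ = σ ∩ {x | 0 ≤ realForm f x}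

/-- The lattice `N ∩ Lin(σ)`. -/
def latticeOf {N : Type u} [AddCommGroup N] (σ : Set (NR N)) : Set N :=
  {n | (1 : ℝ) ⊗ₜ[ℤ] n ∈ Submodule.span ℝ σ}

/-- A poic: a lattice `N` with a full-dimensional partially open integral cone of `N_ℝ`. -/
structure Poic : Type (u + 1) where
  N : Type u
  [grp : AddCommGroup N]
  [free : Module.Free ℤ N]
  [fin : Module.Finite ℤ N]
  carrier : Set (NR N)
  isCone : IsPartiallyOpenCone carrier
  full : Submodule.span ℝ carrier = ⊤

attribute [instance] Poic.grp Poic.free Poic.fin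

namespace Poic

/-- The dimension of a poic; as the cone is full-dimensional, this is the rank of the lattice. -/
def dim (σ : Poic.{u}) : ℕ := Module.finrank ℤ σ.N

/-- The relative interior of a poic; as the cone is full-dimensional, this is its interior. -/
def relint (σ : Poic.{u}) : Set (NR σ.N) := interior σ.carrier

/-- Morphisms of poics. -/
@[ext] structure Hom (σ ξ : Poic.{u}) where
  lin : σ.N →ₗ[ℤ] ξ.N
  maps : ∀ x ∈ σ.carrier, realMap lin x ∈ ξ.carrier

/-- The linear map between the real vector spaces induced by a morphism of poics. -/
def Hom.real {σ ξ : Poic.{u}} (f : Hom σ ξ) : NR σ.N →ₗ[ℝ] NR ξ.N := realMap f.lin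

theorem Hom.realForm_real {σ ξ : Poic.{u}} (f : Hom σ ξ) (g : Module.Dual ℤ ξ.N) (x : NR σ.N) :
    realForm g (f.real x) = realForm (g ∘ₗ f.lin) x :=
  realForm_realMap _ _ _

/-- The identity morphism. -/
def Hom.id (σ : Poic.{u}) : Hom σ σ where
  lin := LinearMap.id
  maps x hx := by simpa [realMap] using hx

/-- Composition of morphisms of poics. -/
def Hom.comp {σ ξ ζ : Poic.{u}} (g : Hom ξ ζ) (f : Hom σ ξ) : Hom σ ζ where
  lin := g.lin ∘ₗ f.lin
  maps x hx := by
    have h := g.maps _ (f.maps x hx)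
    simpa [realMap, LinearMap.baseChange_comp] using h

@[simp] theorem Hom.real_id (σ : Poic.{u}) : (Hom.id σ).real = LinearMap.id := by
  simp [Hom.real, Hom.id, realMap]

theorem Hom.real_comp {σ ξ ζ : Poic.{u}} (g : Hom ξ ζ) (f : Hom σ ξ) :
    (g.comp f).real = g.real ∘ₗ f.real := by
  simp [Hom.real, Hom.comp, realMap, LinearMap.baseChange_comp]

/-- The poic `(N_ℝ, N)`. -/
def ofLattice (N : Type u) [AddCommGroup N] [Module.Free ℤ N] [Module.Finite ℤ N] : Poic.{u} where
  N := N
  carrier := Set.univ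
  isCone := ⟨Set.univ_nonempty, ∅, ∅, Set.finite_empty, Set.finite_empty, by simp⟩
  full := Submodule.span_univ

/-- A face-embedding identifies `σ` with a face of `ξ`: the induced real map is injective, the image
of the cone is a face `τ`, and the lattice of `σ` is identified with the lattice `N^ξ ∩ Lin(τ)` of
this face. -/
def Hom.IsFaceEmbedding {σ ξ : Poic.{u}} (f : Hom σ ξ) : Prop :=
  Function.Injective f.real ∧ IsConeFace (f.real '' σ.carrier) ξ.carrier ∧
    (LinearMap.range f.lin : Set ξ.N) = latticeOf (f.real '' σ.carrier)

end Poic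

/-! ### Poic-complexes -/

/-- A poic-complex: a functor from an essentially finite thin category to poics. A thin category is
the same thing as a preorder (`p ≤ q` iff there is a morphism `p → q`, and `p`, `q` are isomorphic
iff `p ≤ q` and `q ≤ p`); it is essentially finite iff it has finitely many isomorphism classes. -/
structure PoicComplex : Type (u + 1) where
  C : Type u
  [pre : Preorder C]
  essFinite : Finite (Antisymmetrization C (· ≤ ·))
  cone : C → Poic.{u}
  map : ∀ {p q : C}, p ≤ q → Poic.Hom (cone p) (cone q)
  map_id : ∀ p : C, map (le_refl p) = Poic.Hom.id (cone p)
  map_comp : ∀ {p q r : C} (h : p ≤ q) (h' : q ≤ r), map (h.trans h') = (map h').comp (map h)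
  isFaceEmbedding : ∀ {p q : C} (h : p ≤ q), (map h).IsFaceEmbedding
  exists_face : ∀ (q : C) (τ : Set (NR (cone q).N)), IsConeFace τ (cone q).carrier →
    ∃ (p : C) (h : p ≤ q), (map h).real '' (cone p).carrier = τ
  unique_face : ∀ {p p' q : C} (h : p ≤ q) (h' : p' ≤ q),
    (map h).real '' (cone p).carrier = (map h').real '' (cone p').carrier → p ≤ p' ∧ p' ≤ p

attribute [instance] PoicComplex.pre PoicComplex.essFinite

namespace PoicComplex

/-- The set `[Φ]` of isomorphism classes of cones. -/
abbrev Classes (Φ : PoicComplex.{u}) : Type u := Antisymmetrization Φ.C (· ≤ ·)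

/-- The isomorphism class `[p]`. -/
def cls (Φ : PoicComplex.{u}) (p : Φ.C) : Φ.Classes := toAntisymmetrization (· ≤ ·) p

/-- The set `[Φ](k)` of isomorphism classes of `k`-dimensional cones. -/
def classesOfDim (Φ : PoicComplex.{u}) (k : ℕ) : Set Φ.Classes :=
  {c | ∃ p : Φ.C, (Φ.cone p).dim = k ∧ Φ.cls p = c}

/-- A morphism of poic-complexes: a functor and a natural transformation such that no cone is mapped
into a proper face. -/
structure Hom (Φ Ψ : PoicComplex.{u}) where
  obj : Φ.C → Ψ.C
  mono : Monotone obj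
  η : ∀ p : Φ.C, Poic.Hom (Φ.cone p) (Ψ.cone (obj p))
  naturality : ∀ {p q : Φ.C} (h : p ≤ q),
    (η q).comp (Φ.map h) = (Ψ.map (mono h)).comp (η p)
  not_in_proper_face : ∀ (p : Φ.C) (τ : Set (NR (Ψ.cone (obj p)).N)),
    IsConeFace τ (Ψ.cone (obj p)).carrier → (η p).real '' (Φ.cone p).carrier ⊆ τ →
      τ = (Ψ.cone (obj p)).carrier

/-- Composition of morphisms of poic-complexes. -/
def Hom.comp {Φ Ψ Ω : PoicComplex.{u}} (G : Hom Ψ Ω) (F : Hom Φ Ψ) : Hom Φ Ω where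
  obj p := G.obj (F.obj p)
  mono := G.mono.comp F.mono
  η p := (G.η (F.obj p)).comp (F.η p)
  naturality {p q} h := by
    have h1 := congrArg Poic.Hom.lin (F.naturality h)
    have h2 := congrArg Poic.Hom.lin (G.naturality (F.mono h))
    ext1
    simp only [Poic.Hom.comp] at h1 h2 ⊢
    rw [LinearMap.comp_assoc, h1, ← LinearMap.comp_assoc, h2, LinearMap.comp_assoc]
  not_in_proper_face p τ hτ h := by
    refine G.not_in_proper_face (F.obj p) τ hτ ?_
    have hτ' := hτ
    obtain ⟨-, f, hf, rfl⟩ := hτ'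
    rw [Poic.Hom.real_comp] at h
    have key := F.not_in_proper_face p
      ((Ψ.cone (F.obj p)).carrier ∩ {x | 0 ≤ realForm (f ∘ₗ (G.η (F.obj p)).lin) x})
    have hsub : (F.η p).real '' (Φ.cone p).carrier ⊆
        (Ψ.cone (F.obj p)).carrier ∩ {x | 0 ≤ realForm (f ∘ₗ (G.η (F.obj p)).lin) x} := by
      rintro _ ⟨x, hx, rfl⟩
      refine ⟨(F.η p).maps x hx, ?_⟩
      have := (h ⟨x, hx, rfl⟩).2
      simpa [Poic.Hom.realForm_real] using this
    have hface := key ⟨((Φ.cone p).isCone.1.image _).mono hsub, f ∘ₗ (G.η (F.obj p)).lin,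
      fun x hx => by
        rw [← Poic.Hom.realForm_real]
        exact hf _ ((G.η (F.obj p)).maps x hx), rfl⟩ hsub
    rintro _ ⟨x, hx, rfl⟩
    refine ⟨(G.η (F.obj p)).maps x hx, ?_⟩
    have hx' := hx
    rw [← hface] at hx'
    simpa [Poic.Hom.realForm_real] using hx'.2

/-- The poic-complex `N_ℝ` with the single cone `(N_ℝ, N)`. -/
def ofLattice (N : Type u) [AddCommGroup N] [Module.Free ℤ N] [Module.Finite ℤ N] :
    PoicComplex.{u} where
  C := PUnit
  essFinite := inferInstance
  cone _ := Poic.ofLattice N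
  map _ := Poic.Hom.id _
  map_id _ := rfl
  map_comp _ _ := rfl
  isFaceEmbedding _ := by
    refine ⟨?_, ?_, ?_⟩
    · rw [Poic.Hom.real_id]
      exact Function.injective_id
    · refine ⟨(Poic.ofLattice N).isCone.1.image _, 0, by simp [realForm], ?_⟩
      simp [realForm]
    · rw [Poic.Hom.real_id]
      have := (Poic.ofLattice N).full
      ext n
      simp [Poic.Hom.id, latticeOf, this]
  exists_face q τ h := by
    refine ⟨q, le_refl q, ?_⟩
    obtain ⟨-, f, hf, rfl⟩ := h
    rw [Poic.Hom.real_id]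
    refine Set.ext fun x => ⟨fun hx => ?_, fun hx => ?_⟩
    · refine ⟨Set.mem_univ _, ?_⟩
      have := hf (-x) (Set.mem_univ _)
      simpa using this
    · exact ⟨x, hx.1, rfl⟩
  unique_face _ _ _ := ⟨trivial, trivial⟩

/-! ### Weights, balancing, subdivisions and tropical cycles of linear poic-complexes

A linear poic-complex is a poic-complex `Φ` with a morphism `X : Hom Φ (ofLattice N)`. -/

/-- The group `W_k(Φ)` of `k`-dimensional weights. -/
abbrev Weights (Φ : PoicComplex.{u}) (k : ℕ) : Type u := Φ.classesOfDim k → ℤ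

/-- `Star¹(s)`: the isomorphism classes of morphisms `s → t` with `d(t) = k`. As the category is
thin, such a class is the same thing as the isomorphism class of `t`. -/
def star (Φ : PoicComplex.{u}) (k : ℕ) (s : Φ.C) : Set (Φ.classesOfDim k) :=
  {c | ∃ t : Φ.C, s ≤ t ∧ Φ.cls t = c}

section Linear

variable {Φ : PoicComplex.{u}} {N : Type u} [AddCommGroup N] [Module.Free ℤ N] [Module.Finite ℤ N]

/-- The integral linear map `X_s : N^s → N_X`. -/
def Hom.linAt (X : Hom Φ (ofLattice N)) (s : Φ.C) : (Φ.cone s).N →ₗ[ℤ] N := (X.η s).lin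

/-- For `s → t` of codimension one, `w ∈ N^t ∩ Φ(t)` is a primitive vector if its class generates
`N^t / N^s`. -/
def IsPrimitive (Φ : PoicComplex.{u}) {s t : Φ.C} (h : s ≤ t) (w : (Φ.cone t).N) : Prop :=
  (1 : ℝ) ⊗ₜ[ℤ] w ∈ (Φ.cone t).carrier ∧
    LinearMap.range (Φ.map h).lin ⊔ Submodule.span ℤ {w} = ⊤

/-- The normal vector `u_{[s → t]} ∈ N_X / X_s(N^s)`: the image of the generator of `N^t / N^s` that
lies in the projection of `N^t ∩ Φ(t)`. It exists, and depends only on the class of `t`. -/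
def Hom.normalVector (X : Hom Φ (ofLattice N)) {k : ℕ} (s : Φ.C) (c : Φ.classesOfDim k) :
    N ⧸ LinearMap.range (X.linAt s) :=
  Classical.epsilon fun u => ∃ (t : Φ.C) (h : s ≤ t) (w : (Φ.cone t).N),
    Φ.cls t = c ∧ Φ.IsPrimitive h w ∧ u = Submodule.Quotient.mk (X.linAt t w)

/-- The group `M_k(Φ_X)` of `k`-dimensional Minkowski weights: the weights that are balanced at
every `(k-1)`-dimensional cone. -/
def minkowski (X : Hom Φ (ofLattice N)) (k : ℕ) : AddSubgroup (Φ.Weights k) where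
  carrier := {ω | ∀ s : Φ.C, (Φ.cone s).dim + 1 = k →
    ∑ᶠ c : Φ.star k s, ω c.1 • X.normalVector s c.1 = 0}
  zero_mem' := by
    intro s _
    simp
  add_mem' {a b} ha hb := by
    intro s hs
    simp only [Pi.add_apply, add_smul]
    rw [finsum_add_distrib (Set.toFinite _) (Set.toFinite _), ha s hs, hb s hs, add_zero]
  neg_mem' {a} ha := by
    intro s hs
    simp only [Pi.neg_apply, neg_smul]
    rw [finsum_neg_distrib, ha s hs, neg_zero]

end Linear

/-- The image in `Φ(s)_ℝ` of the relative interior of a cone `p` with `S(p) ≅ s`. -/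
def Hom.relintImage {Υ Φ : PoicComplex.{u}} (S : Hom Υ Φ) {p : Υ.C} {s : Φ.C} (h : S.obj p ≤ s) :
    Set (NR (Φ.cone s).N) :=
  (Φ.map h).real '' ((S.η p).real '' (Υ.cone p).relint)

/-- Subdivisions of poic-complexes. -/
structure Hom.IsSubdivision {Υ Φ : PoicComplex.{u}} (S : Hom Υ Φ) : Prop where
  /-- The functor is essentially surjective. -/
  essSurj : ∀ s : Φ.C, ∃ p : Υ.C, S.obj p ≤ s ∧ s ≤ S.obj p
  /-- The lattice maps are injective. -/
  injective : ∀ p : Υ.C, Function.Injective (S.η p).lin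
  /-- If `d(p) = d(S(p))`, then the lattice map is an isomorphism. -/
  bijective : ∀ p : Υ.C, (Υ.cone p).dim = (Φ.cone (S.obj p)).dim →
    Function.Bijective (S.η p).lin
  /-- The relative interior of `Φ(s)` is the union of the images of the relative interiors of the
  cones `p` with `S(p) ≅ s`. -/
  relint_eq : ∀ s : Φ.C, (Φ.cone s).relint =
    ⋃ (p : Υ.C) (h : S.obj p ≤ s) (_ : s ≤ S.obj p), S.relintImage h
  /-- This union is disjoint, and the images characterize the cones up to isomorphism: two images
  that meet come from isomorphic cones. -/
  disjoint : ∀ (s : Φ.C) (p q : Υ.C) (hp : S.obj p ≤ s) (hq : S.obj q ≤ s),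
    s ≤ S.obj p → s ≤ S.obj q → (S.relintImage hp ∩ S.relintImage hq).Nonempty → p ≤ q ∧ q ≤ p
  /-- The image of every cone `Υ(p)` is relatively closed in `Φ(S(p))`; equivalently, every face of
  the closure of the image in `Φ(S(p))` is the image of a face of `Υ(p)`. -/
  closed : ∀ p : Υ.C, closure ((S.η p).real '' (Υ.cone p).carrier) ∩ (Φ.cone (S.obj p)).carrier ⊆
    (S.η p).real '' (Υ.cone p).carrier

/-- The map `[Υ] → [Φ]` on isomorphism classes. -/
def Hom.clsMap {Υ Φ : PoicComplex.{u}} (S : Hom Υ Φ) : Υ.Classes → Φ.Classes :=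
  OrderHom.antisymmetrization ⟨S.obj, S.mono⟩

open Classical in
/-- The map `S^* : W_k(Φ) → W_k(Υ)`, with `(S^*ω)([p]) = ω([S(p)])` if `S(p)` is `k`-dimensional and
`(S^*ω)([p]) = 0` otherwise. -/
def Hom.pullback {Υ Φ : PoicComplex.{u}} (S : Hom Υ Φ) {k : ℕ} (ω : Φ.Weights k) : Υ.Weights k :=
  fun c => if h : S.clsMap c.1 ∈ Φ.classesOfDim k then ω ⟨S.clsMap c.1, h⟩ else 0

/-- The subdivisions of `Φ`. -/
structure Subd (Φ : PoicComplex.{u}) : Type (u + 1) where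
  source : PoicComplex.{u}
  hom : Hom source Φ
  isSubdivision : hom.IsSubdivision

section Cycles

variable {Φ : PoicComplex.{u}} {N : Type u} [AddCommGroup N] [Module.Free ℤ N] [Module.Finite ℤ N]

open Classical in
/-- The subgroup generated by the differences `[S, ω] - [S', Q^*ω]`, for subdivisions `S`, `S'` of
`Φ` and a subdivision `Q` with `S ∘ Q = S'`. -/
def cycleRelations (X : Hom Φ (ofLattice N)) (k : ℕ) :
    AddSubgroup (⨁ S : Φ.Subd, minkowski (X.comp S.hom) k) :=
  AddSubgroup.closure {z | ∃ (S S' : Φ.Subd) (Q : Hom S'.source S.source)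
    (ω : minkowski (X.comp S.hom) k) (ω' : minkowski (X.comp S'.hom) k),
    Q.IsSubdivision ∧ S.hom.comp Q = S'.hom ∧ ω'.1 = Q.pullback ω.1 ∧
      z = DirectSum.of (fun S : Φ.Subd => minkowski (X.comp S.hom) k) S ω -
        DirectSum.of (fun S : Φ.Subd => minkowski (X.comp S.hom) k) S' ω'}

/-- The group `Z_k(Φ_X)` of tropical `k`-cycles: the colimit of the groups `M_k(Υ_{X ∘ S})` over the
category of all subdivisions `S : Υ → Φ`. -/
abbrev Cycles (X : Hom Φ (ofLattice N)) (k : ℕ) : Type (u + 1) :=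
  (⨁ S : Φ.Subd, minkowski (X.comp S.hom) k) ⧸ cycleRelations X k

open Classical in
/-- The class in `Z_k(Φ_X)` of a Minkowski weight on a subdivision. -/
def Cycles.mk (X : Hom Φ (ofLattice N)) (k : ℕ) (S : Φ.Subd) (ω : minkowski (X.comp S.hom) k) :
    Cycles X k :=
  QuotientAddGroup.mk (DirectSum.of (fun S : Φ.Subd => minkowski (X.comp S.hom) k) S ω)

end Cycles

end PoicComplex
/-! ### Integral cones, cone complexes and weak embeddings -/

/-- An integral cone `(σ, M)` inside a topological space `X`: a subspace `σ` with a lattice `M` of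
continuous real-valued functions on `σ`, such that evaluation `σ → Hom(M, ℝ)` is a homeomorphism
onto a full-dimensional, strictly convex, rational polyhedral cone. -/
structure IntegralCone (X : Type u) [TopologicalSpace X] where
  carrier : Set X
  M : AddSubgroup C(carrier, ℝ)
  [free : Module.Free ℤ M]
  [fin : Module.Finite ℤ M]
  isEmbedding : IsEmbedding fun (x : carrier) (m : M) => m.1 x
  rational : ∃ F : Set M, F.Finite ∧ ∀ l : M →ₗ[ℤ] ℝ,
    (∃ x : carrier, ∀ m : M, l m = m.1 x) ↔ ∀ m ∈ F, 0 ≤ l m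
  strictlyConvex : ∀ x y : carrier, (∀ m : M, m.1 x + m.1 y = 0) → ∀ m : M, m.1 x = 0
  full : Submodule.span ℝ {l : M →ₗ[ℤ] ℝ | ∃ x : carrier, ∀ m : M, l m = m.1 x} = ⊤

attribute [instance] IntegralCone.free IntegralCone.fin

namespace IntegralCone

variable {X : Type u} [TopologicalSpace X]

/-- The lattice `N^σ = Hom(M^σ, ℤ)`. -/
abbrev N (σ : IntegralCone X) : Type u := Module.Dual ℤ σ.M

/-- The dimension of an integral cone. -/
def dim (σ : IntegralCone X) : ℕ := Module.finrank ℤ σ.N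

/-- `τ` is a subcone of `σ`: it is contained in `σ`, and its lattice of functions consists of the
restrictions of the functions of `σ`. -/
def IsSubcone (τ σ : IntegralCone X) : Prop :=
  ∃ h : τ.carrier ⊆ σ.carrier, ∀ g : C(τ.carrier, ℝ),
    g ∈ τ.M ↔ ∃ m ∈ σ.M, ∀ x : τ.carrier, g x = m (Set.inclusion h x)

/-- `τ` is a face of `σ`: a subcone that is the zero set of a non-negative function of `M^σ`. -/
def IsFace (τ σ : IntegralCone X) : Prop :=
  IsSubcone τ σ ∧ ∃ m ∈ σ.M, (∀ x, 0 ≤ m x) ∧ τ.carrier = Subtype.val '' {x | m x = 0}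

/-- The vector `v ∈ N^σ_ℝ = Hom(M^σ, ℝ)` represents the point `x ∈ σ`. -/
def Represents (σ : IntegralCone X) (v : NR σ.N) (x : σ.carrier) : Prop :=
  ∀ m : σ.M, realForm (Module.Dual.eval ℤ σ.M m) v = m.1 x

end IntegralCone

/-- A cone complex with underlying topological space `X`. -/
@[ext] structure ConeComplex (X : Type u) [TopologicalSpace X] where
  cones : Set (IntegralCone X)
  finite : cones.Finite
  isClosed : ∀ σ ∈ cones, IsClosed σ.carrier
  covers : ∀ x : X, ∃ σ ∈ cones, x ∈ σ.carrier
  /-- Every face of a cone is a cone of the complex. -/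
  face_mem : ∀ σ ∈ cones, ∀ m ∈ σ.M, (∀ x, 0 ≤ m x) →
    ∃ τ ∈ cones, τ.IsFace σ ∧ τ.carrier = Subtype.val '' {x | m x = 0}
  /-- The intersection of two cones is a union of common faces. -/
  inter : ∀ σ ∈ cones, ∀ τ ∈ cones, ∀ x ∈ σ.carrier ∩ τ.carrier,
    ∃ ρ ∈ cones, ρ.IsFace σ ∧ ρ.IsFace τ ∧ x ∈ ρ.carrier

/-- `Σ'` is a proper subdivision of `Σ`: a cone complex on the same space all of whose cones are
subcones of cones of `Σ`. -/
def ConeComplex.IsProperSubdivision {X : Type u} [TopologicalSpace X] (S' S : ConeComplex X) :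
    Prop :=
  ∀ σ' ∈ S'.cones, ∃ σ ∈ S.cones, IntegralCone.IsSubcone σ' σ

/-- A weak embedding of a cone complex: a continuous map to `N_ℝ`, for a lattice `N`, that is
integral linear on every cone. -/
structure WeakEmbedding {X : Type u} [TopologicalSpace X] (S : ConeComplex X)
    (N : Type u) [AddCommGroup N] where
  toFun : X → NR N
  continuous : Continuous toFun
  integral : ∀ σ ∈ S.cones, ∀ n : Module.Dual ℤ N,
    ∃ m ∈ σ.M, ∀ x : σ.carrier, m x = realForm n (toFun x)

/-! ### The poic-complex of a cone complex -/

namespace IntegralCone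

variable {X : Type u} [TopologicalSpace X]

/-- The identification `N^σ_ℝ → Hom(M^σ, ℝ)`. -/
def toHom (σ : IntegralCone X) : NR σ.N →ₗ[ℝ] (σ.M →ₗ[ℤ] ℝ) where
  toFun v :=
    { toFun := fun m => realForm (Module.Dual.eval ℤ σ.M m) v
      map_add' := fun a b => by
        induction v using TensorProduct.induction_on with
        | zero => simp
        | tmul r n => simp [add_mul]
        | add x y hx hy => simp only [map_add] at hx hy ⊢; rw [hx, hy]; ring
      map_smul' := fun c a => by
        induction v using TensorProduct.induction_on with
        | zero => simp
        | tmul r n => simp [mul_assoc]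
        | add x y hx hy => simp only [map_add, hx, hy, smul_add] }
  map_add' a b := by ext; simp
  map_smul' c a := by ext; simp

theorem toHom_apply (σ : IntegralCone X) (v : NR σ.N) (m : σ.M) :
    σ.toHom v m = realForm (Module.Dual.eval ℤ σ.M m) v := rfl

theorem toHom_bijective (σ : IntegralCone X) : Function.Bijective σ.toHom := by
  have h : ∀ v, σ.toHom v = dualTensorHomEquiv ℤ σ.M ℝ (TensorProduct.comm ℤ ℝ σ.N v) := by
    intro v
    induction v using TensorProduct.induction_on with
    | zero => rw [LinearMap.map_zero, LinearEquiv.map_zero, LinearEquiv.map_zero]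
    | tmul r n => ext m; simp [toHom_apply]
    | add x y hx hy => rw [LinearMap.map_add, LinearEquiv.map_add, LinearEquiv.map_add, hx, hy]
  have h2 : (σ.toHom : NR σ.N → _) =
      (dualTensorHomEquiv ℤ σ.M ℝ) ∘ (TensorProduct.comm ℤ ℝ σ.N) := funext h
  rw [h2]
  exact (dualTensorHomEquiv ℤ σ.M ℝ).bijective.comp (TensorProduct.comm ℤ ℝ σ.N).bijective

theorem exists_represents (σ : IntegralCone X) (x : σ.carrier) : ∃ v, σ.Represents v x := by
  obtain ⟨v, hv⟩ := σ.toHom_bijective.2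
    { toFun := fun m => m.1 x, map_add' := fun a b => rfl, map_smul' := fun c a => by simp }
  exact ⟨v, fun m => by rw [← toHom_apply, hv]; rfl⟩

theorem Represents.unique {σ : IntegralCone X} {v w : NR σ.N} {x : σ.carrier}
    (hv : σ.Represents v x) (hw : σ.Represents w x) : v = w := by
  apply σ.toHom_bijective.1
  ext m
  rw [toHom_apply, toHom_apply, hv m, hw m]

/-- The image of `σ` in `N^σ_ℝ`. -/
def coneSet (σ : IntegralCone X) : Set (NR σ.N) := {v | ∃ x : σ.carrier, σ.Represents v x}

/-- The poic of an integral cone: the lattice is `N^σ`, the cone is the image of `σ`. -/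
def poic (σ : IntegralCone X) : Poic.{u} where
  N := σ.N
  carrier := σ.coneSet
  isCone := by
    obtain ⟨F, hF, h⟩ := σ.rational
    constructor
    · obtain ⟨x, hx⟩ := (h 0).2 (by simp)
      obtain ⟨v, hv⟩ := σ.exists_represents x
      exact ⟨v, x, hv⟩
    · refine ⟨(Module.Dual.eval ℤ σ.M) '' F, ∅, hF.image _, Set.finite_empty, ?_⟩
      ext v
      refine (h (σ.toHom v)).trans ⟨fun h' => ⟨?_, fun g hg => hg.elim⟩, fun h' m hm => ?_⟩
      · rintro _ ⟨m, hm, rfl⟩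
        exact h' m hm
      · exact h'.1 _ ⟨m, hm, rfl⟩
  full := by
    apply Submodule.map_injective_of_injective (f := σ.toHom) σ.toHom_bijective.1
    rw [Submodule.map_span, Submodule.map_top, LinearMap.range_eq_top.2 σ.toHom_bijective.2,
      ← σ.full]
    congr 1
    ext l
    constructor
    · rintro ⟨v, ⟨x, hx⟩, rfl⟩
      exact ⟨x, hx⟩
    · rintro ⟨x, hx⟩
      obtain ⟨v, rfl⟩ := σ.toHom_bijective.2 l
      exact ⟨v, ⟨x, hx⟩, rfl⟩

/-- Restriction of functions to a subcone. -/
def restrict {τ σ : IntegralCone X} (h : IsSubcone τ σ) : σ.M →ₗ[ℤ] τ.M where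
  toFun m := ⟨m.1.comp ⟨Set.inclusion h.1, continuous_inclusion h.1⟩,
    (h.2 _).2 ⟨m.1, m.2, fun _ => rfl⟩⟩
  map_add' _ _ := rfl
  map_smul' _ _ := rfl

theorem restrict_surjective {τ σ : IntegralCone X} (h : IsSubcone τ σ) :
    Function.Surjective (restrict h) := by
  rintro ⟨g, hg⟩
  obtain ⟨m, hm, e⟩ := (h.2 g).1 hg
  exact ⟨⟨m, hm⟩, Subtype.ext (ContinuousMap.ext fun x => (e x).symm)⟩

theorem restrict_apply {τ σ : IntegralCone X} (h : IsSubcone τ σ) (m : σ.M) (x : τ.carrier) :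
    (restrict h m).1 x = m.1 (Set.inclusion h.1 x) := rfl

theorem Represents.map {τ σ : IntegralCone X} (h : IsSubcone τ σ) {v : NR τ.N} {x : τ.carrier}
    (hv : τ.Represents v x) :
    σ.Represents (realMap (restrict h).dualMap v) (Set.inclusion h.1 x) := by
  intro m
  rw [realForm_realMap, ← restrict_apply h, ← hv]
  rfl

/-- The morphism of poics given by the inclusion of a subcone; on lattices it is dual to the
restriction of functions. -/
def incl {τ σ : IntegralCone X} (h : IsSubcone τ σ) : Poic.Hom τ.poic σ.poic where
  lin := (restrict h).dualMap
  maps := by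
    rintro v ⟨x, hx⟩
    exact ⟨_, hx.map h⟩

theorem incl_injective {τ σ : IntegralCone X} (h : IsSubcone τ σ) :
    Function.Injective (incl h).real := by
  apply Module.Flat.lTensor_preserves_injective_linearMap (M := ℝ) (restrict h).dualMap
  exact LinearMap.dualMap_injective_of_surjective (restrict_surjective h)

theorem image_incl {τ σ : IntegralCone X} (h : IsSubcone τ σ) :
    realMap (restrict h).dualMap '' τ.coneSet =
      {v | ∃ x : σ.carrier, x.1 ∈ τ.carrier ∧ σ.Represents v x} := by
  ext v
  constructor
  · rintro ⟨w, ⟨x, hx⟩, rfl⟩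
    exact ⟨_, x.2, hx.map h⟩
  · rintro ⟨x, hx, hv⟩
    obtain ⟨w, hw⟩ := τ.exists_represents ⟨x.1, hx⟩
    exact ⟨w, ⟨_, hw⟩, (hw.map h).unique hv⟩

theorem realForm_neg {N : Type u} [AddCommGroup N] (f : Module.Dual ℤ N) (v : NR N) :
    realForm (-f) v = -realForm f v := by
  induction v using TensorProduct.induction_on with
  | zero => simp only [map_zero, neg_zero]
  | tmul r n => simp
  | add x y hx hy => rw [map_add, map_add, hx, hy]; ring

theorem isConeFace_zeroSet (σ : IntegralCone X) (m : σ.M) (hpos : ∀ x, 0 ≤ m.1 x)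
    (Z : Set X) (hz : Z = Subtype.val '' {x | m.1 x = 0})
    (hne : {v | ∃ x : σ.carrier, x.1 ∈ Z ∧ σ.Represents v x}.Nonempty) :
    IsConeFace {v | ∃ x : σ.carrier, x.1 ∈ Z ∧ σ.Represents v x} σ.coneSet := by
  refine ⟨hne, -(Module.Dual.eval ℤ σ.M m), ?_, ?_⟩
  · rintro v ⟨x, hx⟩
    rw [realForm_neg, hx m]
    exact neg_nonpos.2 (hpos x)
  · ext v
    constructor
    · rintro ⟨x, hx, hv⟩
      refine ⟨⟨x, hv⟩, ?_⟩
      rw [hz] at hx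
      obtain ⟨y, hy, e⟩ := hx
      obtain rfl : y = x := Subtype.ext e
      change 0 ≤ realForm (-(Module.Dual.eval ℤ σ.M m)) v
      rw [realForm_neg, hv m, show m.1 y = 0 from hy, neg_zero]
    · rintro ⟨⟨x, hv⟩, h0⟩
      refine ⟨x, ?_, hv⟩
      rw [hz]
      refine ⟨x, le_antisymm ?_ (hpos x), rfl⟩
      change 0 ≤ realForm (-(Module.Dual.eval ℤ σ.M m)) v at h0
      rw [realForm_neg, hv m] at h0
      exact neg_nonneg.1 h0

theorem exists_dualMap_eq {A B : Type u} [AddCommGroup A] [AddCommGroup B] (r : A →ₗ[ℤ] B)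
    (hr : Function.Surjective r) (y : Module.Dual ℤ A) (w : NR (Module.Dual ℤ B))
    (hw : realMap r.dualMap w = (1 : ℝ) ⊗ₜ[ℤ] y) : ∃ z, r.dualMap z = y := by
  have hy : y ∈ (LinearMap.ker r).dualAnnihilator := by
    rw [Submodule.mem_dualAnnihilator]
    intro m hm
    have e1 : realForm (Module.Dual.eval ℤ A m) ((1 : ℝ) ⊗ₜ[ℤ] y) = ((y m : ℤ) : ℝ) := by
      rw [realForm_tmul, mul_one]; rfl
    have e2 : Module.Dual.eval ℤ A m ∘ₗ r.dualMap = 0 := by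
      ext z
      change z (r m) = 0
      rw [LinearMap.mem_ker.1 hm, map_zero]
    rw [← hw, realForm_realMap, e2] at e1
    have e3 : ((y m : ℤ) : ℝ) = 0 := by
      rw [← e1]
      simp [realForm]
    exact_mod_cast e3
  rw [← LinearMap.range_dualMap_eq_dualAnnihilator_ker_of_surjective r hr] at hy
  exact hy

theorem incl_isFaceEmbedding {τ σ : IntegralCone X} (h : IsFace τ σ) :
    (incl h.1).IsFaceEmbedding := by
  refine ⟨incl_injective h.1, ?_, ?_⟩
  · obtain ⟨m, hm, hpos, hz⟩ := h.2
    have hne := (τ.poic.isCone.1.image (incl h.1).real)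
    change IsConeFace (realMap (restrict h.1).dualMap '' τ.coneSet) σ.coneSet
    change (realMap (restrict h.1).dualMap '' τ.coneSet).Nonempty at hne
    rw [image_incl] at hne ⊢
    exact isConeFace_zeroSet σ ⟨m, hm⟩ hpos _ hz hne
  · have hspan : Submodule.span ℝ ((incl h.1).real '' τ.poic.carrier) =
        LinearMap.range (incl h.1).real := by
      rw [← Submodule.map_span, τ.poic.full, Submodule.map_top]
    ext y
    simp only [latticeOf, hspan]
    constructor
    · rintro ⟨z, rfl⟩
      exact ⟨(1 : ℝ) ⊗ₜ[ℤ] z, rfl⟩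
    · rintro ⟨w, hw⟩
      exact exists_dualMap_eq (restrict h.1) (restrict_surjective h.1) y w hw

theorem IsSubcone.refl (σ : IntegralCone X) : IsSubcone σ σ :=
  ⟨subset_rfl, fun g => ⟨fun hg => ⟨g, hg, fun _ => rfl⟩, fun ⟨m, hm, e⟩ => by
    have : g = m := ContinuousMap.ext e
    exact this ▸ hm⟩⟩

theorem IsSubcone.antisymm {σ τ : IntegralCone X} (h : IsSubcone σ τ) (h' : τ.carrier ⊆ σ.carrier) :
    σ = τ := by
  obtain ⟨c, M, _, _, _, _⟩ := σ
  obtain ⟨c', M', _, _, _, _⟩ := τ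
  obtain rfl : c = c' := Set.Subset.antisymm h.1 h'
  have : M = M' := by
    ext g
    refine (h.2 g).trans ⟨?_, fun hg => ⟨g, hg, fun _ => rfl⟩⟩
    rintro ⟨m, hm, e⟩
    have : g = m := ContinuousMap.ext e
    exact this ▸ hm
  subst this
  rfl

theorem exists_add (σ : IntegralCone X) (x y : σ.carrier) :
    ∃ z : σ.carrier, ∀ m : σ.M, m.1 z = m.1 x + m.1 y := by
  obtain ⟨F, -, h⟩ := σ.rational
  let e : σ.carrier → (σ.M →ₗ[ℤ] ℝ) := fun x =>
    { toFun := fun m => m.1 x, map_add' := fun a b => rfl, map_smul' := fun c a => by simp }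
  obtain ⟨z, hz⟩ := (h (e x + e y)).2 fun m hm =>
    add_nonneg ((h (e x)).1 ⟨x, fun _ => rfl⟩ m hm) ((h (e y)).1 ⟨y, fun _ => rfl⟩ m hm)
  exact ⟨z, fun m => (hz m).symm⟩

theorem nonempty (σ : IntegralCone X) : Nonempty σ.carrier := by
  obtain ⟨F, -, h⟩ := σ.rational
  obtain ⟨x, -⟩ := (h 0).2 (by simp)
  exact ⟨x⟩

/-- A cone is not a finite union of proper faces. -/
theorem exists_not_mem_faces (σ : IntegralCone X) (A : Set (IntegralCone X)) (hA : A.Finite)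
    (hf : ∀ ρ ∈ A, ρ.IsFace σ ∧ ¬ σ.carrier ⊆ ρ.carrier) :
    ∃ x : σ.carrier, ∀ ρ ∈ A, x.1 ∉ ρ.carrier := by
  induction A, hA using Set.Finite.induction_on with
  | empty => exact ⟨σ.nonempty.some, by simp⟩
  | @insert ρ A _ _ ih =>
    obtain ⟨x, hx⟩ := ih fun ρ' h => hf ρ' (Set.mem_insert_of_mem _ h)
    obtain ⟨hρ, hn⟩ := hf ρ (Set.mem_insert _ _)
    obtain ⟨y, hy, hyρ⟩ := Set.not_subset.1 hn
    obtain ⟨z, hz⟩ := σ.exists_add x ⟨y, hy⟩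
    have key : ∀ ρ' : IntegralCone X, ρ'.IsFace σ → z.1 ∈ ρ'.carrier →
        x.1 ∈ ρ'.carrier ∧ y ∈ ρ'.carrier := by
      rintro ρ' ⟨-, m, hm, hpos, e⟩ hzρ
      rw [e] at hzρ ⊢
      obtain ⟨z', hz', e'⟩ := hzρ
      obtain rfl : z' = z := Subtype.ext e'
      have h1 := hz ⟨m, hm⟩
      have h2 : m z' = 0 := hz'
      have h3 := hpos x
      have h4 := hpos ⟨y, hy⟩
      simp only at h1
      exact ⟨⟨x, by change m x = 0; linarith, rfl⟩, ⟨⟨y, hy⟩, by change m _ = 0; linarith, rfl⟩⟩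
    refine ⟨z, fun ρ' h' hzρ => ?_⟩
    rcases Set.mem_insert_iff.1 h' with rfl | h'
    · exact hyρ (key _ hρ hzρ).2
    · exact hx ρ' h' (key ρ' (hf ρ' (Set.mem_insert_of_mem _ h')).1 hzρ).1

end IntegralCone

namespace ConeComplex

variable {X : Type u} [TopologicalSpace X]

/-- A cone of the complex that is contained in another one is a face of it. -/
theorem isFace_of_subset (S : ConeComplex X) {τ σ : IntegralCone X} (hτ : τ ∈ S.cones)
    (hσ : σ ∈ S.cones) (h : τ.carrier ⊆ σ.carrier) : τ.IsFace σ := by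
  by_contra hn
  obtain ⟨x, hx⟩ := τ.exists_not_mem_faces {ρ | ρ ∈ S.cones ∧ ρ.IsFace τ ∧ ρ.IsFace σ}
    (S.finite.subset fun _ h => h.1) fun ρ hρ => ⟨hρ.2.1, fun hs => hn <| by
      rw [← IntegralCone.IsSubcone.antisymm hρ.2.1.1 hs]
      exact hρ.2.2⟩
  obtain ⟨ρ, hρ, h1, h2, hxρ⟩ := S.inter τ hτ σ hσ x.1 ⟨x.2, h x.2⟩
  exact hx ρ ⟨hρ, h1, h2⟩ hxρ

/-- The cones of the complex, ordered by inclusion. -/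
instance (S : ConeComplex X) : PartialOrder S.cones where
  le τ σ := τ.1.carrier ⊆ σ.1.carrier
  le_refl _ := subset_rfl
  le_trans _ _ _ := Set.Subset.trans
  le_antisymm τ σ h h' :=
    Subtype.ext ((S.isFace_of_subset τ.2 σ.2 h).1.antisymm h')

theorem isFace (S : ConeComplex X) {τ σ : S.cones} (h : τ ≤ σ) : τ.1.IsFace σ.1 :=
  S.isFace_of_subset τ.2 σ.2 h

instance (S : ConeComplex X) : Finite S.cones := S.finite

/-- The poic-complex `p(Σ)` of a cone complex `Σ`: the poset of cones of `Σ`, ordered by inclusion,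
with the tautological association of cones. -/
def toPoic (S : ConeComplex X) : PoicComplex.{u} where
  C := S.cones
  essFinite := Quotient.finite _
  cone σ := σ.1.poic
  map h := IntegralCone.incl (S.isFace h).1
  map_id σ := rfl
  map_comp _ _ := rfl
  isFaceEmbedding h := IntegralCone.incl_isFaceEmbedding (S.isFace h)
  exists_face σ τ := by
    rintro ⟨-, f, hf, rfl⟩
    obtain ⟨m, rfl⟩ := (Module.bijective_dual_eval ℤ σ.1.M).2 f
    have hpos : ∀ x, 0 ≤ (-m).1 x := by
      intro x
      obtain ⟨v, hv⟩ := σ.1.exists_represents x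
      have h1 := hf v ⟨x, hv⟩
      have h2 : m.1 x ≤ 0 := (hv m).symm.trans_le h1
      exact neg_nonneg.2 h2
    obtain ⟨τ, hτ, hface, hz⟩ := S.face_mem σ.1 σ.2 _ (-m).2 hpos
    have hle : τ.carrier ⊆ σ.1.carrier := hface.1.1
    refine ⟨⟨τ, hτ⟩, hle, ?_⟩
    refine (IntegralCone.image_incl hface.1).trans ?_
    ext v
    constructor
    · rintro ⟨x, hx, hv⟩
      refine ⟨⟨x, hv⟩, ?_⟩
      rw [hz] at hx
      obtain ⟨y, hy, e⟩ := hx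
      obtain rfl : y = x := Subtype.ext e
      have h1 : -(m.1 y) = 0 := hy
      exact ((hv m).trans (neg_eq_zero.1 h1)).ge
    · rintro ⟨⟨x, hv⟩, h0⟩
      refine ⟨x, ?_, hv⟩
      rw [hz]
      have h1 : 0 ≤ m.1 x := (hv m) ▸ h0
      refine ⟨x, le_antisymm ?_ (hpos x), rfl⟩
      exact neg_nonpos.2 h1
  unique_face {τ τ' σ} h h' e := by
    have key : ∀ {τ τ' : S.cones} (h : τ ≤ σ) (h' : τ' ≤ σ),
        (IntegralCone.incl (S.isFace h).1).real '' τ.1.poic.carrier =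
          (IntegralCone.incl (S.isFace h').1).real '' τ'.1.poic.carrier → τ ≤ τ' := by
      intro τ τ' h h' e y hy
      obtain ⟨v, hv⟩ := σ.1.exists_represents ⟨y, h hy⟩
      have e' := ((IntegralCone.image_incl (S.isFace h).1).symm.trans e).trans
        (IntegralCone.image_incl (S.isFace h').1)
      have hmem : v ∈ {v | ∃ x : σ.1.carrier, x.1 ∈ τ.1.carrier ∧ σ.1.Represents v x} :=
        ⟨_, hy, hv⟩
      rw [e'] at hmem
      obtain ⟨x, hx, hv'⟩ := hmem
      have : x = ⟨y, h hy⟩ := by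
        apply σ.1.isEmbedding.injective
        funext m
        exact (hv' m).symm.trans (hv m)
      rw [this] at hx
      exact hx
    exact ⟨key h h' e, key h' h e.symm⟩

end ConeComplex

/-! ### Minkowski weights and tropical cycles of weakly embedded cone complexes -/

namespace WeakEmbedding

variable {X : Type u} [TopologicalSpace X] {S : ConeComplex X}
  {N : Type u} [AddCommGroup N]

theorem continuous_form (φ : WeakEmbedding S N) (n : Module.Dual ℤ N) :
    Continuous fun x => realForm n (φ.toFun x) := by
  have : IsModuleTopology ℝ (NR N) := ⟨rfl⟩
  exact (IsModuleTopology.continuous_of_linearMap (realForm n)).comp φ.continuous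

/-- The pullback of integral linear forms along the weak embedding, `N^∨ → M^σ`. -/
def pull (φ : WeakEmbedding S N) (σ : S.cones) : Module.Dual ℤ N →ₗ[ℤ] σ.1.M where
  toFun n := ⟨⟨fun x => realForm n (φ.toFun x), (φ.continuous_form n).comp continuous_subtype_val⟩,
    by
      obtain ⟨m, hm, e⟩ := φ.integral σ.1 σ.2 n
      convert hm
      exact (e _).symm⟩
  map_add' a b := by
    ext x
    exact congrArg (fun f : NR N →ₗ[ℝ] ℝ => f (φ.toFun x)) (map_add (Module.Dual.baseChange ℝ) a b)
  map_smul' c a := by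
    ext x
    have h := congrArg (fun f : NR N →ₗ[ℝ] ℝ => f (φ.toFun x))
      (map_smul (Module.Dual.baseChange ℝ) c a)
    exact h

/-- A weak embedding of `Σ` is one of every proper subdivision of `Σ`. -/
def ofSubdivision (φ : WeakEmbedding S N) {S' : ConeComplex X} (h : S'.IsProperSubdivision S) :
    WeakEmbedding S' N where
  toFun := φ.toFun
  continuous := φ.continuous
  integral σ' hσ' n := by
    obtain ⟨σ, hσ, hs⟩ := h σ' hσ'
    obtain ⟨m, hm, e⟩ := φ.integral σ hσ n
    let g := IntegralCone.restrict hs ⟨m, hm⟩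
    exact ⟨g.1, g.2, fun x => e (Set.inclusion hs.1 x)⟩

variable [Module.Free ℤ N] [Module.Finite ℤ N]

/-- The integral linear map `N^σ → N` given by the weak embedding on the cone `σ`. -/
def linAt (φ : WeakEmbedding S N) (σ : S.cones) : σ.1.N →ₗ[ℤ] N :=
  (Module.evalEquiv ℤ N).symm.toLinearMap ∘ₗ (φ.pull σ).dualMap

/-- The morphism `p(Σ) → N_ℝ` defined by a weak embedding of `Σ`, that is, the structure of a linear
poic-complex on `p(Σ)`. -/
def toPoic (φ : WeakEmbedding S N) : PoicComplex.Hom S.toPoic (PoicComplex.ofLattice N) where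
  obj _ := PUnit.unit
  mono _ _ _ := le_refl _
  η σ := ⟨φ.linAt σ, fun _ _ => Set.mem_univ _⟩
  naturality h := by
    ext1
    rfl
  not_in_proper_face σ τ hτ _ := by
    obtain ⟨-, f, hf, rfl⟩ := hτ
    refine Set.Subset.antisymm Set.inter_subset_left fun x hx => ⟨hx, ?_⟩
    have := hf (-x) (Set.mem_univ _)
    simpa using this

end WeakEmbedding

namespace ConeComplex

variable {X : Type u} [TopologicalSpace X] {S : ConeComplex X}
  {N : Type u} [AddCommGroup N] [Module.Free ℤ N] [Module.Finite ℤ N]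

/-- The set `Σ_(k)` of `k`-dimensional cones. -/
abbrev conesOfDim (S : ConeComplex X) (k : ℕ) : Set S.cones := {σ | σ.1.dim = k}

/-- The `k`-dimensional weights on a cone complex. -/
abbrev Weights (S : ConeComplex X) (k : ℕ) : Type u := S.conesOfDim k → ℤ

/-- The inclusion `N^τ → N^σ` for cones `τ ⊆ σ`, dual to the restriction of functions. -/
def latticeIncl (S : ConeComplex X) {τ σ : S.cones} (h : τ ≤ σ) : τ.1.N →ₗ[ℤ] σ.1.N :=
  (IntegralCone.restrict (S.isFace h).1).dualMap

/-- The lattice normal vector `u_{σ/τ} ∈ N / N_τ`, where `N_τ` is the image of `N^τ` in `N`: the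
image of the generator of `N^σ / N^τ` that lies in the projection of `σ ∩ N^σ`. -/
def normalVector (φ : WeakEmbedding S N) {τ σ : S.cones} (h : τ ≤ σ) :
    N ⧸ LinearMap.range (φ.linAt τ) :=
  Classical.epsilon fun u => ∃ w : σ.1.N,
    (∃ x : σ.1.carrier, ∀ m : σ.1.M, ((w m : ℤ) : ℝ) = m.1 x) ∧
    LinearMap.range (S.latticeIncl h) ⊔ Submodule.span ℤ {w} = ⊤ ∧
    u = Submodule.Quotient.mk (φ.linAt σ w)

/-- The group `M_k(Σ)` of `k`-dimensional Minkowski weights of a weakly embedded cone complex: for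
every `(k-1)`-dimensional cone `τ`, with `σ` running over the `k`-dimensional cones containing `τ`,
`∑ c(σ) u_{σ/τ} = 0`. -/
def minkowski (φ : WeakEmbedding S N) (k : ℕ) : AddSubgroup (S.Weights k) where
  carrier := {c | ∀ τ : S.cones, τ.1.dim + 1 = k →
    ∑ᶠ σ : {σ : S.conesOfDim k // τ ≤ σ.1}, c σ.1 • normalVector φ σ.2 = 0}
  zero_mem' := by
    intro τ _
    simp
  add_mem' {a b} ha hb := by
    intro τ hτ
    simp only [Pi.add_apply, add_smul]
    rw [finsum_add_distrib (Set.toFinite _) (Set.toFinite _), ha τ hτ, hb τ hτ, add_zero]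
  neg_mem' {a} ha := by
    intro τ hτ
    simp only [Pi.neg_apply, neg_smul]
    rw [finsum_neg_distrib, ha τ hτ, neg_zero]

open Classical in
/-- The pullback of a weight along a subdivision `Σ'` of `Σ`: the weight of a `k`-dimensional cone
`σ'` is `c(σ)` if `σ'` lies in a (necessarily unique) `k`-dimensional cone `σ` of `Σ`, and `0`
otherwise. -/
def pullback {k : ℕ} (c : S.Weights k) (S' : ConeComplex X) : S'.Weights k :=
  fun σ' => if h : ∃ σ : S.conesOfDim k, σ'.1.1.carrier ⊆ σ.1.1.carrier then c h.choose else 0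

/-- The proper subdivisions of `Σ`. -/
abbrev ProperSubd (S : ConeComplex X) : Type u := {S' : ConeComplex X // S'.IsProperSubdivision S}

open Classical in
/-- The subgroup generated by the differences `[Σ', c] - [Σ'', c'']`, where `Σ''` is a proper
subdivision of `Σ'` and `c''` is the pullback of `c`. -/
def cycleRelations (φ : WeakEmbedding S N) (k : ℕ) :
    AddSubgroup (⨁ S' : S.ProperSubd, minkowski (φ.ofSubdivision S'.2) k) :=
  AddSubgroup.closure {z | ∃ (S' S'' : S.ProperSubd) (c : minkowski (φ.ofSubdivision S'.2) k)
    (c'' : minkowski (φ.ofSubdivision S''.2) k),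
    S''.1.IsProperSubdivision S'.1 ∧ c''.1 = pullback c.1 S''.1 ∧
      z = DirectSum.of (fun S' : S.ProperSubd => minkowski (φ.ofSubdivision S'.2) k) S' c -
        DirectSum.of (fun S' : S.ProperSubd => minkowski (φ.ofSubdivision S'.2) k) S'' c''}

/-- The group `Z_k(Σ)` of tropical `k`-cycles of a weakly embedded cone complex: the colimit of the
groups `M_k(Σ')` over the proper subdivisions `Σ'` of `Σ`. -/
abbrev Cycles (φ : WeakEmbedding S N) (k : ℕ) : Type u :=
  (⨁ S' : S.ProperSubd, minkowski (φ.ofSubdivision S'.2) k) ⧸ cycleRelations φ k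

open Classical in
/-- The class in `Z_k(Σ)` of a Minkowski weight on a proper subdivision. -/
def Cycles.mk (φ : WeakEmbedding S N) (k : ℕ) (S' : S.ProperSubd)
    (c : minkowski (φ.ofSubdivision S'.2) k) : Cycles φ k :=
  QuotientAddGroup.mk
    (DirectSum.of (fun S' : S.ProperSubd => minkowski (φ.ofSubdivision S'.2) k) S' c)

/-- The bijection `Σ_(k) → [p(Σ)](k)`. -/
def classEquiv (S : ConeComplex X) (k : ℕ) : S.conesOfDim k ≃ S.toPoic.classesOfDim k :=
  Equiv.ofBijective (fun σ => ⟨S.toPoic.cls σ.1, σ.1, σ.2, rfl⟩) <| by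
    constructor
    · intro σ τ h
      have h' := Quotient.exact (congrArg Subtype.val h)
      exact Subtype.ext (le_antisymm (α := S.cones) h'.1 h'.2)
    · rintro ⟨_, σ, hσ, rfl⟩
      exact ⟨⟨σ, hσ⟩, rfl⟩

/-- The identification of weights on `Σ` with weights on `p(Σ)`. -/
def weightEquiv (S : ConeComplex X) (k : ℕ) : S.Weights k ≃+ S.toPoic.Weights k :=
  AddEquiv.arrowCongr (S.classEquiv k) (AddEquiv.refl ℤ)

/-- A morphism `p(Σ') → p(Σ)` lies over the identity of the underlying space `X` if it maps, for
every cone `σ'` of `Σ'`, each point of `σ'` to the same point of the cone `S(σ')` of `Σ`. -/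
def OverIdentity {S' S : ConeComplex X} (F : PoicComplex.Hom S'.toPoic S.toPoic) : Prop :=
  ∀ (σ' : S'.cones) (x : σ'.1.carrier) (v : NR σ'.1.N), σ'.1.Represents v x →
    ∃ h : x.1 ∈ (F.obj σ' : S.cones).1.carrier,
      (F.obj σ' : S.cones).1.Represents ((F.η σ').real v) ⟨x.1, h⟩

end ConeComplex
end

end Trop

/-!
The proof rests on the fact that the subdivisions of `p(Σ)` are, up to isomorphism, exactly the
poic-complexes `p(Σ')` of the proper subdivisions `Σ'` of `Σ`.

Points of `|Σ|` are compared through relative interiors. Every point of `|Σ|` lies in the relative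
interior of exactly one cone (`ConeComplex.exists_le_mem_relintPts`,
`ConeComplex.le_of_mem_relintPts`), and every morphism of poic-complexes maps relative interiors into
relative interiors (`PoicComplex.Hom.maps_relint`). Hence a morphism to `p(Σ)` is determined by its
effect on points (`ConeComplex.hom_ext`), and the conditions on a subdivision of `p(Σ)` amount to
conditions on a decomposition of `|Σ|` into relatively open cells
(`ConeComplex.isSubdivision_of_openCellPts`). For a proper subdivision `Σ'`, mapping each cone to the
smallest cone of `Σ` that contains it gives the unique subdivision `p(Σ') → p(Σ)` over the identity of
`|Σ|` (`ConeComplex.subdivisionHom`). The balancing conditions of `Σ'` and `p(Σ')` agree because both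
kinds of lattice normal vectors are selected by the same property
(`ConeComplex.mem_minkowski_iff`).

Conversely, let `F : Υ → p(Σ)` be a subdivision. The images of the cones of `Υ` in `|Σ|`, with the
restrictions of the integral linear functions of `Σ`, form a proper subdivision of `Σ`
(`ConeComplex.cellComplex`), and `Υ` is isomorphic to its poic-complex (`ConeComplex.toCells`). The
point that needs an argument is that the lattice of a cone `p` of `Υ`, which is only required to
embed in the lattice of `F(p)`, is saturated there (`ConeComplex.cellDual_surjective`). Indeed, the
cells over `F(p)` that have smaller dimension lie in finitely many proper subspaces, and the cells
are closed, so `p` is a face of a cone over `F(p)` of full dimension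
(`ConeComplex.exists_full_dim_cell`), whose lattice is all of the lattice of `F(p)`.

The two constructions are compatible with refinements (`ConeComplex.weightEquiv_pullback`,
`ConeComplex.cellWeightEquiv_symm_pullback`), so they induce homomorphisms between the two groups of
tropical cycles. These are inverse to each other, because the cells of `p(Σ')` are the cones of `Σ'`
and because `toCells` is itself a subdivision (`ConeComplex.exists_cyclesEquiv`).
-/

namespace Trop

/-! ### The topology of the real vector space of a lattice -/

instance NR.isModuleTopology (N : Type u) [AddCommGroup N] : IsModuleTopology ℝ (NR N) := ⟨rfl⟩

instance NR.isTopologicalAddGroup (N : Type u) [AddCommGroup N] : IsTopologicalAddGroup (NR N) :=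
  IsModuleTopology.topologicalAddGroup ℝ (NR N)

theorem NR.continuous_linear {N : Type u} [AddCommGroup N] {E : Type*} [AddCommGroup E] [Module ℝ E]
    [TopologicalSpace E] [ContinuousAdd E] [ContinuousSMul ℝ E] (f : NR N →ₗ[ℝ] E) :
    Continuous f :=
  IsModuleTopology.continuous_of_linearMap f

instance NR.t2Space (N : Type u) [AddCommGroup N] [Module.Free ℤ N] [Module.Finite ℤ N] :
    T2Space (NR N) := by
  let e := (Module.finBasis ℝ (NR N)).equivFun
  exact T2Space.of_injective_continuous e.injective (NR.continuous_linear e.toLinearMap)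

theorem NR.finrank_eq (N : Type u) [AddCommGroup N] [Module.Free ℤ N] [Module.Finite ℤ N] :
    Module.finrank ℝ (NR N) = Module.finrank ℤ N :=
  Module.finrank_baseChange

theorem NR.one_tmul_injective (N : Type u) [AddCommGroup N] [Module.Free ℤ N] :
    Function.Injective fun n : N => (1 : ℝ) ⊗ₜ[ℤ] n := by
  have h := Module.Flat.rTensor_preserves_injective_linearMap (M := N)
    (Algebra.linearMap ℤ ℝ) (RingHom.injective_int (algebraMap ℤ ℝ))
  intro a b hab
  apply (TensorProduct.lid ℤ N).symm.injective
  apply h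
  simpa using hab

theorem realForm_eq_zero {N : Type u} [AddCommGroup N] {f : Module.Dual ℤ N}
    (h : realForm f = 0) : f = 0 := by
  ext n
  have h1 := congrArg (fun g => g ((1 : ℝ) ⊗ₜ[ℤ] n)) h
  simpa using h1

@[simp] theorem realForm_zero {N : Type u} [AddCommGroup N] :
    realForm (0 : Module.Dual ℤ N) = 0 := by
  simp [realForm]

theorem realMap_tmul {N : Type u} {P : Type v} [AddCommGroup N] [AddCommGroup P] (f : N →ₗ[ℤ] P)
    (r : ℝ) (n : N) : realMap f (r ⊗ₜ[ℤ] n) = r ⊗ₜ[ℤ] f n := by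
  simp [realMap]

theorem realMap_injective {N : Type u} {P : Type v} [AddCommGroup N] [AddCommGroup P]
    (f : N →ₗ[ℤ] P) (hf : Function.Injective f) : Function.Injective (realMap f) :=
  Module.Flat.lTensor_preserves_injective_linearMap (M := ℝ) f hf

theorem realMap_comp {N P Q : Type u} [AddCommGroup N] [AddCommGroup P] [AddCommGroup Q]
    (g : P →ₗ[ℤ] Q) (f : N →ₗ[ℤ] P) : realMap (g ∘ₗ f) = realMap g ∘ₗ realMap f := by
  simp [realMap, LinearMap.baseChange_comp]

theorem realMap_inj {N P : Type u} [AddCommGroup N] [AddCommGroup P] [Module.Free ℤ P]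
    {f g : N →ₗ[ℤ] P} (h : realMap f = realMap g) : f = g := by
  ext n
  apply NR.one_tmul_injective P
  simpa [realMap] using congrArg (fun g => g ((1 : ℝ) ⊗ₜ[ℤ] n)) h

/-! ### Partially open cones -/

section PartiallyOpenCone

variable {N : Type u} [AddCommGroup N] {σ : Set (NR N)}

theorem IsPartiallyOpenCone.add_mem (h : IsPartiallyOpenCone σ) {x y : NR N} (hx : x ∈ σ)
    (hy : y ∈ σ) : x + y ∈ σ := by
  obtain ⟨-, F, G, -, -, rfl⟩ := h
  refine ⟨fun f hf => ?_, fun g hg => ?_⟩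
  · rw [map_add]
    exact add_nonneg (hx.1 f hf) (hy.1 f hf)
  · rw [map_add]
    exact add_pos (hx.2 g hg) (hy.2 g hg)

/-- An integral linear form that vanishes on a spanning set is zero. -/
theorem eq_zero_of_span {f : Module.Dual ℤ N} (hσ : Submodule.span ℝ σ = ⊤)
    (h : ∀ x ∈ σ, realForm f x = 0) : f = 0 := by
  apply realForm_eq_zero
  apply LinearMap.ext_on hσ
  intro x hx
  simpa using h x hx

theorem mem_interior_of_pos {F G : Set (Module.Dual ℤ N)} (hF : F.Finite) (hG : G.Finite) {x : NR N}
    (h : ∀ f ∈ F, f ≠ 0 → 0 < realForm f x) (h' : ∀ g ∈ G, 0 < realForm g x) :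
    x ∈ interior {x | (∀ f ∈ F, 0 ≤ realForm f x) ∧ ∀ g ∈ G, 0 < realForm g x} := by
  have hopen : ∀ A : Set (Module.Dual ℤ N), A.Finite →
      IsOpen (⋂ f ∈ A, {y : NR N | 0 < realForm f y}) := fun A hA =>
    hA.isOpen_biInter fun f _ => isOpen_lt continuous_const (NR.continuous_linear _)
  refine mem_interior.2 ⟨_, ?_, (hopen (F \ {0}) (hF.subset Set.sdiff_subset)).inter (hopen G hG),
    Set.mem_iInter₂.2 fun f hf => h f hf.1 hf.2, Set.mem_iInter₂.2 h'⟩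
  rintro y ⟨hy1, hy2⟩
  rw [Set.mem_iInter₂] at hy1 hy2
  refine ⟨fun f hf => ?_, hy2⟩
  by_cases h0 : f = 0
  · simp [h0]
  · exact le_of_lt (hy1 f ⟨hf, h0⟩)

/-- The interior of a full-dimensional partially open cone consists of the points that lie on no
proper face. -/
theorem mem_interior_iff (h : IsPartiallyOpenCone σ) (hσ : Submodule.span ℝ σ = ⊤) {x : NR N} :
    x ∈ interior σ ↔ x ∈ σ ∧ ∀ f : Module.Dual ℤ N, (∀ y ∈ σ, 0 ≤ realForm f y) →
      realForm f x = 0 → f = 0 := by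
  constructor
  · refine fun hx => ⟨interior_subset hx, fun f hf h0 => ?_⟩
    apply realForm_eq_zero
    refine LinearMap.ext fun u => ?_
    -- near `x`, both `x + t u` and `x - t u` stay in `σ`
    have key : ∀ u : NR N, 0 ≤ realForm f u := by
      intro u
      have hc : Continuous fun t : ℝ => x + t • u := by fun_prop
      have hn : (fun t : ℝ => x + t • u) ⁻¹' σ ∈ 𝓝 (0 : ℝ) :=
        hc.continuousAt.preimage_mem_nhds (by simpa using mem_interior_iff_mem_nhds.1 hx)
      obtain ⟨ε, hε, hb⟩ := Metric.mem_nhds_iff.1 hn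
      have hm : x + (ε / 2) • u ∈ σ := hb (by simp [abs_of_pos hε]; linarith)
      have h1 := hf _ hm
      rw [map_add, h0, map_smul, zero_add, smul_eq_mul] at h1
      exact nonneg_of_mul_nonneg_right h1 (by linarith)
    have h1 := key u
    have h2 := key (-u)
    rw [map_neg] at h2
    exact le_antisymm (neg_nonneg.1 h2) h1
  · rintro ⟨hx, hf⟩
    obtain ⟨-, F, G, hF, hG, rfl⟩ := h
    refine mem_interior_of_pos hF hG ?_ hx.2
    intro f hfF hf0
    refine lt_of_le_of_ne (hx.1 f hfF) fun h0 => hf0 ?_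
    exact hf f (fun y hy => hy.1 f hfF) h0.symm

theorem interior_nonempty (h : IsPartiallyOpenCone σ) (hσ : Submodule.span ℝ σ = ⊤) :
    (interior σ).Nonempty := by
  have h' := h
  obtain ⟨⟨x₀, hx₀⟩, F, G, hF, hG, e⟩ := h'
  have key : ∀ F' : Set (Module.Dual ℤ N), F'.Finite → F' ⊆ F \ {0} →
      ∃ x ∈ σ, ∀ f ∈ F', 0 < realForm f x := by
    intro F' hF'
    induction F', hF' using Set.Finite.induction_on with
    | empty => exact fun _ => ⟨x₀, hx₀, by simp⟩
    | @insert f F' _ _ ih =>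
      intro hs
      obtain ⟨x, hx, hxf⟩ := ih ((Set.subset_insert _ _).trans hs)
      have hpos : ∀ f ∈ F, ∀ y ∈ σ, 0 ≤ realForm f y := fun f hf y hy => by
        rw [e] at hy
        exact hy.1 f hf
      obtain ⟨hfF, hf0⟩ := hs (Set.mem_insert _ _)
      have : ∃ y ∈ σ, 0 < realForm f y := by
        by_contra! hn
        exact hf0 (eq_zero_of_span hσ fun y hy => le_antisymm (hn y hy) (hpos f hfF y hy))
      obtain ⟨y, hy, hfy⟩ := this
      refine ⟨x + y, h.add_mem hx hy, fun g hg => ?_⟩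
      rw [map_add]
      rcases Set.mem_insert_iff.1 hg with rfl | hg
      · exact add_pos_of_nonneg_of_pos (hpos _ hfF x hx) hfy
      · exact add_pos_of_pos_of_nonneg (hxf g hg)
          (hpos g (hs (Set.mem_insert_of_mem _ hg)).1 y hy)
  obtain ⟨x, hx, hxF⟩ := key _ (hF.subset Set.sdiff_subset) subset_rfl
  rw [e] at hx ⊢
  exact ⟨x, mem_interior_of_pos hF hG (fun f hf h0 => hxF f ⟨hf, h0⟩) hx.2⟩

/-- A closed partially open cone is an intersection of closed half-spaces. -/
theorem IsPartiallyOpenCone.eq_of_isClosed (h : IsPartiallyOpenCone σ) (hc : IsClosed σ) :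
    ∃ H : Set (Module.Dual ℤ N), H.Finite ∧ σ = {x | ∀ f ∈ H, 0 ≤ realForm f x} := by
  obtain ⟨⟨x₀, hx₀⟩, F, G, hF, hG, e⟩ := h
  refine ⟨F ∪ G, hF.union hG, Set.Subset.antisymm ?_ fun x hx => ?_⟩
  · intro x hx f hf
    rw [e] at hx
    rcases hf with hf | hf
    · exact hx.1 f hf
    · exact (hx.2 f hf).le
  · -- `x` is the limit of the points `x + t x₀` of `σ`
    have hlim : Filter.Tendsto (fun t : ℝ => x + t • x₀) (𝓝[>] 0) (𝓝 x) := by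
      have hc : Continuous fun t : ℝ => x + t • x₀ := by fun_prop
      have := hc.tendsto 0
      simp only [zero_smul, add_zero] at this
      exact this.mono_left nhdsWithin_le_nhds
    refine hc.mem_of_tendsto hlim ?_
    filter_upwards [self_mem_nhdsWithin] with t ht
    rw [e] at hx₀ ⊢
    refine ⟨fun f hf => ?_, fun g hg => ?_⟩
    · rw [map_add, map_smul]
      exact add_nonneg (hx f (Or.inl hf)) (mul_nonneg (le_of_lt ht) (hx₀.1 f hf))
    · rw [map_add, map_smul]
      exact add_pos_of_nonneg_of_pos (hx g (Or.inr hg)) (mul_pos ht (hx₀.2 g hg))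

end PartiallyOpenCone

/-- A non-empty open subset of `N_ℝ` is not covered by finitely many proper subspaces. -/
theorem not_subset_biUnion_submodule {N : Type u} [AddCommGroup N] [Module.Free ℤ N]
    [Module.Finite ℤ N] {ι : Type*} {A : Set ι} (hA : A.Finite) (L : ι → Submodule ℝ (NR N))
    (hL : ∀ i ∈ A, L i ≠ ⊤) {V : Set (NR N)} (hV : IsOpen V) (hne : V.Nonempty) :
    ¬ V ⊆ ⋃ i ∈ A, (L i : Set (NR N)) := by
  have key : interior (⋃ i ∈ A, (L i : Set (NR N))) = ∅ := by
    induction A, hA using Set.Finite.induction_on with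
    | empty => simp
    | @insert i A _ _ ih =>
      rw [Set.biUnion_insert, interior_union_isClosed_of_interior_empty
        (Submodule.closed_of_finiteDimensional _) (ih fun j hj => hL j (Set.mem_insert_of_mem _ hj))]
      by_contra hn
      exact hL i (Set.mem_insert _ _)
        (Submodule.eq_top_of_nonempty_interior' _ (Set.nonempty_iff_ne_empty.2 hn))
  intro hs
  exact (hne.mono (interior_maximal hs hV)).ne_empty key

/-! ### Faces and relative interiors in poic-complexes -/

namespace PoicComplex

/-- Every point of a cone lies in the relative interior of one of its faces. -/
theorem exists_face_relint (Φ : PoicComplex.{u}) (q : Φ.C) (x : NR (Φ.cone q).N)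
    (hx : x ∈ (Φ.cone q).carrier) :
    ∃ (p : Φ.C) (h : p ≤ q), ∃ y ∈ (Φ.cone p).relint, (Φ.map h).real y = x := by
  induction hd : (Φ.cone q).dim using Nat.strong_induction_on generalizing q with
  | _ d ih =>
    by_cases hi : x ∈ interior (Φ.cone q).carrier
    · exact ⟨q, le_refl q, x, hi, by simp [Φ.map_id]⟩
    rw [mem_interior_iff (Φ.cone q).isCone (Φ.cone q).full] at hi
    push Not at hi
    obtain ⟨f, hf, hfx, hf0⟩ := hi hx
    obtain ⟨p, h, hp⟩ := Φ.exists_face q ((Φ.cone q).carrier ∩ {y | 0 ≤ realForm (-f) y})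
      ⟨⟨x, hx, by simp [IntegralCone.realForm_neg, hfx]⟩, -f, fun y hy => by
        simpa [IntegralCone.realForm_neg] using hf y hy, rfl⟩
    have hxp : x ∈ (Φ.map h).real '' (Φ.cone p).carrier := by
      rw [hp]
      exact ⟨hx, by simp [IntegralCone.realForm_neg, hfx]⟩
    obtain ⟨y, hy, rfl⟩ := hxp
    have hinj := (Φ.isFaceEmbedding h).1
    have hcomp : realForm f ∘ₗ (Φ.map h).real = 0 := by
      apply LinearMap.ext_on (Φ.cone p).full
      intro z hz
      have hz' : (Φ.map h).real z ∈ (Φ.cone q).carrier ∩ {y | 0 ≤ realForm (-f) y} :=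
        hp ▸ ⟨z, hz, rfl⟩
      have h2 := hz'.2
      simp only [Set.mem_ofPred_eq, IntegralCone.realForm_neg] at h2
      exact le_antisymm (neg_nonneg.1 h2) (hf _ hz'.1)
    have hlt : (Φ.cone p).dim < d := by
      rw [← hd, Poic.dim, Poic.dim, ← NR.finrank_eq, ← NR.finrank_eq]
      refine lt_of_le_of_ne (LinearMap.finrank_le_finrank_of_injective hinj) fun he => hf0 ?_
      have hs := (LinearMap.injective_iff_surjective_of_finrank_eq_finrank he).1 hinj
      apply realForm_eq_zero
      refine LinearMap.ext fun z => ?_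
      obtain ⟨z, rfl⟩ := hs z
      exact LinearMap.congr_fun hcomp z
    obtain ⟨r, h', z, hz, e⟩ := ih _ hlt p y hy rfl
    refine ⟨r, h'.trans h, z, hz, ?_⟩
    rw [Φ.map_comp h' h, Poic.Hom.real_comp, LinearMap.comp_apply, e]

/-- A morphism maps relative interiors into relative interiors. -/
theorem Hom.maps_relint {Φ Ψ : PoicComplex.{u}} (F : Hom Φ Ψ) (p : Φ.C) {v : NR (Φ.cone p).N}
    (hv : v ∈ (Φ.cone p).relint) : (F.η p).real v ∈ (Ψ.cone (F.obj p)).relint := by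
  rw [Poic.relint, mem_interior_iff (Poic.isCone _) (Poic.full _)] at hv ⊢
  refine ⟨(F.η p).maps v hv.1, fun f hf h0 => ?_⟩
  have h1 := hv.2 (f ∘ₗ (F.η p).lin) (fun y hy => by
    rw [← Poic.Hom.realForm_real]
    exact hf _ ((F.η p).maps y hy)) (by rw [← Poic.Hom.realForm_real, h0])
  have hsub : (F.η p).real '' (Φ.cone p).carrier ⊆
      (Ψ.cone (F.obj p)).carrier ∩ {x | 0 ≤ realForm (-f) x} := by
    rintro _ ⟨y, hy, rfl⟩
    refine ⟨(F.η p).maps y hy, ?_⟩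
    simp [IntegralCone.realForm_neg, Poic.Hom.realForm_real, h1]
  have h2 := F.not_in_proper_face p _ ⟨((Φ.cone p).isCone.1.image _).mono hsub, -f, fun y hy => by
    simpa [IntegralCone.realForm_neg] using hf y hy, rfl⟩ hsub
  apply eq_zero_of_span (Ψ.cone (F.obj p)).full
  intro y hy
  have h3 := hy
  rw [← h2] at h3
  have h4 := h3.2
  simp only [Set.mem_ofPred_eq, IntegralCone.realForm_neg] at h4
  exact le_antisymm (by linarith) (hf y hy)

theorem relint_nonempty (Φ : PoicComplex.{u}) (p : Φ.C) : (Φ.cone p).relint.Nonempty :=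
  interior_nonempty (Φ.cone p).isCone (Φ.cone p).full

end PoicComplex

/-! ### Relative interiors and subcones of integral cones -/

namespace IntegralCone

variable {X : Type u} [TopologicalSpace X]

/-- The relative interior of an integral cone: the points that lie on no proper face, that is, at
which no non-zero non-negative function of the lattice vanishes. -/
def relintPts (σ : IntegralCone X) : Set X :=
  {x | ∃ h : x ∈ σ.carrier, ∀ m : σ.M, (∀ y, 0 ≤ m.1 y) → m.1 ⟨x, h⟩ = 0 → m = 0}

theorem Represents.point_unique {σ : IntegralCone X} {v : NR σ.N} {x y : σ.carrier}
    (hx : σ.Represents v x) (hy : σ.Represents v y) : x = y :=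
  σ.isEmbedding.injective (funext fun m => (hx m).symm.trans (hy m))

theorem isPartiallyOpenCone_coneSet (σ : IntegralCone X) : IsPartiallyOpenCone σ.coneSet :=
  σ.poic.isCone

theorem span_coneSet (σ : IntegralCone X) : Submodule.span ℝ σ.coneSet = ⊤ := σ.poic.full

theorem mem_interior_coneSet_iff {σ : IntegralCone X} {v : NR σ.N} {x : σ.carrier}
    (h : σ.Represents v x) : v ∈ interior σ.coneSet ↔ x.1 ∈ σ.relintPts := by
  refine (mem_interior_iff σ.isPartiallyOpenCone_coneSet σ.span_coneSet).trans
    ⟨fun hv => ⟨x.2, fun m hm h0 => ?_⟩, fun hx => ⟨⟨x, h⟩, fun f hf h0 => ?_⟩⟩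
  · have := hv.2 (Module.Dual.eval ℤ σ.M m) (fun w hw => by
      obtain ⟨y, hy⟩ := hw
      rw [hy m]
      exact hm y) ((h m).trans h0)
    exact (Module.bijective_dual_eval ℤ σ.M).1 (this.trans (map_zero _).symm)
  · obtain ⟨m, rfl⟩ := (Module.bijective_dual_eval ℤ σ.M).2 f
    have hm : ∀ y, 0 ≤ m.1 y := fun y => by
      obtain ⟨w, hw⟩ := σ.exists_represents y
      exact (hf w ⟨y, hw⟩).trans_eq (hw m)
    rw [hx.2 m hm ((h m).symm.trans h0), map_zero]

theorem relintPts_nonempty (σ : IntegralCone X) : σ.relintPts.Nonempty := by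
  obtain ⟨v, hv⟩ := interior_nonempty σ.isPartiallyOpenCone_coneSet σ.span_coneSet
  obtain ⟨x, hx⟩ := interior_subset hv
  exact ⟨x, (mem_interior_coneSet_iff hx).1 hv⟩

/-- A subcone one of whose relative interior points lies on a face is contained in this face. -/
theorem subset_face_of_mem_relintPts {σ τ ρ : IntegralCone X} (h : IsSubcone σ τ) (hρ : IsFace ρ τ)
    {x : X} (hx : x ∈ σ.relintPts) (hxρ : x ∈ ρ.carrier) : σ.carrier ⊆ ρ.carrier := by
  obtain ⟨-, m, hm, hpos, hz⟩ := hρ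
  obtain ⟨hxσ, hx⟩ := hx
  rw [hz] at hxρ ⊢
  obtain ⟨x', hx', rfl⟩ := hxρ
  have h0 := hx (restrict h ⟨m, hm⟩) (fun y => hpos _) hx'
  intro y hy
  exact ⟨⟨y, h.1 hy⟩, congrArg (fun g : σ.M => g.1 ⟨y, hy⟩) h0, rfl⟩

theorem IsSubcone.trans {ρ σ τ : IntegralCone X} (h : IsSubcone ρ σ) (h' : IsSubcone σ τ) :
    IsSubcone ρ τ := by
  refine ⟨h.1.trans h'.1, fun g => ⟨fun hg => ?_, ?_⟩⟩
  · obtain ⟨m, hm, e⟩ := (h.2 g).1 hg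
    obtain ⟨n, hn, e'⟩ := (h'.2 m).1 hm
    exact ⟨n, hn, fun x => (e x).trans (e' _)⟩
  · rintro ⟨n, hn, e⟩
    exact (h.2 g).2 ⟨_, (restrict h' ⟨n, hn⟩).2, e⟩

theorem IsSubcone.of_subset {ρ σ τ : IntegralCone X} (h : IsSubcone ρ τ) (h' : IsSubcone σ τ)
    (hs : ρ.carrier ⊆ σ.carrier) : IsSubcone ρ σ := by
  refine ⟨hs, fun g => ⟨fun hg => ?_, ?_⟩⟩
  · obtain ⟨n, hn, e⟩ := (h.2 g).1 hg
    exact ⟨_, (restrict h' ⟨n, hn⟩).2, e⟩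
  · rintro ⟨m, hm, e⟩
    obtain ⟨n, hn, e'⟩ := (h'.2 m).1 hm
    exact (h.2 g).2 ⟨n, hn, fun x => (e x).trans (e' _)⟩

theorem IsSubcone.dim_le {σ τ : IntegralCone X} (h : IsSubcone σ τ) : σ.dim ≤ τ.dim :=
  LinearMap.finrank_le_finrank_of_injective (f := (restrict h).dualMap)
    (LinearMap.dualMap_injective_of_surjective (restrict_surjective h))

theorem restrict_bijective {σ τ : IntegralCone X} (h : IsSubcone σ τ) (hd : τ.dim ≤ σ.dim) :
    Function.Bijective (restrict h) := by
  have hs := restrict_surjective h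
  have hd' : Module.finrank ℤ τ.M = Module.finrank ℤ σ.M := by
    refine le_antisymm ?_ (LinearMap.finrank_le_finrank_of_surjective hs)
    have e : ∀ ρ : IntegralCone X, ρ.dim = Module.finrank ℤ ρ.M := fun ρ =>
      (Module.Free.chooseBasis ℤ ρ.M).toDualEquiv.finrank_eq.symm
    rwa [e, e] at hd
  let e := LinearEquiv.ofFinrankEq τ.M σ.M hd'
  exact ⟨(OrzechProperty.injective_of_surjective_of_injective e.toLinearMap (restrict h)
    e.injective hs), hs⟩

theorem Represents.comp {σ : IntegralCone X} {N P : Type u} [AddCommGroup N] [AddCommGroup P]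
    {f : N →ₗ[ℤ] P} {g : P →ₗ[ℤ] σ.N} {v : NR N} {x : σ.carrier}
    (h : σ.Represents (realMap g (realMap f v)) x) : σ.Represents (realMap (g ∘ₗ f) v) x := by
  rwa [realMap_comp]

/-- Two integral linear maps to `N^σ` agree if, for the vectors of a spanning set, their values
represent the same point of `σ`. -/
theorem linearMap_ext_of_represents (σ : IntegralCone X) {P : Type u} [AddCommGroup P]
    {A : Set (NR P)} (hA : Submodule.span ℝ A = ⊤) {f g : P →ₗ[ℤ] σ.N}
    (h : ∀ v ∈ A, ∃ x, σ.Represents (realMap f v) x ∧ σ.Represents (realMap g v) x) : f = g := by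
  apply realMap_inj
  apply LinearMap.ext_on hA
  intro v hv
  obtain ⟨x, hx, hx'⟩ := h v hv
  exact hx.unique hx'

theorem isClosed_coneSet (σ : IntegralCone X) : IsClosed σ.coneSet := by
  obtain ⟨F, hF, h⟩ := σ.rational
  have e : σ.coneSet = ⋂ m ∈ F, {v | 0 ≤ realForm (Module.Dual.eval ℤ σ.M m) v} := by
    ext v
    rw [Set.mem_iInter₂]
    exact h (σ.toHom v)
  rw [e]
  exact isClosed_biInter fun m _ => isClosed_le continuous_const (NR.continuous_linear _)

/-- The vector of `N^σ_ℝ` that represents a point of `σ`. -/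
noncomputable def vec (σ : IntegralCone X) (x : σ.carrier) : NR σ.N := (σ.exists_represents x).choose

theorem represents_vec (σ : IntegralCone X) (x : σ.carrier) : σ.Represents (σ.vec x) x :=
  (σ.exists_represents x).choose_spec

theorem continuous_vec (σ : IntegralCone X) : Continuous σ.vec := by
  -- `N^σ_ℝ` carries the topology of pointwise convergence on `M^σ`
  let T : NR σ.N →ₗ[ℝ] (σ.M → ℝ) :=
    LinearMap.pi fun m => realForm (Module.Dual.eval ℤ σ.M m)
  have hT : LinearMap.ker T = ⊥ := by
    rw [LinearMap.ker_eq_bot]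
    intro v w h
    exact σ.toHom_bijective.1 (LinearMap.ext fun m => congrFun h m)
  rw [(LinearMap.isClosedEmbedding_of_injective hT).isInducing.continuous_iff]
  have e : T ∘ σ.vec = fun x m => m.1 x := funext fun x => funext fun m => σ.represents_vec x m
  rw [e]
  exact σ.isEmbedding.continuous

end IntegralCone

/-! ### Relative interiors in cone complexes -/

namespace ConeComplex

variable {X : Type u} [TopologicalSpace X] {S : ConeComplex X}

/-- Every point of a cone lies in the relative interior of a face. -/
theorem exists_le_mem_relintPts {σ : S.cones} {x : X} (hx : x ∈ σ.1.carrier) :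
    ∃ ρ : S.cones, ρ ≤ σ ∧ x ∈ ρ.1.relintPts := by
  obtain ⟨v, hv⟩ := σ.1.exists_represents ⟨x, hx⟩
  obtain ⟨ρ, h, w, hw, e⟩ := S.toPoic.exists_face_relint σ v ⟨_, hv⟩
  obtain ⟨y, hy⟩ := interior_subset hw
  have hy' : σ.1.Represents v _ := e ▸ hy.map (S.isFace h).1
  obtain rfl : y.1 = x := congrArg Subtype.val (IntegralCone.Represents.point_unique hy' hv)
  exact ⟨ρ, h, (IntegralCone.mem_interior_coneSet_iff hy).1 hw⟩

/-- A cone that contains a relative interior point of `σ` contains `σ`. -/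
theorem le_of_mem_relintPts {σ τ : S.cones} {x : X} (hx : x ∈ σ.1.relintPts)
    (hxτ : x ∈ τ.1.carrier) : σ ≤ τ := by
  obtain ⟨ρ, -, h1, h2, hxρ⟩ := S.inter σ.1 σ.2 τ.1 τ.2 x ⟨hx.1, hxτ⟩
  exact (IntegralCone.subset_face_of_mem_relintPts (.refl _) h1 hx hxρ).trans h2.1.1

theorem eq_of_mem_relintPts {σ τ : S.cones} {x : X} (hx : x ∈ σ.1.relintPts)
    (hx' : x ∈ τ.1.relintPts) : σ = τ :=
  le_antisymm (le_of_mem_relintPts hx hx'.1) (le_of_mem_relintPts hx' hx.1)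

theorem exists_mem_relintPts (S : ConeComplex X) (x : X) : ∃ σ : S.cones, x ∈ σ.1.relintPts := by
  obtain ⟨σ, hσ, hx⟩ := S.covers x
  obtain ⟨ρ, -, h⟩ := exists_le_mem_relintPts (σ := ⟨σ, hσ⟩) hx
  exact ⟨ρ, h⟩

/-- A face of full dimension is not proper. -/
theorem eq_of_le_of_dim_le {σ τ : S.cones} (h : σ ≤ τ) (hd : τ.1.dim ≤ σ.1.dim) : σ = τ := by
  obtain ⟨hsub, m, hm, hpos, hz⟩ := S.isFace h
  -- restriction of functions is injective for dimension reasons, so the function cutting out `σ`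
  -- vanishes on `τ`
  have hr := (IntegralCone.restrict_bijective hsub hd).1
  have h0 : (⟨m, hm⟩ : τ.1.M) = 0 := by
    apply hr
    rw [map_zero]
    refine Subtype.ext (ContinuousMap.ext fun x => ?_)
    obtain ⟨y, hy, e⟩ := hz.subset x.2
    obtain rfl : y = Set.inclusion hsub.1 x := Subtype.ext e
    exact hy
  refine le_antisymm h fun x hx => ?_
  rw [hz]
  exact ⟨⟨x, hx⟩, congrArg (fun g : τ.1.M => g.1 ⟨x, hx⟩) h0, rfl⟩

/-! ### Morphisms to the poic-complex of a cone complex -/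

variable {Υ : PoicComplex.{u}}

/-- The vector `v` of the cone `p` is mapped by `F : Υ → p(Σ)` to the point `x` of `|Σ|`. -/
def IsPoint (F : PoicComplex.Hom Υ S.toPoic) (p : Υ.C) (v : NR (Υ.cone p).N) (x : X) : Prop :=
  ∃ h : x ∈ (F.obj p : S.cones).1.carrier,
    (F.obj p : S.cones).1.Represents ((F.η p).real v) ⟨x, h⟩

/-- The image in `|Σ|` of the cone `p`, for a morphism `F : Υ → p(Σ)`. -/
def cellPts (F : PoicComplex.Hom Υ S.toPoic) (p : Υ.C) : Set X :=
  {x | ∃ v ∈ (Υ.cone p).carrier, IsPoint F p v x}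

/-- The image in `|Σ|` of the relative interior of the cone `p`, for a morphism `F : Υ → p(Σ)`. -/
def openCellPts (F : PoicComplex.Hom Υ S.toPoic) (p : Υ.C) : Set X :=
  {x | ∃ v ∈ (Υ.cone p).relint, IsPoint F p v x}

variable (F : PoicComplex.Hom Υ S.toPoic)

theorem openCellPts_subset (p : Υ.C) : openCellPts F p ⊆ cellPts F p := fun _ ⟨v, hv, h⟩ =>
  ⟨v, interior_subset hv, h⟩

theorem cellPts_subset (p : Υ.C) : cellPts F p ⊆ (F.obj p : S.cones).1.carrier := fun _ ⟨_, _, h⟩ =>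
  h.1

variable {F}

theorem exists_isPoint {p : Υ.C} {v : NR (Υ.cone p).N} (hv : v ∈ (Υ.cone p).carrier) :
    ∃ x, IsPoint F p v x := by
  obtain ⟨x, hx⟩ := (F.η p).maps v hv
  exact ⟨x.1, x.2, hx⟩

theorem IsPoint.point_unique {p : Υ.C} {v : NR (Υ.cone p).N} {x y : X} (h : IsPoint F p v x)
    (h' : IsPoint F p v y) : x = y :=
  congrArg Subtype.val (IntegralCone.Represents.point_unique h.2 h'.2)

theorem IsPoint.map {p q : Υ.C} (hpq : p ≤ q) {v : NR (Υ.cone p).N} {x : X} (h : IsPoint F p v x) :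
    IsPoint F q ((Υ.map hpq).real v) x := by
  have h1 := h.2.map (S.isFace (F.mono hpq)).1
  have h2 := congrArg (fun f => Poic.Hom.real f v) (F.naturality hpq)
  simp only [Poic.Hom.real_comp, LinearMap.comp_apply] at h2
  refine ⟨F.mono hpq h.1, ?_⟩
  rw [h2]
  exact h1

theorem IsPoint.mem_relintPts {p : Υ.C} {v : NR (Υ.cone p).N} {x : X} (h : IsPoint F p v x)
    (hv : v ∈ (Υ.cone p).relint) : x ∈ (F.obj p : S.cones).1.relintPts :=
  (IntegralCone.mem_interior_coneSet_iff h.2).1 (F.maps_relint p hv)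

theorem openCellPts_subset_relintPts (p : Υ.C) :
    openCellPts F p ⊆ (F.obj p : S.cones).1.relintPts := fun _ ⟨_, hv, h⟩ => h.mem_relintPts hv

theorem openCellPts_nonempty (p : Υ.C) : (openCellPts F p).Nonempty := by
  obtain ⟨v, hv⟩ := Υ.relint_nonempty p
  obtain ⟨x, hx⟩ := exists_isPoint (F := F) (interior_subset hv)
  exact ⟨x, v, hv, hx⟩

theorem cellPts_mono {p q : Υ.C} (h : p ≤ q) : cellPts F p ⊆ cellPts F q := fun _ ⟨_, hv, hx⟩ =>
  ⟨_, (Υ.map h).maps _ hv, hx.map h⟩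

theorem exists_le_mem_openCellPts {q : Υ.C} {x : X} (hx : x ∈ cellPts F q) :
    ∃ p ≤ q, x ∈ openCellPts F p := by
  obtain ⟨v, hv, h⟩ := hx
  obtain ⟨p, hp, w, hw, rfl⟩ := Υ.exists_face_relint q v hv
  obtain ⟨y, hy⟩ := exists_isPoint (F := F) (interior_subset hw)
  obtain rfl := (hy.map hp).point_unique h
  exact ⟨p, hp, w, hw, hy⟩

/-- A morphism to `p(Σ)` is determined by the points to which it maps the vectors of the cones. -/
theorem hom_ext {F F' : PoicComplex.Hom Υ S.toPoic}
    (h : ∀ p, ∀ v ∈ (Υ.cone p).carrier, ∀ x, IsPoint F p v x → IsPoint F' p v x) : F = F' := by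
  have hobj : F.obj = F'.obj := by
    funext p
    obtain ⟨v, hv⟩ := Υ.relint_nonempty p
    obtain ⟨x, hx⟩ := exists_isPoint (F := F) (interior_subset hv)
    exact eq_of_mem_relintPts (hx.mem_relintPts hv)
      ((h p v (interior_subset hv) x hx).mem_relintPts hv)
  obtain ⟨obj, mono, η, nat, np⟩ := F
  obtain ⟨obj', mono', η', nat', np'⟩ := F'
  obtain rfl : obj = obj' := hobj
  congr
  funext p
  ext1
  apply IntegralCone.linearMap_ext_of_represents (obj p : S.cones).1 (Υ.cone p).full
  intro v hv
  obtain ⟨x, hx⟩ := exists_isPoint (F := ⟨obj, mono, η, nat, np⟩) hv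
  exact ⟨_, hx.2, (h p v hv x hx).2⟩

theorem mem_relintImage_iff {p : Υ.C} {s : S.cones} (h : F.obj p ≤ s) {v : NR s.1.N}
    {x : s.1.carrier} (hv : s.1.Represents v x) :
    v ∈ F.relintImage h ↔ x.1 ∈ openCellPts F p := by
  have key : ∀ {w y}, IsPoint F p w y → ∃ h' : y ∈ s.1.carrier, s.1.Represents
      ((S.toPoic.map h).real ((F.η p).real w)) ⟨y, h'⟩ := fun hw =>
    ⟨_, hw.2.map (S.isFace h).1⟩
  constructor
  · rintro ⟨_, ⟨w, hw, rfl⟩, rfl⟩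
    obtain ⟨y, hy⟩ := exists_isPoint (F := F) (interior_subset hw)
    obtain ⟨h1, h2⟩ := key hy
    obtain rfl := IntegralCone.Represents.point_unique hv h2
    exact ⟨w, hw, hy⟩
  · rintro ⟨w, hw, hy⟩
    obtain ⟨h1, h2⟩ := key hy
    exact ⟨_, ⟨w, hw, rfl⟩, h2.unique hv⟩

/-- The images of the relative interiors of the cones of a subdivision cover `|Σ|`. -/
theorem exists_mem_openCellPts (hF : F.IsSubdivision) (x : X) : ∃ p, x ∈ openCellPts F p := by
  obtain ⟨s, hs⟩ := S.exists_mem_relintPts x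
  have hv := s.1.represents_vec ⟨x, hs.1⟩
  have h1 := (IntegralCone.mem_interior_coneSet_iff hv).2 hs
  have h2 : s.1.vec ⟨x, hs.1⟩ ∈ (S.toPoic.cone s).relint := h1
  rw [hF.relint_eq s] at h2
  obtain ⟨p, h2⟩ := Set.mem_iUnion.1 h2
  obtain ⟨hp, h2⟩ := Set.mem_iUnion.1 h2
  obtain ⟨-, h3⟩ := Set.mem_iUnion.1 h2
  exact ⟨p, (mem_relintImage_iff hp hv).1 h3⟩

/-- Cones of a subdivision whose relative interiors meet in `|Σ|` are isomorphic. -/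
theorem le_of_mem_openCellPts (hF : F.IsSubdivision) {p q : Υ.C} {x : X} (hp : x ∈ openCellPts F p)
    (hq : x ∈ openCellPts F q) : p ≤ q := by
  have e : (F.obj q : S.cones) = F.obj p :=
    eq_of_mem_relintPts (openCellPts_subset_relintPts q hq) (openCellPts_subset_relintPts p hp)
  have hv := (F.obj p : S.cones).1.represents_vec ⟨x, cellPts_subset F p (openCellPts_subset F p hp)⟩
  exact (hF.disjoint (F.obj p) p q le_rfl e.le le_rfl e.ge
    ⟨_, (mem_relintImage_iff _ hv).2 hp, (mem_relintImage_iff _ hv).2 hq⟩).1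

/-- Over `p(Σ)`, conditions on the relative interiors can be checked in the space `|Σ|`. -/
theorem isSubdivision_of_openCellPts (hcov : ∀ x, ∃ p, x ∈ openCellPts F p)
    (hdis : ∀ p q x, x ∈ openCellPts F p → x ∈ openCellPts F q → p ≤ q)
    (hinj : ∀ p, Function.Injective (F.η p).lin)
    (hbij : ∀ p, (Υ.cone p).dim = (S.toPoic.cone (F.obj p)).dim → Function.Bijective (F.η p).lin)
    (hclosed : ∀ p, closure ((F.η p).real '' (Υ.cone p).carrier) ∩
      (S.toPoic.cone (F.obj p)).carrier ⊆ (F.η p).real '' (Υ.cone p).carrier) :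
    F.IsSubdivision where
  essSurj s := by
    obtain ⟨x, hx⟩ := IntegralCone.relintPts_nonempty (X := X) (Subtype.val (s : S.cones))
    obtain ⟨p, hp⟩ := hcov x
    have e : (F.obj p : S.cones) = s := eq_of_mem_relintPts (openCellPts_subset_relintPts p hp) hx
    exact ⟨p, e.le, e.ge⟩
  injective := hinj
  bijective := hbij
  relint_eq s := by
    change S.cones at s
    ext v
    simp only [Set.mem_iUnion]
    constructor
    · intro hv
      obtain ⟨x, hx⟩ := interior_subset hv
      obtain ⟨p, hp⟩ := hcov x.1
      have e : (F.obj p : S.cones) = s := eq_of_mem_relintPts (openCellPts_subset_relintPts p hp)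
        ((IntegralCone.mem_interior_coneSet_iff hx).1 hv)
      exact ⟨p, e.le, e.ge, (mem_relintImage_iff e.le hx).2 hp⟩
    · rintro ⟨p, hp, hp', hv⟩
      obtain rfl : (F.obj p : S.cones) = s := le_antisymm (α := S.cones) hp hp'
      obtain ⟨_, ⟨w, hw, rfl⟩, e⟩ := id hv
      have hm : (F.η p).real w ∈ (S.toPoic.cone (F.obj p)).carrier :=
        (F.η p).maps _ (interior_subset hw)
      have e' : (F.η p).real w = v := by
        rw [← e]
        exact (LinearMap.congr_fun (Poic.Hom.real_id _) _).symm
      rw [e'] at hm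
      obtain ⟨x, hx⟩ := hm
      exact (IntegralCone.mem_interior_coneSet_iff hx).2
        (openCellPts_subset_relintPts p ((mem_relintImage_iff hp hx).1 hv))
  disjoint s p q hp hq hp' hq' := by
    rintro ⟨v, hv, hv'⟩
    change S.cones at s
    have : ∃ x, s.1.Represents v x := by
      obtain ⟨_, ⟨w, hw, rfl⟩, rfl⟩ := hv
      exact (S.toPoic.map hp).maps _ ((F.η p).maps _ (interior_subset hw))
    obtain ⟨x, hx⟩ := this
    have h1 := (mem_relintImage_iff hp hx).1 hv
    have h2 := (mem_relintImage_iff hq hx).1 hv'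
    exact ⟨hdis p q _ h1 h2, hdis q p _ h2 h1⟩
  closed := hclosed

/-! ### The subdivision of poic-complexes given by a proper subdivision -/

variable {S' : ConeComplex X}

/-- Every cone of a proper subdivision is a subcone of a cone of `Σ` whose relative interior contains
its relative interior; this is the smallest cone of `Σ` that contains it. -/
theorem exists_minimal_cone (h : S'.IsProperSubdivision S) (σ' : S'.cones) :
    ∃ s : S.cones, σ'.1.IsSubcone s.1 ∧ ∀ x ∈ σ'.1.relintPts, x ∈ s.1.relintPts := by
  obtain ⟨x, hx⟩ := σ'.1.relintPts_nonempty
  obtain ⟨t, ht, hsub⟩ := h σ'.1 σ'.2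
  obtain ⟨ρ, hρ, hxρ⟩ := exists_le_mem_relintPts (σ := (⟨t, ht⟩ : S.cones)) (hsub.1 hx.1)
  have hface := S.isFace hρ
  have hsub' : σ'.1.IsSubcone ρ.1 := hsub.of_subset hface.1
    (IntegralCone.subset_face_of_mem_relintPts hsub hface hx hxρ.1)
  refine ⟨ρ, hsub', fun y hy => ⟨hsub'.1 hy.1, fun m hm h0 => hxρ.2 m hm ?_⟩⟩
  -- a non-negative function that vanishes at `y` vanishes on `σ'`, so it vanishes at `x`
  have h1 := hy.2 (IntegralCone.restrict hsub' m) (fun z => hm _) h0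
  exact congrArg (fun g : σ'.1.M => g.1 ⟨x, hx.1⟩) h1

/-- The smallest cone of `Σ` that contains a given cone of a proper subdivision. -/
noncomputable def minimalCone (h : S'.IsProperSubdivision S) (σ' : S'.cones) : S.cones :=
  (exists_minimal_cone h σ').choose

theorem isSubcone_minimalCone (h : S'.IsProperSubdivision S) (σ' : S'.cones) :
    σ'.1.IsSubcone (minimalCone h σ').1 :=
  (exists_minimal_cone h σ').choose_spec.1

theorem relintPts_subset_minimalCone (h : S'.IsProperSubdivision S) (σ' : S'.cones) :
    σ'.1.relintPts ⊆ (minimalCone h σ').1.relintPts :=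
  (exists_minimal_cone h σ').choose_spec.2

/-- The morphism `p(Σ') → p(Σ)` given by a proper subdivision. -/
noncomputable def subdivisionHom (h : S'.IsProperSubdivision S) :
    PoicComplex.Hom S'.toPoic S.toPoic where
  obj σ' := minimalCone h σ'
  mono σ' τ' hle := by
    obtain ⟨x, hx⟩ := IntegralCone.relintPts_nonempty (X := X) (Subtype.val (σ' : S'.cones))
    exact le_of_mem_relintPts (relintPts_subset_minimalCone h σ' hx)
      ((isSubcone_minimalCone h τ').1 (hle hx.1))
  η σ' := IntegralCone.incl (isSubcone_minimalCone h σ')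
  naturality hle := by
    ext1
    rfl
  not_in_proper_face σ' τ hτ hsub := by
    obtain ⟨x, hx⟩ := IntegralCone.relintPts_nonempty (X := X) (Subtype.val (σ' : S'.cones))
    obtain ⟨ρ, hρ, rfl⟩ := S.toPoic.exists_face _ τ hτ
    have hface := S.isFace hρ
    have e := IntegralCone.image_incl hface.1
    have hxρ : x ∈ (Subtype.val (ρ : S.cones)).carrier := by
      obtain ⟨v, hv⟩ := IntegralCone.exists_represents (Subtype.val (σ' : S'.cones)) ⟨x, hx.1⟩
      have h1 := hsub ⟨v, ⟨_, hv⟩, rfl⟩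
      have h2 := e.subset h1
      obtain ⟨y, hy, hy'⟩ := h2
      obtain rfl := IntegralCone.Represents.point_unique hy'
        (hv.map (isSubcone_minimalCone h σ'))
      exact hy
    have hle : minimalCone h σ' ≤ ρ :=
      le_of_mem_relintPts (relintPts_subset_minimalCone h σ' hx) hxρ
    refine Set.Subset.antisymm ?_ fun v hv => ?_
    · rintro _ ⟨v, hv, rfl⟩
      exact (S.toPoic.map hρ).maps v hv
    · obtain ⟨y, hy⟩ := hv
      exact e.superset ⟨y, hle y.2, hy⟩

theorem overIdentity_subdivisionHom (h : S'.IsProperSubdivision S) :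
    OverIdentity (subdivisionHom h) := fun σ' x _ hv =>
  ⟨(isSubcone_minimalCone h σ').1 x.2, hv.map (isSubcone_minimalCone h σ')⟩

theorem OverIdentity.isPoint {F : PoicComplex.Hom S'.toPoic S.toPoic} (hF : OverIdentity F)
    {σ' : S'.cones} {v : NR σ'.1.N} {x : σ'.1.carrier} (h : σ'.1.Represents v x) :
    IsPoint F σ' v x.1 :=
  hF σ' x v h

/-- There is at most one morphism `p(Σ') → p(Σ)` over the identity of `|Σ|`. -/
theorem OverIdentity.unique {F F' : PoicComplex.Hom S'.toPoic S.toPoic} (hF : OverIdentity F)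
    (hF' : OverIdentity F') : F = F' := by
  refine hom_ext fun p v hv x hx => ?_
  obtain ⟨y, hy⟩ := hv
  obtain rfl := hx.point_unique (hF.isPoint hy)
  exact hF'.isPoint hy

theorem OverIdentity.openCellPts_eq {F : PoicComplex.Hom S'.toPoic S.toPoic} (hF : OverIdentity F)
    (σ' : S'.cones) : openCellPts F σ' = σ'.1.relintPts := by
  ext x
  constructor
  · rintro ⟨v, hv, h⟩
    obtain ⟨y, hy⟩ := interior_subset hv
    obtain rfl := h.point_unique (hF.isPoint hy)
    exact (IntegralCone.mem_interior_coneSet_iff hy).1 hv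
  · intro hx
    have hv := σ'.1.represents_vec ⟨x, hx.1⟩
    exact ⟨_, (IntegralCone.mem_interior_coneSet_iff hv).2 hx, hF.isPoint hv⟩

theorem isSubdivision_subdivisionHom (h : S'.IsProperSubdivision S) :
    (subdivisionHom h).IsSubdivision := by
  have hover := overIdentity_subdivisionHom h
  refine isSubdivision_of_openCellPts (fun x => ?_) (fun p q x hp hq => ?_) (fun p => ?_)
    (fun p hd => ?_) fun p => ?_
  · obtain ⟨σ', hσ'⟩ := S'.exists_mem_relintPts x
    exact ⟨σ', (hover.openCellPts_eq σ').superset hσ'⟩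
  · exact (eq_of_mem_relintPts ((hover.openCellPts_eq p).subset hp)
      ((hover.openCellPts_eq q).subset hq)).le
  · exact LinearMap.dualMap_injective_of_surjective
      (IntegralCone.restrict_surjective (isSubcone_minimalCone h p))
  · have hb := IntegralCone.restrict_bijective (isSubcone_minimalCone h p) hd.ge
    exact (LinearEquiv.ofBijective _ hb).dualMap.bijective
  · have hc := (LinearMap.isClosedEmbedding_of_injective (LinearMap.ker_eq_bot.2
      (IntegralCone.incl_injective (isSubcone_minimalCone h p)))).isClosedMap _
      (IntegralCone.isClosed_coneSet (Subtype.val (p : S'.cones)))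
    exact Set.inter_subset_left.trans hc.closure_eq.subset

end ConeComplex

/-! ### Saturated sublattices and duality -/

/-- Linear forms extend from a saturated sublattice. -/
theorem exists_dual_extension {P Q : Type u} [AddCommGroup P] [AddCommGroup Q] [Module.Finite ℤ Q]
    (ι : P →ₗ[ℤ] Q) (hι : Function.Injective ι)
    (hsat : ∀ (k : ℤ) (n : Q), k ≠ 0 → k • n ∈ LinearMap.range ι → n ∈ LinearMap.range ι)
    (f : Module.Dual ℤ P) : ∃ g : Module.Dual ℤ Q, g ∘ₗ ι = f := by
  have htf : Module.IsTorsionFree ℤ (Q ⧸ LinearMap.range ι) := by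
    refine Module.IsTorsionFree.of_smul_eq_zero fun k m h => ?_
    obtain ⟨n, rfl⟩ := Submodule.mkQ_surjective _ m
    by_cases hk : k = 0
    · exact Or.inl hk
    · right
      rw [← map_smul, Submodule.mkQ_apply, Submodule.Quotient.mk_eq_zero] at h
      rw [Submodule.mkQ_apply, Submodule.Quotient.mk_eq_zero]
      exact hsat k n hk h
  obtain ⟨s, hs⟩ := Module.projective_lifting_property (LinearMap.range ι).mkQ LinearMap.id
    (Submodule.mkQ_surjective _)
  have hmem : ∀ n, n - s ((LinearMap.range ι).mkQ n) ∈ LinearMap.range ι := by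
    intro n
    refine (Submodule.Quotient.eq _).1 ?_
    exact (LinearMap.congr_fun hs _).symm
  let r : Q →ₗ[ℤ] LinearMap.range ι :=
    (LinearMap.id - s ∘ₗ (LinearMap.range ι).mkQ).codRestrict _ hmem
  let e := LinearEquiv.ofInjective ι hι
  refine ⟨f ∘ₗ e.symm.toLinearMap ∘ₗ r, LinearMap.ext fun x => ?_⟩
  have h1 : r (ι x) = e x := by
    apply Subtype.ext
    have h0 : (LinearMap.range ι).mkQ (ι x) = 0 := by simp
    change ι x - s ((LinearMap.range ι).mkQ (ι x)) = ι x
    rw [h0, map_zero, sub_zero]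
  change f (e.symm (r (ι x))) = f x
  rw [h1, LinearEquiv.symm_apply_apply]

theorem latticeOf_saturated {N : Type u} [AddCommGroup N] {σ : Set (NR N)} {k : ℤ} {n : N}
    (hk : k ≠ 0) (h : k • n ∈ latticeOf σ) : n ∈ latticeOf σ := by
  have h1 : (k : ℝ) • ((1 : ℝ) ⊗ₜ[ℤ] n) ∈ Submodule.span ℝ σ := by
    have e : (k : ℝ) • ((1 : ℝ) ⊗ₜ[ℤ] n) = (1 : ℝ) ⊗ₜ[ℤ] (k • n) := by
      rw [TensorProduct.tmul_smul, Int.cast_smul_eq_zsmul]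
    rw [e]
    exact h
  have h2 := Submodule.smul_mem _ (k : ℝ)⁻¹ h1
  rwa [smul_smul, inv_mul_cancel₀ (Int.cast_ne_zero.2 hk), one_smul] at h2

/-- Linear forms on a lattice extend along face-embeddings. -/
theorem Poic.Hom.IsFaceEmbedding.exists_dual_extension {σ ξ : Poic.{u}} {f : Poic.Hom σ ξ}
    (hf : f.IsFaceEmbedding) (g : Module.Dual ℤ σ.N) : ∃ g' : Module.Dual ℤ ξ.N, g' ∘ₗ f.lin = g := by
  refine Trop.exists_dual_extension f.lin (fun a b hab => ?_) (fun k n hk h => ?_) g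
  · apply NR.one_tmul_injective σ.N
    apply hf.1
    change realMap f.lin _ = realMap f.lin _
    simp only [realMap_tmul, hab]
  · have h1 : k • n ∈ (LinearMap.range f.lin : Set ξ.N) := h
    rw [hf.2.2] at h1
    have h2 := latticeOf_saturated hk h1
    rw [← hf.2.2] at h2
    exact h2

/-- The identification `M^∨ ⊗ ℝ → Hom(M, ℝ)` for a lattice `M`; for the lattice of functions of an
integral cone this is `IntegralCone.toHom`. -/
noncomputable def dualReal (M : Type u) [AddCommGroup M] :
    NR (Module.Dual ℤ M) →ₗ[ℝ] (M →ₗ[ℤ] ℝ) where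
  toFun v :=
    { toFun := fun m => realForm (Module.Dual.eval ℤ M m) v
      map_add' := fun a b => by
        induction v using TensorProduct.induction_on with
        | zero => simp
        | tmul r n => simp [add_mul]
        | add x y hx hy => simp only [map_add] at hx hy ⊢; rw [hx, hy]; ring
      map_smul' := fun c a => by
        induction v using TensorProduct.induction_on with
        | zero => simp
        | tmul r n => simp [mul_assoc]
        | add x y hx hy => simp only [map_add, hx, hy, smul_add] }
  map_add' a b := by ext; simp
  map_smul' c a := by ext; simp

theorem dualReal_apply (M : Type u) [AddCommGroup M] (v : NR (Module.Dual ℤ M)) (m : M) :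
    dualReal M v m = realForm (Module.Dual.eval ℤ M m) v := rfl

theorem dualReal_bijective (M : Type u) [AddCommGroup M] [Module.Free ℤ M] [Module.Finite ℤ M] :
    Function.Bijective (dualReal M) := by
  have h : (dualReal M : NR (Module.Dual ℤ M) → _) =
      (dualTensorHomEquiv ℤ M ℝ) ∘ (TensorProduct.comm ℤ ℝ (Module.Dual ℤ M)) := by
    funext v
    induction v using TensorProduct.induction_on with
    | zero => simp only [LinearMap.map_zero, LinearEquiv.map_zero, Function.comp]
    | tmul r n => ext m; simp [dualReal_apply]
    | add x y hx hy =>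
      simp only [Function.comp, LinearMap.map_add, LinearEquiv.map_add] at hx hy ⊢
      rw [hx, hy]
  rw [h]
  exact (dualTensorHomEquiv ℤ M ℝ).bijective.comp
    (TensorProduct.comm ℤ ℝ (Module.Dual ℤ M)).bijective

namespace ConeComplex

variable {X : Type u} [TopologicalSpace X] {S : ConeComplex X} {Υ : PoicComplex.{u}}
  {F : PoicComplex.Hom Υ S.toPoic}

/-! ### The cells of a subdivision -/

theorem mem_cellPts_iff {p : Υ.C} {x : X} (h : x ∈ (F.obj p : S.cones).1.carrier)
    {v : NR (F.obj p : S.cones).1.N} (hv : (F.obj p : S.cones).1.Represents v ⟨x, h⟩) :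
    x ∈ cellPts F p ↔ v ∈ (F.η p).real '' (Υ.cone p).carrier := by
  constructor
  · rintro ⟨w, hw, h'⟩
    exact ⟨w, hw, h'.2.unique hv⟩
  · rintro ⟨w, hw, rfl⟩
    exact ⟨w, hw, h, hv⟩

/-- The cones of `Σ` are closed, so relatively closed images are closed. -/
theorem isClosed_image (hF : F.IsSubdivision) (p : Υ.C) :
    IsClosed ((F.η p).real '' (Υ.cone p).carrier) := by
  refine isClosed_of_closure_subset fun v hv => hF.closed p ⟨hv, ?_⟩
  have h1 : (F.η p).real '' (Υ.cone p).carrier ⊆ (S.toPoic.cone (F.obj p)).carrier := by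
    rintro _ ⟨w, hw, rfl⟩
    exact (F.η p).maps w hw
  exact closure_minimal h1 (IntegralCone.isClosed_coneSet (F.obj p : S.cones).1) hv

theorem isClosed_carrier (hF : F.IsSubdivision) (p : Υ.C) : IsClosed (Υ.cone p).carrier := by
  have hi : Function.Injective (F.η p).real := realMap_injective _ (hF.injective p)
  rw [← hi.preimage_image (Υ.cone p).carrier]
  exact (isClosed_image hF p).preimage (NR.continuous_linear _)

theorem isClosed_cellPts (hF : F.IsSubdivision) (p : Υ.C) : IsClosed (cellPts F p) := by
  have h1 : IsClosed ((F.obj p : S.cones).1.vec ⁻¹' ((F.η p).real '' (Υ.cone p).carrier)) :=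
    (isClosed_image hF p).preimage (F.obj p : S.cones).1.continuous_vec
  have h2 := (S.isClosed _ (F.obj p : S.cones).2).isClosedEmbedding_subtypeVal.isClosedMap _ h1
  convert h2
  ext x
  constructor
  · intro hx
    have hx' := cellPts_subset F p hx
    exact ⟨⟨x, hx'⟩, (mem_cellPts_iff hx' (IntegralCone.represents_vec _ _)).1 hx, rfl⟩
  · rintro ⟨x, hx, rfl⟩
    exact (mem_cellPts_iff x.2 (IntegralCone.represents_vec _ _)).2 hx

/-- In a subdivision, every relative interior point of a cone `s` of `Σ` lies in a cell over `s` of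
the same dimension as `s`: the finitely many smaller cells over `s` lie in proper subspaces. -/
theorem exists_full_dim_cell (hF : F.IsSubdivision) {s : S.cones} {x : X} (hx : x ∈ s.1.relintPts) :
    ∃ q, (F.obj q : S.cones) = s ∧ (Υ.cone q).dim = s.1.dim ∧ x ∈ cellPts F q := by
  by_contra! hno
  let r : Υ.Classes → Υ.C := Quotient.out
  have hr : ∀ p, p ≤ r (Υ.cls p) ∧ r (Υ.cls p) ≤ p := fun p =>
    (Quotient.exact (Quotient.out_eq (Υ.cls p))).symm
  let A : Υ.Classes → Set (NR s.1.N) := fun c => {v | ∃ y, s.1.Represents v y ∧ y.1 ∈ cellPts F (r c)}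
  have hA : ∀ q, (F.obj q : S.cones) = s → ∃ f : NR (Υ.cone q).N →ₗ[ℝ] NR s.1.N,
      {v | ∃ y, s.1.Represents v y ∧ y.1 ∈ cellPts F q} = f '' (Υ.cone q).carrier ∧
        IsClosed (f '' (Υ.cone q).carrier) ∧ Function.Injective f := by
    rintro q rfl
    refine ⟨(F.η q).real, ?_, isClosed_image hF q, realMap_injective _ (hF.injective q)⟩
    ext v
    constructor
    · rintro ⟨y, hv, hy⟩
      exact (mem_cellPts_iff y.2 hv).1 hy
    · rintro ⟨w, hw, rfl⟩
      obtain ⟨y, hy⟩ := exists_isPoint (F := F) hw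
      exact ⟨⟨y, hy.1⟩, hy.2, w, hw, hy⟩
  let K₁ : Set Υ.Classes := {c | (F.obj (r c) : S.cones) = s ∧ (Υ.cone (r c)).dim = s.1.dim}
  let K₂ : Set Υ.Classes := {c | (F.obj (r c) : S.cones) = s ∧ (Υ.cone (r c)).dim ≠ s.1.dim}
  have hL : ∀ c, ∃ L : Submodule ℝ (NR s.1.N), c ∈ K₂ → L ≠ ⊤ ∧ A c ⊆ L := by
    intro c
    by_cases hc : c ∈ K₂
    · obtain ⟨f, hf, -, hinj⟩ := hA (r c) hc.1
      refine ⟨LinearMap.range f, fun _ => ⟨fun htop => hc.2 ?_, ?_⟩⟩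
      · have h1 := (LinearEquiv.ofBijective f ⟨hinj, LinearMap.range_eq_top.1 htop⟩).finrank_eq
        rwa [NR.finrank_eq, NR.finrank_eq] at h1
      · intro v hv
        obtain ⟨w, -, rfl⟩ := hf.subset hv
        exact ⟨w, rfl⟩
    · exact ⟨⊥, fun h => (hc h).elim⟩
  choose L hL using hL
  obtain ⟨v, hv⟩ := s.1.exists_represents ⟨x, hx.1⟩
  refine not_subset_biUnion_submodule (Set.toFinite K₂) L (fun c hc => (hL c hc).1)
    (V := interior s.1.coneSet \ ⋃ c ∈ K₁, A c)
    (isOpen_interior.sdiff ((Set.toFinite K₁).isClosed_biUnion fun c hc => ?_))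
    ⟨v, (IntegralCone.mem_interior_coneSet_iff hv).2 hx, fun hmem => ?_⟩ ?_
  · obtain ⟨f, hf, hcl, -⟩ := hA (r c) hc.1
    change IsClosed {v | ∃ y, s.1.Represents v y ∧ y.1 ∈ cellPts F (r c)}
    rwa [hf]
  · obtain ⟨c, hc, y, hy, hyc⟩ := Set.mem_iUnion₂.1 hmem
    obtain rfl := IntegralCone.Represents.point_unique hv hy
    exact hno _ hc.1 hc.2 hyc
  · rintro w ⟨hw, hw'⟩
    obtain ⟨y, hy⟩ := interior_subset hw
    obtain ⟨p, hp⟩ := exists_mem_openCellPts hF y.1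
    have e : (F.obj p : S.cones) = s := eq_of_mem_relintPts (openCellPts_subset_relintPts p hp)
      ((IntegralCone.mem_interior_coneSet_iff hy).1 hw)
    have e' : (F.obj (r (Υ.cls p)) : S.cones) = s := by
      rw [← e]
      exact le_antisymm (α := S.cones) (F.mono (hr p).2) (F.mono (hr p).1)
    have hwA : w ∈ A (Υ.cls p) :=
      ⟨y, hy, cellPts_mono (hr p).1 (openCellPts_subset F p hp)⟩
    have hK : Υ.cls p ∈ K₂ :=
      ⟨e', fun hd => hw' (Set.mem_iUnion₂.2 ⟨_, ⟨e', hd⟩, hwA⟩)⟩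
    exact Set.mem_iUnion₂.2 ⟨_, hK, (hL _ hK).2 hwA⟩

/-- The dual of the lattice map of a cell. -/
noncomputable def cellDual (F : PoicComplex.Hom Υ S.toPoic) (p : Υ.C) :
    (F.obj p : S.cones).1.M →ₗ[ℤ] Module.Dual ℤ (Υ.cone p).N :=
  (F.η p).lin.dualMap ∘ₗ Module.Dual.eval ℤ (F.obj p : S.cones).1.M

theorem IsPoint.realForm_cellDual {p : Υ.C} {v : NR (Υ.cone p).N} {x : X} (h : IsPoint F p v x)
    (m : (F.obj p : S.cones).1.M) : realForm (cellDual F p m) v = m.1 ⟨x, h.1⟩ :=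
  (realForm_realMap (F.η p).lin (Module.Dual.eval ℤ _ m) v).symm.trans (h.2 m)

/-- The lattice of a cell of a subdivision is saturated in the lattice of the cone of `Σ`, as the
cell is a face of a full-dimensional one. -/
theorem cellDual_surjective (hF : F.IsSubdivision) (p : Υ.C) :
    Function.Surjective (cellDual F p) := by
  intro f
  obtain ⟨x, hx⟩ := openCellPts_nonempty (F := F) p
  obtain ⟨q, hq, hd, hxq⟩ := exists_full_dim_cell hF (openCellPts_subset_relintPts p hx)
  obtain ⟨p', hp', hx'⟩ := exists_le_mem_openCellPts hxq
  have hle : p ≤ q := (le_of_mem_openCellPts hF hx hx').trans hp'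
  obtain ⟨g, rfl⟩ := (Υ.isFaceEmbedding hle).exists_dual_extension f
  have hb : Function.Bijective (F.η q).lin := hF.bijective q (by
    rw [hd]
    exact congrArg (fun s : S.cones => s.1.dim) hq.symm)
  let e := LinearEquiv.ofBijective (F.η q).lin hb
  obtain ⟨m, hm⟩ := (Module.bijective_dual_eval ℤ (F.obj q : S.cones).1.M).2 (g ∘ₗ e.symm.toLinearMap)
  refine ⟨IntegralCone.restrict (S.isFace (F.mono hle)).1 m, ?_⟩
  ext n
  have h1 : (F.η q).lin ((Υ.map hle).lin n) = (S.toPoic.map (F.mono hle)).lin ((F.η p).lin n) :=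
    congrArg (fun f => Poic.Hom.lin f n) (F.naturality hle)
  have h2 := LinearMap.congr_fun hm ((F.η q).lin ((Υ.map hle).lin n))
  have h3 : e.symm ((F.η q).lin ((Υ.map hle).lin n)) = (Υ.map hle).lin n :=
    e.symm_apply_apply _
  have h4 : (g ∘ₗ e.symm.toLinearMap) ((F.η q).lin ((Υ.map hle).lin n)) = g ((Υ.map hle).lin n) :=
    congrArg g h3
  refine Eq.trans ?_ (h2.trans h4)
  rw [h1]
  rfl

/-- The restrictions to a cell of the integral linear functions on the cone of `Σ`. -/
noncomputable def cellFns (F : PoicComplex.Hom Υ S.toPoic) (p : Υ.C) : AddSubgroup C(cellPts F p, ℝ) :=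
  (F.obj p : S.cones).1.M.map (ContinuousMap.compAddMonoidHom'
    ⟨Set.inclusion (cellPts_subset F p), continuous_inclusion (cellPts_subset F p)⟩)

theorem mem_cellFns {p : Υ.C} {g : C(cellPts F p, ℝ)} : g ∈ cellFns F p ↔
    ∃ m ∈ (F.obj p : S.cones).1.M, ∀ x, g x = m (Set.inclusion (cellPts_subset F p) x) := by
  constructor
  · rintro ⟨m, hm, rfl⟩
    exact ⟨m, hm, fun _ => rfl⟩
  · rintro ⟨m, hm, e⟩
    exact ⟨m, hm, ContinuousMap.ext fun x => (e x).symm⟩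

/-- Restriction of functions to a cell. -/
noncomputable def cellRestrict (F : PoicComplex.Hom Υ S.toPoic) (p : Υ.C) :
    (F.obj p : S.cones).1.M →ₗ[ℤ] cellFns F p where
  toFun m := ⟨m.1.comp ⟨Set.inclusion (cellPts_subset F p), continuous_inclusion _⟩,
    mem_cellFns.2 ⟨m.1, m.2, fun _ => rfl⟩⟩
  map_add' _ _ := rfl
  map_smul' _ _ := rfl

theorem cellRestrict_surjective (p : Υ.C) : Function.Surjective (cellRestrict F p) := by
  rintro ⟨g, hg⟩
  obtain ⟨m, hm, e⟩ := mem_cellFns.1 hg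
  exact ⟨⟨m, hm⟩, Subtype.ext (ContinuousMap.ext fun x => (e x).symm)⟩

/-- As the cone `p` spans `N^p_ℝ`, a function vanishes on its cell if and only if the corresponding
linear form is zero. -/
theorem ker_cellRestrict (p : Υ.C) :
    LinearMap.ker (cellRestrict F p) = LinearMap.ker (cellDual F p) := by
  ext m
  rw [LinearMap.mem_ker, LinearMap.mem_ker]
  constructor
  · intro h
    refine eq_zero_of_span (Υ.cone p).full fun v hv => ?_
    obtain ⟨x, hx⟩ := exists_isPoint (F := F) hv
    rw [hx.realForm_cellDual]
    exact congrArg (fun g : cellFns F p => g.1 ⟨x, v, hv, hx⟩) h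
  · intro h
    refine Subtype.ext (ContinuousMap.ext ?_)
    rintro ⟨x, v, hv, hx⟩
    refine (hx.realForm_cellDual m).symm.trans ?_
    rw [h, realForm_zero]
    rfl

/-- The functions on a cell are the integral linear forms on its lattice. -/
theorem exists_cellFns_equiv (hF : F.IsSubdivision) (p : Υ.C) :
    ∃ E : cellFns F p ≃ₗ[ℤ] Module.Dual ℤ (Υ.cone p).N, ∀ (g : cellFns F p) (v : NR (Υ.cone p).N)
      (x : cellPts F p), IsPoint F p v x.1 → realForm (E g) v = g.1 x := by
  let E := ((cellRestrict F p).quotKerEquivOfSurjective (cellRestrict_surjective p)).symm ≪≫ₗ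
    Submodule.quotEquivOfEq _ _ (ker_cellRestrict p) ≪≫ₗ
    (cellDual F p).quotKerEquivOfSurjective (cellDual_surjective hF p)
  refine ⟨E, fun g v x h => ?_⟩
  obtain ⟨m, rfl⟩ := cellRestrict_surjective p g
  have e : E (cellRestrict F p m) = cellDual F p m := by
    have h1 : ((cellRestrict F p).quotKerEquivOfSurjective (cellRestrict_surjective p)).symm
        (cellRestrict F p m) = Submodule.Quotient.mk m := by
      rw [LinearEquiv.symm_apply_eq]
      rfl
    change (cellDual F p).quotKerEquivOfSurjective (cellDual_surjective hF p)
      (Submodule.quotEquivOfEq _ _ (ker_cellRestrict p) (LinearEquiv.symm _ _)) = _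
    rw [h1]
    rfl
  rw [e, h.realForm_cellDual]
  rfl

/-- The integral linear form on the lattice of a cell that a function on the cell defines. -/
noncomputable def cellFnsEquiv (hF : F.IsSubdivision) (p : Υ.C) :
    cellFns F p ≃ₗ[ℤ] Module.Dual ℤ (Υ.cone p).N :=
  (exists_cellFns_equiv hF p).choose

theorem IsPoint.realForm_cellFnsEquiv (hF : F.IsSubdivision) {p : Υ.C} {v : NR (Υ.cone p).N}
    {x : cellPts F p} (h : IsPoint F p v x.1) (g : cellFns F p) :
    realForm (cellFnsEquiv hF p g) v = g.1 x :=
  (exists_cellFns_equiv hF p).choose_spec g v x h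

/-- The identification of the lattice of a cell with the dual of its lattice of functions. -/
noncomputable def cellLattice (hF : F.IsSubdivision) (p : Υ.C) :
    (Υ.cone p).N ≃ₗ[ℤ] Module.Dual ℤ (cellFns F p) :=
  Module.evalEquiv ℤ (Υ.cone p).N ≪≫ₗ (cellFnsEquiv hF p).dualMap

theorem realForm_cellLattice (hF : F.IsSubdivision) (p : Υ.C) (v : NR (Υ.cone p).N)
    (g : cellFns F p) :
    realForm (Module.Dual.eval ℤ _ g) (realMap (cellLattice hF p).toLinearMap v) =
      realForm (cellFnsEquiv hF p g) v := by
  rw [realForm_realMap]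
  rfl

end ConeComplex

namespace ConeComplex

variable {X : Type u} [TopologicalSpace X] {S : ConeComplex X} {Υ : PoicComplex.{u}}
  {F : PoicComplex.Hom Υ S.toPoic}

/-! ### The cone complex of a subdivision -/

/-- The identification of `N^p_ℝ` with the real-valued linear forms on the lattice of functions of
the cell `p`. -/
noncomputable def cellEval (hF : F.IsSubdivision) (p : Υ.C) :
    NR (Υ.cone p).N →ₗ[ℝ] (cellFns F p →ₗ[ℤ] ℝ) :=
  dualReal (cellFns F p) ∘ₗ realMap (cellLattice hF p).toLinearMap

theorem cellEval_apply (hF : F.IsSubdivision) (p : Υ.C) (v : NR (Υ.cone p).N) (g : cellFns F p) :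
    cellEval hF p v g = realForm (cellFnsEquiv hF p g) v :=
  realForm_cellLattice hF p v g

theorem cellEval_bijective (hF : F.IsSubdivision) (p : Υ.C) :
    Function.Bijective (cellEval hF p) := by
  have : Module.Free ℤ (cellFns F p) := Module.Free.of_equiv (cellFnsEquiv hF p).symm
  have : Module.Finite ℤ (cellFns F p) := Module.Finite.equiv (cellFnsEquiv hF p).symm
  exact (dualReal_bijective _).comp ((cellLattice hF p).baseChange ℤ ℝ _ _).bijective

/-- The linear forms given by evaluation at points of the cell are those given by the vectors of the
cone. -/
theorem cellEval_eq_evaluation_iff (hF : F.IsSubdivision) (p : Υ.C) (v : NR (Υ.cone p).N) :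
    (∃ x : cellPts F p, ∀ m : cellFns F p, cellEval hF p v m = m.1 x) ↔
      v ∈ (Υ.cone p).carrier := by
  constructor
  · rintro ⟨⟨x, w, hw, hx⟩, h⟩
    have e : cellEval hF p v = cellEval hF p w := LinearMap.ext fun m => (h m).trans <|
      ((cellEval_apply hF p w m).trans (hx.realForm_cellFnsEquiv hF m (x := ⟨x, w, hw, hx⟩))).symm
    rwa [(cellEval_bijective hF p).1 e]
  · intro hv
    obtain ⟨x, hx⟩ := exists_isPoint (F := F) hv
    exact ⟨⟨x, v, hv, hx⟩, fun m => (cellEval_apply hF p v m).trans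
      (hx.realForm_cellFnsEquiv hF m)⟩

/-- The integral cone in `|Σ|` that is the image of the cone `p` of a subdivision of `p(Σ)`; its
functions are the restrictions of the functions on the cone of `Σ`. -/
noncomputable def cell (hF : F.IsSubdivision) (p : Υ.C) : IntegralCone X where
  carrier := cellPts F p
  M := cellFns F p
  free := Module.Free.of_equiv (cellFnsEquiv hF p).symm
  fin := Module.Finite.equiv (cellFnsEquiv hF p).symm
  isEmbedding := by
    have h1 := (F.obj p : S.cones).1.isEmbedding.comp
      (IsEmbedding.inclusion (cellPts_subset F p))
    have h2 : Continuous fun (g : cellFns F p → ℝ) (m : (F.obj p : S.cones).1.M) =>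
        g (cellRestrict F p m) := by fun_prop
    exact IsEmbedding.of_comp (continuous_pi fun m => m.1.continuous) h2 h1
  rational := by
    obtain ⟨H, hH, e⟩ := (Υ.cone p).isCone.eq_of_isClosed (isClosed_carrier hF p)
    refine ⟨(cellFnsEquiv hF p).symm '' H, hH.image _, fun l => ?_⟩
    obtain ⟨v, rfl⟩ := (cellEval_bijective hF p).2 l
    rw [cellEval_eq_evaluation_iff, e, Set.forall_mem_image]
    simp only [cellEval_apply, LinearEquiv.apply_symm_apply]
    rfl
  strictlyConvex x y h m := by
    obtain ⟨n, rfl⟩ := cellRestrict_surjective p m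
    exact (F.obj p : S.cones).1.strictlyConvex (Set.inclusion (cellPts_subset F p) x)
      (Set.inclusion (cellPts_subset F p) y) (fun n => h (cellRestrict F p n)) n
  full := by
    have e : {l : cellFns F p →ₗ[ℤ] ℝ | ∃ x : cellPts F p, ∀ m : cellFns F p, l m = m.1 x} =
        cellEval hF p '' (Υ.cone p).carrier := by
      ext l
      obtain ⟨v, rfl⟩ := (cellEval_bijective hF p).2 l
      rw [(cellEval_bijective hF p).1.mem_set_image]
      exact cellEval_eq_evaluation_iff hF p v
    rw [e, ← Submodule.map_span, (Υ.cone p).full, Submodule.map_top,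
      LinearMap.range_eq_top.2 (cellEval_bijective hF p).2]

/-- The isomorphism of lattices `N^p → N^σ` for the cell `σ` of `p`. -/
noncomputable def cellMap (hF : F.IsSubdivision) (p : Υ.C) :
    (Υ.cone p).N →ₗ[ℤ] (cell hF p).N :=
  (cellLattice hF p).toLinearMap

theorem cellMap_bijective (hF : F.IsSubdivision) (p : Υ.C) : Function.Bijective (cellMap hF p) :=
  (cellLattice hF p).bijective

theorem IsPoint.represents_cell (hF : F.IsSubdivision) {p : Υ.C} {v : NR (Υ.cone p).N}
    {x : (cell hF p).carrier} (h : IsPoint F p v x.1) :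
    (cell hF p).Represents (realMap (cellMap hF p) v) x := fun m =>
  (realForm_cellLattice hF p v m).trans (h.realForm_cellFnsEquiv hF m)

theorem isSubcone_cell (hF : F.IsSubdivision) (p : Υ.C) :
    (cell hF p).IsSubcone (F.obj p : S.cones).1 :=
  ⟨cellPts_subset F p, fun _ => mem_cellFns⟩

theorem isSubcone_cell_of_le (hF : F.IsSubdivision) {p q : Υ.C} (h : p ≤ q) :
    (cell hF p).IsSubcone (cell hF q) :=
  ((isSubcone_cell hF p).trans (S.isFace (F.mono h)).1).of_subset (isSubcone_cell hF q)
    (cellPts_mono h)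

theorem cellMap_comp_map (hF : F.IsSubdivision) {p q : Υ.C} (h : p ≤ q) :
    cellMap hF q ∘ₗ (Υ.map h).lin =
      (IntegralCone.restrict (isSubcone_cell_of_le hF h)).dualMap ∘ₗ cellMap hF p := by
  apply IntegralCone.linearMap_ext_of_represents (cell hF q) (Υ.cone p).full
  intro v hv
  obtain ⟨x, hx⟩ := exists_isPoint (F := F) hv
  exact ⟨⟨x, _, (Υ.map h).maps v hv, hx.map h⟩, ((hx.map h).represents_cell hF).comp,
    ((hx.represents_cell hF (x := ⟨x, v, hv, hx⟩)).map (isSubcone_cell_of_le hF h)).comp⟩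

theorem cell_eq_of_le (hF : F.IsSubdivision) {p q : Υ.C} (h : p ≤ q) (h' : q ≤ p) :
    cell hF p = cell hF q :=
  (isSubcone_cell_of_le hF h).antisymm (cellPts_mono h')

/-- Cells are ordered by inclusion in the same way as the cones of the subdivision. -/
theorem le_of_cellPts_subset (hF : F.IsSubdivision) {p q : Υ.C} (h : cellPts F p ⊆ cellPts F q) :
    p ≤ q := by
  obtain ⟨x, hx⟩ := openCellPts_nonempty (F := F) p
  obtain ⟨r, hr, hx'⟩ := exists_le_mem_openCellPts (h (openCellPts_subset F p hx))
  exact (le_of_mem_openCellPts hF hx hx').trans hr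

/-- If a non-negative function `m` on the cell of `q` cuts out the face `p` of `q`, the cell of `p` is
the zero set of `m`. -/
theorem cellPts_eq_zeros (hF : F.IsSubdivision) {p q : Υ.C} (h : p ≤ q)
    {m : cellFns F q} (hm : ∀ x, 0 ≤ m.1 x)
    (e : (Υ.map h).real '' (Υ.cone p).carrier = (Υ.cone q).carrier ∩
      {v | 0 ≤ realForm (-cellFnsEquiv hF q m) v}) :
    cellPts F p = Subtype.val '' {x | m.1 x = 0} := by
  ext x
  constructor
  · rintro ⟨v, hv, hx⟩
    have h1 := e.subset ⟨v, hv, rfl⟩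
    have h2 := h1.2
    let x' : cellPts F q := ⟨x, _, h1.1, hx.map h⟩
    rw [Set.mem_ofPred_eq, IntegralCone.realForm_neg,
      (hx.map h).realForm_cellFnsEquiv hF (x := x')] at h2
    exact ⟨x', le_antisymm (neg_nonneg.1 h2) (hm _), rfl⟩
  · rintro ⟨x, hx0, rfl⟩
    obtain ⟨v, hv, hx⟩ := x.2
    have h1 : v ∈ (Υ.map h).real '' (Υ.cone p).carrier := by
      rw [e]
      refine ⟨hv, ?_⟩
      rw [Set.mem_ofPred_eq, IntegralCone.realForm_neg, hx.realForm_cellFnsEquiv hF]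
      exact (neg_eq_zero.2 hx0).ge
    obtain ⟨w, hw, rfl⟩ := h1
    obtain ⟨y, hy⟩ := exists_isPoint (F := F) hw
    obtain rfl := (hy.map h).point_unique hx
    exact ⟨w, hw, hy⟩

theorem isFace_cell_of_le (hF : F.IsSubdivision) {p q : Υ.C} (h : p ≤ q) :
    (cell hF p).IsFace (cell hF q) := by
  refine ⟨isSubcone_cell_of_le hF h, ?_⟩
  obtain ⟨-, f, hf, e⟩ := (Υ.isFaceEmbedding h).2.1
  obtain ⟨m, hm⟩ := (cellFnsEquiv hF q).surjective (-f)
  have hpos : ∀ x, 0 ≤ m.1 x := by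
    intro x
    obtain ⟨v, hv, hx⟩ := x.2
    rw [← hx.realForm_cellFnsEquiv hF m, hm, IntegralCone.realForm_neg]
    exact neg_nonneg.2 (hf v hv)
  refine ⟨m.1, m.2, hpos, cellPts_eq_zeros hF h hpos ?_⟩
  rw [hm, neg_neg]
  exact e

/-- The zero set of a non-negative function on a cell is a cell. -/
theorem exists_cell_eq_zeros (hF : F.IsSubdivision) (q : Υ.C) (m : cellFns F q)
    (hm : ∀ x, 0 ≤ m.1 x) : ∃ p ≤ q, cellPts F p = Subtype.val '' {x | m.1 x = 0} := by
  -- the apex of the closed cone shows that the zero set is not empty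
  obtain ⟨x₀, hx₀⟩ : ∃ x₀ : cellPts F q, m.1 x₀ = 0 := by
    obtain ⟨x, y⟩ := (cellEval_eq_evaluation_iff hF q 0).2 (by
      obtain ⟨H, hH, e⟩ := (Υ.cone q).isCone.eq_of_isClosed (isClosed_carrier hF q)
      rw [e]
      intro f _
      rw [map_zero])
    exact ⟨x, (y m).symm.trans (by rw [map_zero]; rfl)⟩
  have hform : ∀ {v} {x : cellPts F q}, IsPoint F q v x.1 →
      realForm (-cellFnsEquiv hF q m) v = -m.1 x := fun h => by
    rw [IntegralCone.realForm_neg, h.realForm_cellFnsEquiv hF]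
  obtain ⟨p, h, e⟩ := Υ.exists_face q ((Υ.cone q).carrier ∩
      {v | 0 ≤ realForm (-cellFnsEquiv hF q m) v}) ⟨by
    obtain ⟨v, hv, hx⟩ := x₀.2
    refine ⟨v, hv, ?_⟩
    rw [Set.mem_ofPred_eq, hform hx, hx₀, neg_zero], _, fun v hv => by
    obtain ⟨x, hx⟩ := exists_isPoint (F := F) hv
    rw [hform (x := ⟨x, v, hv, hx⟩) hx]
    exact neg_nonpos.2 (hm _), rfl⟩
  exact ⟨p, h, cellPts_eq_zeros hF h hm e⟩

/-- The cone complex formed by the cells of a subdivision of `p(Σ)`. -/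
noncomputable def cellComplex (hF : F.IsSubdivision) : ConeComplex X where
  cones := Set.range (cell hF)
  finite := by
    refine (Set.finite_range fun c : Υ.Classes => cell hF (Quotient.out c)).subset ?_
    rintro _ ⟨p, rfl⟩
    have h := Quotient.exact (Quotient.out_eq (Υ.cls p))
    exact ⟨Υ.cls p, cell_eq_of_le hF h.1 h.2⟩
  isClosed := by
    rintro _ ⟨p, rfl⟩
    exact isClosed_cellPts hF p
  covers x := by
    obtain ⟨p, hp⟩ := exists_mem_openCellPts hF x
    exact ⟨_, ⟨p, rfl⟩, openCellPts_subset F p hp⟩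
  face_mem := by
    rintro _ ⟨q, rfl⟩ m hm hpos
    obtain ⟨p, h, e⟩ := exists_cell_eq_zeros hF q ⟨m, hm⟩ hpos
    exact ⟨_, ⟨p, rfl⟩, isFace_cell_of_le hF h, e⟩
  inter := by
    rintro _ ⟨p, rfl⟩ _ ⟨q, rfl⟩ x ⟨hxp, hxq⟩
    obtain ⟨p', hp', hx⟩ := exists_le_mem_openCellPts hxp
    obtain ⟨q', hq', hx'⟩ := exists_le_mem_openCellPts hxq
    exact ⟨_, ⟨p', rfl⟩, isFace_cell_of_le hF hp',
      isFace_cell_of_le hF ((le_of_mem_openCellPts hF hx hx').trans hq'), openCellPts_subset F p' hx⟩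

theorem isProperSubdivision_cellComplex (hF : F.IsSubdivision) :
    (cellComplex hF).IsProperSubdivision S := by
  rintro _ ⟨p, rfl⟩
  exact ⟨_, (F.obj p : S.cones).2, isSubcone_cell hF p⟩

/-- The isomorphism from a subdivision `Υ` of `p(Σ)` to the poic-complex of its cells. -/
noncomputable def toCells (hF : F.IsSubdivision) : PoicComplex.Hom Υ (cellComplex hF).toPoic where
  obj p := (⟨cell hF p, p, rfl⟩ : (cellComplex hF).cones)
  mono _ _ h := cellPts_mono h
  η p :=
    { lin := cellMap hF p
      maps := fun v hv => by
        obtain ⟨x, hx⟩ := exists_isPoint (F := F) hv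
        exact ⟨⟨x, v, hv, hx⟩, hx.represents_cell hF⟩ }
  naturality {p q} h := by
    ext1
    exact cellMap_comp_map hF h
  not_in_proper_face p τ hτ hsub := by
    refine Set.Subset.antisymm ?_ fun v hv => hsub ?_
    · obtain ⟨-, f, -, rfl⟩ := hτ
      exact Set.inter_subset_left
    · obtain ⟨⟨x, w, hw, hx⟩, hv⟩ := hv
      exact ⟨w, hw, (hx.represents_cell hF).unique hv⟩

theorem isPoint_toCells_iff (hF : F.IsSubdivision) {p : Υ.C} {v : NR (Υ.cone p).N}
    (hv : v ∈ (Υ.cone p).carrier) {x : X} : IsPoint (toCells hF) p v x ↔ IsPoint F p v x := by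
  obtain ⟨y, hy⟩ := exists_isPoint (F := F) hv
  have hy' : IsPoint (toCells hF) p v y := ⟨⟨v, hv, hy⟩, hy.represents_cell hF⟩
  exact ⟨fun h => hy'.point_unique h ▸ hy, fun h => hy.point_unique h ▸ hy'⟩

theorem openCellPts_toCells (hF : F.IsSubdivision) (p : Υ.C) :
    openCellPts (toCells hF) p = openCellPts F p := by
  ext x
  exact exists_congr fun v => and_congr_right fun hv => isPoint_toCells_iff hF (interior_subset hv)

theorem isSubdivision_toCells (hF : F.IsSubdivision) : (toCells hF).IsSubdivision := by
  refine isSubdivision_of_openCellPts (fun x => ?_) (fun p q x hp hq => ?_) (fun p => ?_)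
    (fun p _ => cellMap_bijective hF p) fun p v hv => ?_
  · obtain ⟨p, hp⟩ := exists_mem_openCellPts hF x
    exact ⟨p, by rwa [openCellPts_toCells]⟩
  · rw [openCellPts_toCells] at hp hq
    exact le_of_mem_openCellPts hF hp hq
  · exact (cellMap_bijective hF p).1
  · obtain ⟨⟨x, w, hw, hx⟩, hv⟩ := hv.2
    exact ⟨w, hw, (hx.represents_cell hF).unique hv⟩

/-- The isomorphism `Υ → p(Σ')` onto the complex `Σ'` of cells is compatible with the structures of
subdivisions of `p(Σ)`. -/
theorem comp_toCells (hF : F.IsSubdivision)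
    {G : PoicComplex.Hom (cellComplex hF).toPoic S.toPoic} (hG : OverIdentity G) :
    G.comp (toCells hF) = F := by
  refine (hom_ext fun p v hv x hx => ?_).symm
  obtain ⟨h, h'⟩ := hG.isPoint (σ' := (toCells hF).obj p) (hx.represents_cell hF (x := ⟨x, v, hv, hx⟩))
  exact ⟨h, IntegralCone.Represents.comp (f := cellMap hF p)
    (g := (G.η ((toCells hF).obj p)).lin) h'⟩

end ConeComplex

/-! ### Balancing -/

section NormalVector

variable {N : Type u} [AddCommGroup N]

/-- A vector of `N / R` that is the class of an element of `P`. Both kinds of lattice normal vectors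
are of this form. -/
noncomputable def quotientVector (R : Submodule ℤ N) (P : Set N) : N ⧸ R :=
  Classical.epsilon fun u => ∃ n ∈ P, u = Submodule.Quotient.mk n

theorem finsum_quotientVector_eq_zero_iff {R R' : Submodule ℤ N} (hR : R = R') {ι ι' : Type*}
    (e : ι ≃ ι') {P : ι → Set N} {P' : ι' → Set N} (hP : ∀ i, P i = P' (e i)) {c : ι → ℤ}
    {c' : ι' → ℤ} (hc : ∀ i, c i = c' (e i)) :
    ∑ᶠ i, c i • quotientVector R (P i) = 0 ↔ ∑ᶠ i, c' i • quotientVector R' (P' i) = 0 := by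
  subst hR
  rw [← finsum_comp_equiv e]
  simp only [hP, hc]

end NormalVector

namespace PoicComplex

theorem dim_eq_of_le_of_le (Φ : PoicComplex.{u}) {p q : Φ.C} (h : p ≤ q) (h' : q ≤ p) :
    (Φ.cone p).dim = (Φ.cone q).dim := by
  have key : ∀ {p q : Φ.C}, p ≤ q → (Φ.cone p).dim ≤ (Φ.cone q).dim := fun h => by
    have := LinearMap.finrank_le_finrank_of_injective (Φ.isFaceEmbedding h).1
    rwa [NR.finrank_eq, NR.finrank_eq] at this
  exact le_antisymm (key h) (key h')

theorem cls_eq_iff (Φ : PoicComplex.{u}) {p q : Φ.C} : Φ.cls p = Φ.cls q ↔ p ≤ q ∧ q ≤ p :=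
  ⟨fun h => Quotient.exact h, fun h => Quotient.sound h⟩

theorem cls_mem_classesOfDim_iff (Φ : PoicComplex.{u}) {p : Φ.C} {k : ℕ} :
    Φ.cls p ∈ Φ.classesOfDim k ↔ (Φ.cone p).dim = k := by
  refine ⟨?_, fun h => ⟨p, h, rfl⟩⟩
  rintro ⟨q, rfl, e⟩
  obtain ⟨h, h'⟩ := (cls_eq_iff Φ).1 e
  exact (dim_eq_of_le_of_le Φ h h').symm

open Classical in
theorem Hom.pullback_cls {Υ Φ : PoicComplex.{u}} (S : Hom Υ Φ) {k : ℕ} (ω : Φ.Weights k) (p : Υ.C)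
    (hp : Υ.cls p ∈ Υ.classesOfDim k) : S.pullback ω ⟨Υ.cls p, hp⟩ =
      if h : (Φ.cone (S.obj p)).dim = k then
        ω ⟨Φ.cls (S.obj p), (cls_mem_classesOfDim_iff Φ).2 h⟩ else 0 := by
  have e : S.clsMap (Υ.cls p) = Φ.cls (S.obj p) := rfl
  by_cases h : (Φ.cone (S.obj p)).dim = k
  · rw [dif_pos h]
    exact dif_pos (c := S.clsMap (Υ.cls p) ∈ Φ.classesOfDim k) ((cls_mem_classesOfDim_iff Φ).2 h)
  · rw [dif_neg h]
    exact dif_neg (c := S.clsMap (Υ.cls p) ∈ Φ.classesOfDim k)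
      (fun h' => h ((cls_mem_classesOfDim_iff Φ).1 h'))

/-- The identity morphism. -/
def Hom.id (Φ : PoicComplex.{u}) : Hom Φ Φ where
  obj p := p
  mono _ _ h := h
  η p := Poic.Hom.id _
  naturality h := by
    ext1
    rfl
  not_in_proper_face p τ hτ h := by
    refine Set.Subset.antisymm ?_ fun x hx => h ⟨x, hx, by rw [Poic.Hom.real_id]; rfl⟩
    obtain ⟨-, f, -, rfl⟩ := hτ
    exact Set.inter_subset_left

end PoicComplex

namespace ConeComplex

variable {X : Type u} [TopologicalSpace X] {S : ConeComplex X}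

/-- The lattice map `N^p → N^σ` of a morphism to `p(Σ)` that maps `p` to `σ`. -/
def latticeMap {Υ : PoicComplex.{u}} (Q : PoicComplex.Hom Υ S.toPoic) (p : Υ.C) :
    (Υ.cone p).N →ₗ[ℤ] (Q.obj p : S.cones).1.N :=
  (Q.η p).lin

/-- Primitive vectors correspond along a morphism `Q` that identifies the lattices and the cones. -/
theorem isPrimitive_iff {Υ : PoicComplex.{u}} (Q : PoicComplex.Hom Υ S.toPoic)
    (hη : ∀ p, Function.Bijective (Q.η p).lin)
    (hcar : ∀ p, (S.toPoic.cone (Q.obj p)).carrier ⊆ (Q.η p).real '' (Υ.cone p).carrier)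
    {s t : Υ.C} (h : s ≤ t) (w : (Υ.cone t).N) : Υ.IsPrimitive h w ↔
      (∃ x : (Q.obj t : S.cones).1.carrier, ∀ m : (Q.obj t : S.cones).1.M,
        ((latticeMap Q t w m : ℤ) : ℝ) = m.1 x) ∧
      LinearMap.range (S.latticeIncl (Q.mono h)) ⊔ Submodule.span ℤ {latticeMap Q t w} = ⊤ := by
  refine and_congr ?_ ?_
  · have e : (Q.η t).real ((1 : ℝ) ⊗ₜ[ℤ] w) = (1 : ℝ) ⊗ₜ[ℤ] latticeMap Q t w := realMap_tmul _ _ _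
    have h1 : (1 : ℝ) ⊗ₜ[ℤ] w ∈ (Υ.cone t).carrier ↔
        (1 : ℝ) ⊗ₜ[ℤ] latticeMap Q t w ∈ (Q.obj t : S.cones).1.coneSet := by
      rw [← e]
      refine ⟨(Q.η t).maps _, fun hm => ?_⟩
      obtain ⟨v, hv, e'⟩ := hcar t hm
      rwa [← realMap_injective _ (hη t).1 e']
    rw [h1]
    refine exists_congr fun x => forall_congr' fun m => ?_
    have e2 : realForm (Module.Dual.eval ℤ _ m)
        ((1 : ℝ) ⊗ₜ[ℤ] latticeMap Q t w) =
          ((latticeMap Q t w m : ℤ) : ℝ) := by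
      rw [realForm_tmul, mul_one]
      rfl
    exact e2 ▸ Iff.rfl
  · have e1 : latticeMap Q t ∘ₗ (Υ.map h).lin = S.latticeIncl (Q.mono h) ∘ₗ latticeMap Q s :=
      congrArg Poic.Hom.lin (Q.naturality h)
    have e2 : LinearMap.range (S.latticeIncl (Q.mono h)) =
        (LinearMap.range (Υ.map h).lin).map (latticeMap Q t) := by
      rw [← LinearMap.range_comp, e1]
      exact (LinearMap.range_comp_of_range_eq_top _ (LinearMap.range_eq_top.2 (hη s).2)).symm
    have e3 : Submodule.span ℤ {latticeMap Q t w} =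
        (Submodule.span ℤ {w}).map (latticeMap Q t) := by
      rw [Submodule.map_span, Set.image_singleton]
    rw [e2, e3]
    rw [← Submodule.map_sup]
    constructor
    · intro h1
      rw [h1, Submodule.map_top]
      exact LinearMap.range_eq_top.2 (hη t).2
    · intro h1
      apply Submodule.map_injective_of_injective (f := latticeMap Q t) (hη t).1
      rw [h1, Submodule.map_top]
      exact (LinearMap.range_eq_top.2 (hη t).2).symm

variable {N : Type u} [AddCommGroup N] [Module.Free ℤ N] [Module.Finite ℤ N]

/-- The balancing conditions agree along an isomorphism `Q` of linear poic-complexes. -/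
theorem mem_minkowski_iff (φ : WeakEmbedding S N) {k : ℕ} {Υ : PoicComplex.{u}}
    (Q : PoicComplex.Hom Υ S.toPoic) (hη : ∀ p, Function.Bijective (Q.η p).lin)
    (hcar : ∀ p, (S.toPoic.cone (Q.obj p)).carrier ⊆ (Q.η p).real '' (Υ.cone p).carrier)
    (hsurj : ∀ σ : S.cones, ∃ p, Q.obj p = σ) (hrefl : ∀ p q, Q.obj p ≤ Q.obj q → p ≤ q)
    (Y : PoicComplex.Hom Υ (PoicComplex.ofLattice N))
    (hY : ∀ p, Y.linAt p = φ.linAt (Q.obj p) ∘ₗ (Q.η p).lin)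
    (B : S.conesOfDim k ≃ Υ.classesOfDim k)
    (hB : ∀ σ p, Q.obj p = σ.1 → (B σ).1 = Υ.cls p) (c : S.Weights k) :
    c ∈ minkowski φ k ↔ AddEquiv.arrowCongr B (AddEquiv.refl ℤ) c ∈ PoicComplex.minkowski Y k := by
  have hdim : ∀ p, (Υ.cone p).dim = (Q.obj p : S.cones).1.dim := fun p =>
    (LinearEquiv.ofBijective _ (hη p)).finrank_eq
  -- two cones are isomorphic if and only if they correspond to the same cone of `Σ`
  have hobj : ∀ (σ : S.conesOfDim k) (t : Υ.C), Υ.cls t = (B σ).1 ↔ Q.obj t = σ.1 := by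
    intro σ t
    refine ⟨fun ht => ?_, fun ht => (hB σ t ht).symm⟩
    obtain ⟨t', ht'⟩ := hsurj σ.1
    rw [hB σ t' ht', PoicComplex.cls_eq_iff] at ht
    exact (le_antisymm (α := S.cones) (Q.mono ht.1) (Q.mono ht.2)).trans ht'
  have key : ∀ s : Υ.C,
      (∑ᶠ σ : {σ : S.conesOfDim k // (Q.obj s : S.cones) ≤ σ.1}, c σ.1 • normalVector φ σ.2 = 0 ↔
        ∑ᶠ cl : Υ.star k s, AddEquiv.arrowCongr B (AddEquiv.refl ℤ) c cl.1 •
          Y.normalVector s cl.1 = 0) := by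
    intro s
    have hstar : ∀ σ : S.conesOfDim k, (Q.obj s : S.cones) ≤ σ.1 ↔ B σ ∈ Υ.star k s := by
      intro σ
      obtain ⟨t, ht⟩ := hsurj σ.1
      constructor
      · intro h
        exact ⟨t, hrefl _ _ (ht ▸ h), (hobj σ t).2 ht⟩
      · rintro ⟨t', h, ht'⟩
        rw [← (hobj σ t').1 ht']
        exact Q.mono h
    have h1 : ∀ σ : {σ : S.conesOfDim k // (Q.obj s : S.cones) ≤ σ.1}, normalVector φ σ.2 =
        quotientVector (LinearMap.range (φ.linAt (Q.obj s))) {n | ∃ w : σ.1.1.1.N,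
          (∃ x : σ.1.1.1.carrier, ∀ m : σ.1.1.1.M, ((w m : ℤ) : ℝ) = m.1 x) ∧
          LinearMap.range (S.latticeIncl σ.2) ⊔ Submodule.span ℤ {w} = ⊤ ∧
          n = φ.linAt σ.1.1 w} := by
      intro σ
      refine congrArg Classical.epsilon (funext fun u => propext ⟨?_, ?_⟩)
      · rintro ⟨w, h1, h2, h3⟩
        exact ⟨_, ⟨w, h1, h2, rfl⟩, h3⟩
      · rintro ⟨_, ⟨w, h1, h2, rfl⟩, h3⟩
        exact ⟨w, h1, h2, h3⟩
    have h2 : ∀ cl : Υ.star k s, Y.normalVector s cl.1 =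
        quotientVector (LinearMap.range (Y.linAt s)) {n | ∃ (t : Υ.C) (h : s ≤ t)
          (w : (Υ.cone t).N), Υ.cls t = cl.1 ∧ Υ.IsPrimitive h w ∧ n = Y.linAt t w} := by
      intro cl
      refine congrArg Classical.epsilon (funext fun u => propext ⟨?_, ?_⟩)
      · rintro ⟨t, h, w, h1, h2, h3⟩
        exact ⟨_, ⟨t, h, w, h1, h2, rfl⟩, h3⟩
      · rintro ⟨_, ⟨t, h, w, h1, h2, rfl⟩, h3⟩
        exact ⟨t, h, w, h1, h2, h3⟩
    simp only [h1, h2]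
    refine finsum_quotientVector_eq_zero_iff ?_ (B.subtypeEquiv hstar) ?_ ?_
    · rw [hY s]
      exact (LinearMap.range_comp_of_range_eq_top _ (LinearMap.range_eq_top.2 (hη s).2)).symm
    · rintro ⟨⟨σ, hσ⟩, hle⟩
      ext n
      constructor
      · rintro ⟨w, hw1, hw2, rfl⟩
        obtain ⟨t, rfl⟩ := hsurj σ
        obtain ⟨w, rfl⟩ := (hη t).2 w
        refine ⟨t, hrefl _ _ hle, w, (hobj _ t).2 rfl, (isPrimitive_iff Q hη hcar _ w).2 ⟨hw1, hw2⟩, ?_⟩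
        rw [hY t]
        rfl
      · rintro ⟨t, h, w, ht, hw, rfl⟩
        obtain rfl : Q.obj t = σ := (hobj ⟨σ, hσ⟩ t).1 ht
        obtain ⟨hw1, hw2⟩ := (isPrimitive_iff Q hη hcar h w).1 hw
        refine ⟨_, hw1, hw2, ?_⟩
        rw [hY t]
        rfl
    · intro σ
      exact (congrArg c (B.symm_apply_apply σ.1)).symm
  constructor
  · intro hc s hs
    exact (key s).1 (hc (Q.obj s) (by rw [← hdim]; exact hs))
  · intro hc τ hτ
    obtain ⟨s, rfl⟩ := hsurj τ
    exact (key s).2 (hc s (by rw [hdim]; exact hτ))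

theorem classEquiv_apply (S : ConeComplex X) (k : ℕ) (σ : S.conesOfDim k) :
    (S.classEquiv k σ).1 = S.toPoic.cls σ.1 := rfl

theorem weightEquiv_cls (S : ConeComplex X) {k : ℕ} (c : S.Weights k) (σ : S.conesOfDim k)
    (h : S.toPoic.cls σ.1 ∈ S.toPoic.classesOfDim k) :
    S.weightEquiv k c ⟨S.toPoic.cls σ.1, h⟩ = c σ :=
  congrArg c ((S.classEquiv k).symm_apply_apply σ)

variable {S' : ConeComplex X}

/-- The two linear structures on `p(Σ')` agree. -/
theorem linAt_ofSubdivision (φ : WeakEmbedding S N) (h : S'.IsProperSubdivision S)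
    {F : PoicComplex.Hom S'.toPoic S.toPoic} (hF : OverIdentity F) (σ' : S'.cones) :
    (φ.toPoic.comp F).linAt σ' = (φ.ofSubdivision h).linAt σ' := by
  obtain rfl := hF.unique (overIdentity_subdivisionHom h)
  rfl

theorem mem_minkowski_iff_weightEquiv (φ : WeakEmbedding S N) (h : S'.IsProperSubdivision S)
    {F : PoicComplex.Hom S'.toPoic S.toPoic} (hF : OverIdentity F) {k : ℕ} (c : S'.Weights k) :
    c ∈ minkowski (φ.ofSubdivision h) k ↔
      S'.weightEquiv k c ∈ PoicComplex.minkowski (φ.toPoic.comp F) k := by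
  refine mem_minkowski_iff (φ.ofSubdivision h) (PoicComplex.Hom.id S'.toPoic)
    (fun p => Function.bijective_id) (fun p v hv => ⟨v, hv, ?_⟩) (fun σ => ⟨σ, rfl⟩)
    (fun p q h => h) (φ.toPoic.comp F) (fun p => linAt_ofSubdivision φ h hF p) (S'.classEquiv k)
    (fun σ p e => ?_) c
  · exact LinearMap.congr_fun (Poic.Hom.real_id _) v
  · rw [classEquiv_apply, ← e]
    rfl

open Classical in
/-- The pullback of a weight, computed with the smallest cone `s` that contains a given cone. -/
theorem pullback_apply {k : ℕ} (c : S.Weights k) (σ' : S'.conesOfDim k) (s : S.cones)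
    (hs : σ'.1.1.IsSubcone s.1) {x : X} (hx : x ∈ σ'.1.1.carrier) (hxs : x ∈ s.1.relintPts) :
    pullback c S' σ' = if h : s.1.dim = k then c ⟨s, h⟩ else 0 := by
  have hle : ∀ σ : S.conesOfDim k, σ'.1.1.carrier ⊆ σ.1.1.carrier → s = σ.1 := by
    intro σ hσ
    have hk : σ'.1.1.dim = k := σ'.2
    have hk' : σ.1.1.dim = k := σ.2
    exact eq_of_le_of_dim_le (le_of_mem_relintPts hxs (hσ hx)) (by rw [hk', ← hk]; exact hs.dim_le)
  by_cases h : ∃ σ : S.conesOfDim k, σ'.1.1.carrier ⊆ σ.1.1.carrier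
  · have e := hle _ h.choose_spec
    have hd : s.1.dim = k := by rw [e]; exact h.choose.2
    rw [pullback, dif_pos h, dif_pos hd]
    exact congrArg c (Subtype.ext e.symm)
  · rw [pullback, dif_neg h, dif_neg fun hd : s.1.dim = k => h ⟨⟨s, hd⟩, hs.1⟩]

end ConeComplex

namespace ConeComplex

variable {X : Type u} [TopologicalSpace X] {S : ConeComplex X}
  {N : Type u} [AddCommGroup N] [Module.Free ℤ N] [Module.Finite ℤ N]

/-! ### Weights on the cells of a subdivision -/

section CellWeights

variable {Υ : PoicComplex.{u}} {F : PoicComplex.Hom Υ S.toPoic}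

theorem dim_cell (hF : F.IsSubdivision) (p : Υ.C) : (cell hF p).dim = (Υ.cone p).dim :=
  (LinearEquiv.ofBijective _ (cellMap_bijective hF p)).finrank_eq.symm

/-- The bijection between the `k`-dimensional cells and the classes of `k`-dimensional cones. -/
noncomputable def cellClassEquiv (hF : F.IsSubdivision) (k : ℕ) :
    (cellComplex hF).conesOfDim k ≃ Υ.classesOfDim k :=
  Equiv.ofBijective (fun σ => ⟨Υ.cls σ.1.2.choose, _, by
    rw [← dim_cell hF, σ.1.2.choose_spec]
    exact σ.2, rfl⟩) <| by
    constructor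
    · intro σ τ h
      obtain ⟨h1, h2⟩ := (PoicComplex.cls_eq_iff Υ).1 (congrArg Subtype.val h)
      refine Subtype.ext (Subtype.ext ?_)
      rw [← σ.1.2.choose_spec, ← τ.1.2.choose_spec]
      exact cell_eq_of_le hF h1 h2
    · rintro ⟨_, p, hp, rfl⟩
      let σ : (cellComplex hF).conesOfDim k := ⟨⟨cell hF p, p, rfl⟩, (dim_cell hF p).trans hp⟩
      refine ⟨σ, Subtype.ext ((PoicComplex.cls_eq_iff Υ).2 ?_)⟩
      have e : cell hF σ.1.2.choose = cell hF p := σ.1.2.choose_spec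
      exact ⟨le_of_cellPts_subset hF (congrArg IntegralCone.carrier e).subset,
        le_of_cellPts_subset hF (congrArg IntegralCone.carrier e).superset⟩

theorem cellClassEquiv_apply (hF : F.IsSubdivision) (k : ℕ) (σ : (cellComplex hF).conesOfDim k)
    (p : Υ.C) (h : (toCells hF).obj p = σ.1) : (cellClassEquiv hF k σ).1 = Υ.cls p := by
  have e : cell hF σ.1.2.choose = cell hF p := σ.1.2.choose_spec.trans (congrArg Subtype.val h).symm
  exact (PoicComplex.cls_eq_iff Υ).2
    ⟨le_of_cellPts_subset hF (congrArg IntegralCone.carrier e).subset,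
      le_of_cellPts_subset hF (congrArg IntegralCone.carrier e).superset⟩

/-- The identification of weights on the cells of a subdivision with weights on the subdivision. -/
noncomputable def cellWeightEquiv (hF : F.IsSubdivision) (k : ℕ) :
    (cellComplex hF).Weights k ≃+ Υ.Weights k :=
  AddEquiv.arrowCongr (cellClassEquiv hF k) (AddEquiv.refl ℤ)

theorem cellWeightEquiv_symm_apply (hF : F.IsSubdivision) {k : ℕ} (ω : Υ.Weights k) (p : Υ.C)
    (h : (cell hF p).dim = k) (h' : Υ.cls p ∈ Υ.classesOfDim k) :
    (cellWeightEquiv hF k).symm ω ⟨(⟨cell hF p, p, rfl⟩ : (cellComplex hF).cones), h⟩ =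
      ω ⟨Υ.cls p, h'⟩ :=
  congrArg ω (Subtype.ext (cellClassEquiv_apply hF k _ p rfl))

theorem mem_minkowski_iff_cellWeightEquiv (φ : WeakEmbedding S N) (hF : F.IsSubdivision) {k : ℕ}
    (c : (cellComplex hF).Weights k) :
    c ∈ minkowski (φ.ofSubdivision (isProperSubdivision_cellComplex hF)) k ↔
      cellWeightEquiv hF k c ∈ PoicComplex.minkowski (φ.toPoic.comp F) k := by
  have hsub := isProperSubdivision_cellComplex hF
  have hG := overIdentity_subdivisionHom hsub
  refine mem_minkowski_iff (φ.ofSubdivision hsub) (toCells hF) (cellMap_bijective hF) ?_ ?_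
    (fun p q => le_of_cellPts_subset hF) (φ.toPoic.comp F) (fun p => ?_) (cellClassEquiv hF k)
    (cellClassEquiv_apply hF k) c
  · rintro p v ⟨⟨x, w, hw, hx⟩, hv⟩
    exact ⟨w, hw, (hx.represents_cell hF).unique hv⟩
  · rintro ⟨_, p, rfl⟩
    exact ⟨p, rfl⟩
  · have e : (φ.toPoic.comp F).linAt p =
        (φ.toPoic.comp ((subdivisionHom hsub).comp (toCells hF))).linAt p := by
      rw [comp_toCells hF hG]
    exact e.trans rfl

end CellWeights

/-! ### Tropical cycles -/

namespace Cycles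

variable (φ : WeakEmbedding S N) (k : ℕ)

open Classical in
/-- The homomorphism from Minkowski weights on a proper subdivision to tropical cycles. -/
noncomputable def mkHom (S' : S.ProperSubd) : minkowski (φ.ofSubdivision S'.2) k →+ Cycles φ k :=
  (QuotientAddGroup.mk' (cycleRelations φ k)).comp
    (DirectSum.of (fun S' : S.ProperSubd => minkowski (φ.ofSubdivision S'.2) k) S')

theorem mk_eq (S' S'' : S.ProperSubd) (h : S''.1.IsProperSubdivision S'.1)
    (c : minkowski (φ.ofSubdivision S'.2) k) (c'' : minkowski (φ.ofSubdivision S''.2) k)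
    (hc : c''.1 = pullback c.1 S''.1) : mk φ k S' c = mk φ k S'' c'' := by
  rw [← sub_eq_zero]
  exact (QuotientAddGroup.eq_zero_iff _).2
    (AddSubgroup.subset_closure ⟨S', S'', c, c'', h, hc, rfl⟩)

variable {φ k}

open Classical in
theorem hom_ext {A : Type*} [AddCommGroup A] {f g : Cycles φ k →+ A}
    (h : ∀ S' c, f (mk φ k S' c) = g (mk φ k S' c)) : f = g := by
  refine QuotientAddGroup.addMonoidHom_ext _ (DirectSum.addHom_ext fun S' c => ?_)
  exact h S' c

open Classical in
theorem exists_lift {A : Type*} [AddCommGroup A]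
    (f : ∀ S' : S.ProperSubd, minkowski (φ.ofSubdivision S'.2) k →+ A)
    (hf : ∀ (S' S'' : S.ProperSubd) (c : minkowski (φ.ofSubdivision S'.2) k)
      (c'' : minkowski (φ.ofSubdivision S''.2) k), S''.1.IsProperSubdivision S'.1 →
      c''.1 = pullback c.1 S''.1 → f S' c = f S'' c'') :
    ∃ g : Cycles φ k →+ A, ∀ S' c, g (mk φ k S' c) = f S' c := by
  let g := DirectSum.toAddMonoid f
  have hg : ∀ S' c, g (DirectSum.of _ S' c) = f S' c := DirectSum.toAddMonoid_of f
  have hle : cycleRelations φ k ≤ g.ker := by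
    refine (AddSubgroup.closure_le _).2 ?_
    rintro _ ⟨S', S'', c, c'', h, hc, rfl⟩
    refine (AddMonoidHom.mem_ker).2 ?_
    rw [map_sub, sub_eq_zero]
    exact (hg S' c).trans ((hf S' S'' c c'' h hc).trans (hg S'' c'').symm)
  refine ⟨QuotientAddGroup.lift _ g hle, fun S' c => ?_⟩
  exact hg S' c

end Cycles

end ConeComplex

namespace PoicComplex.Cycles

variable {Φ : PoicComplex.{u}} {N : Type u} [AddCommGroup N] [Module.Free ℤ N] [Module.Finite ℤ N]
  (X : Hom Φ (ofLattice N)) (k : ℕ)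

open Classical in
/-- The homomorphism from Minkowski weights on a subdivision to tropical cycles. -/
noncomputable def mkHom (S : Φ.Subd) : minkowski (X.comp S.hom) k →+ Cycles X k :=
  (QuotientAddGroup.mk' (cycleRelations X k)).comp
    (DirectSum.of (fun S : Φ.Subd => minkowski (X.comp S.hom) k) S)

theorem mk_eq (S S' : Φ.Subd) (Q : Hom S'.source S.source) (hQ : Q.IsSubdivision)
    (h : S.hom.comp Q = S'.hom) (ω : minkowski (X.comp S.hom) k)
    (ω' : minkowski (X.comp S'.hom) k) (hω : ω'.1 = Q.pullback ω.1) :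
    mk X k S ω = mk X k S' ω' := by
  rw [← sub_eq_zero]
  exact (QuotientAddGroup.eq_zero_iff _).2
    (AddSubgroup.subset_closure ⟨S, S', Q, ω, ω', hQ, h, hω, rfl⟩)

variable {X k}

open Classical in
theorem hom_ext {A : Type*} [AddCommGroup A] {f g : Cycles X k →+ A}
    (h : ∀ S ω, f (mk X k S ω) = g (mk X k S ω)) : f = g := by
  refine QuotientAddGroup.addMonoidHom_ext _ (DirectSum.addHom_ext fun S ω => ?_)
  exact h S ω

open Classical in
theorem exists_lift {A : Type*} [AddCommGroup A]
    (f : ∀ S : Φ.Subd, minkowski (X.comp S.hom) k →+ A)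
    (hf : ∀ (S S' : Φ.Subd) (Q : Hom S'.source S.source) (ω : minkowski (X.comp S.hom) k)
      (ω' : minkowski (X.comp S'.hom) k), Q.IsSubdivision → S.hom.comp Q = S'.hom →
      ω'.1 = Q.pullback ω.1 → f S ω = f S' ω') :
    ∃ g : Cycles X k →+ A, ∀ S ω, g (mk X k S ω) = f S ω := by
  let g := DirectSum.toAddMonoid f
  have hg : ∀ S ω, g (DirectSum.of _ S ω) = f S ω := DirectSum.toAddMonoid_of f
  have hle : cycleRelations X k ≤ g.ker := by
    refine (AddSubgroup.closure_le _).2 ?_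
    rintro _ ⟨S, S', Q, ω, ω', hQ, h, hω, rfl⟩
    refine (AddMonoidHom.mem_ker).2 ?_
    rw [map_sub, sub_eq_zero]
    exact (hg S ω).trans ((hf S S' Q ω ω' hQ h hω).trans (hg S' ω').symm)
  refine ⟨QuotientAddGroup.lift _ g hle, fun S ω => ?_⟩
  exact hg S ω

end PoicComplex.Cycles

namespace ConeComplex

variable {X : Type u} [TopologicalSpace X] {S : ConeComplex X}
  {N : Type u} [AddCommGroup N] [Module.Free ℤ N] [Module.Finite ℤ N]

/-- The subdivision of `p(Σ)` given by a proper subdivision of `Σ`. -/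
noncomputable def toSubd (S' : S.ProperSubd) : S.toPoic.Subd :=
  ⟨S'.1.toPoic, subdivisionHom S'.2, isSubdivision_subdivisionHom S'.2⟩

/-- The proper subdivision of `Σ` formed by the cells of a subdivision of `p(Σ)`. -/
noncomputable def ofSubd (T : S.toPoic.Subd) : S.ProperSubd :=
  ⟨cellComplex T.isSubdivision, isProperSubdivision_cellComplex T.isSubdivision⟩

/-- The passage from Minkowski weights on `Σ'` to Minkowski weights on `p(Σ')`. -/
noncomputable def minkowskiToPoic (φ : WeakEmbedding S N) (k : ℕ) (S' : S.ProperSubd) :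
    minkowski (φ.ofSubdivision S'.2) k →+ PoicComplex.minkowski (φ.toPoic.comp (toSubd S').hom) k :=
  ((S'.1.weightEquiv k).toAddMonoidHom.comp (AddSubgroup.subtype _)).codRestrict _ fun c =>
    (mem_minkowski_iff_weightEquiv φ S'.2 (overIdentity_subdivisionHom S'.2) c.1).1 c.2

/-- The passage from Minkowski weights on a subdivision of `p(Σ)` to Minkowski weights on its cell
complex. -/
noncomputable def minkowskiOfPoic (φ : WeakEmbedding S N) (k : ℕ) (T : S.toPoic.Subd) :
    PoicComplex.minkowski (φ.toPoic.comp T.hom) k →+ minkowski (φ.ofSubdivision (ofSubd T).2) k :=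
  ((cellWeightEquiv T.isSubdivision k).symm.toAddMonoidHom.comp (AddSubgroup.subtype _)).codRestrict
    _ fun ω => (mem_minkowski_iff_cellWeightEquiv φ T.isSubdivision _).2 (by
      have e := (cellWeightEquiv T.isSubdivision k).apply_symm_apply ω.1
      exact (congrArg (· ∈ PoicComplex.minkowski (φ.toPoic.comp T.hom) k) e).mpr ω.2)

/-- Pullbacks along proper subdivisions are pullbacks along the morphisms of poic-complexes. -/
theorem weightEquiv_pullback {S' S'' : ConeComplex X} (h : S''.IsProperSubdivision S') {k : ℕ}
    (c : S'.Weights k) : S''.weightEquiv k (pullback c S'') =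
      (subdivisionHom h).pullback (S'.weightEquiv k c) := by
  classical
  funext ⟨_, σ, hσ, rfl⟩
  change S''.cones at σ
  obtain ⟨x, hx⟩ := σ.1.relintPts_nonempty
  refine Eq.trans ?_ ((subdivisionHom h).pullback_cls _ σ _).symm
  refine (weightEquiv_cls S'' _ ⟨σ, hσ⟩ _).trans ((pullback_apply c ⟨σ, hσ⟩ (minimalCone h σ)
    (isSubcone_minimalCone h σ) hx.1 (relintPts_subset_minimalCone h σ hx)).trans ?_)
  by_cases hd : (minimalCone h σ).1.dim = k
  · rw [dif_pos hd]
    refine Eq.trans ?_ (dif_pos hd).symm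
    exact (weightEquiv_cls S' c ⟨minimalCone h σ, hd⟩ _).symm
  · rw [dif_neg hd]
    symm
    exact dif_neg hd

theorem subdivisionHom_comp {S' S'' : ConeComplex X} (h : S''.IsProperSubdivision S')
    (h' : S'.IsProperSubdivision S) (h'' : S''.IsProperSubdivision S) :
    (subdivisionHom h').comp (subdivisionHom h) = subdivisionHom h'' := by
  refine OverIdentity.unique (fun σ x v hv => ?_) (overIdentity_subdivisionHom h'')
  obtain ⟨h1, h2⟩ := overIdentity_subdivisionHom h σ x v hv
  obtain ⟨h3, h4⟩ := overIdentity_subdivisionHom h' _ ⟨x.1, h1⟩ _ h2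
  exact ⟨h3, h4.comp⟩

section Refinement

variable {Υ Υ' : PoicComplex.{u}} {F : PoicComplex.Hom Υ S.toPoic} {Q : PoicComplex.Hom Υ' Υ}

theorem isPoint_comp_iff {p : Υ'.C} {v : NR (Υ'.cone p).N} {x : X} :
    IsPoint (F.comp Q) p v x ↔ IsPoint F (Q.obj p) ((Q.η p).real v) x := by
  have e : ((F.comp Q).η p).real v = (F.η (Q.obj p)).real ((Q.η p).real v) :=
    LinearMap.congr_fun (Poic.Hom.real_comp _ _) v
  refine exists_congr fun h => ?_
  rw [e]
  rfl

theorem cellPts_comp_subset (p : Υ'.C) : cellPts (F.comp Q) p ⊆ cellPts F (Q.obj p) :=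
  fun _ ⟨v, hv, hx⟩ => ⟨_, (Q.η p).maps v hv, isPoint_comp_iff.1 hx⟩

theorem openCellPts_comp_subset (p : Υ'.C) : openCellPts (F.comp Q) p ⊆ openCellPts F (Q.obj p) :=
  fun _ ⟨_, hv, hx⟩ => ⟨_, Q.maps_relint p hv, isPoint_comp_iff.1 hx⟩

variable (hF : F.IsSubdivision) (hF' : (F.comp Q).IsSubdivision)

theorem isSubcone_cell_comp (p : Υ'.C) : (cell hF' p).IsSubcone (cell hF (Q.obj p)) :=
  (isSubcone_cell hF' p).of_subset (isSubcone_cell hF (Q.obj p)) (cellPts_comp_subset p)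

theorem cellComplex_comp : (cellComplex hF').IsProperSubdivision (cellComplex hF) := by
  rintro _ ⟨p, rfl⟩
  exact ⟨_, ⟨Q.obj p, rfl⟩, isSubcone_cell_comp hF hF' p⟩

theorem openCellPts_subset_relintPts_cell (p : Υ.C) : openCellPts F p ⊆ (cell hF p).relintPts := by
  rw [← openCellPts_toCells hF]
  exact openCellPts_subset_relintPts (F := toCells hF) p

/-- Pullbacks along a refinement `Q` of subdivisions of `p(Σ)` are pullbacks of weights between the
cell complexes. -/
theorem cellWeightEquiv_symm_pullback {k : ℕ} (ω : Υ.Weights k) :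
    (cellWeightEquiv hF' k).symm (Q.pullback ω) =
      pullback ((cellWeightEquiv hF k).symm ω) (cellComplex hF') := by
  classical
  funext ⟨⟨_, p, rfl⟩, hp⟩
  obtain ⟨x, hx⟩ := openCellPts_nonempty (F := F.comp Q) p
  have hk : (Υ'.cone p).dim = k := (dim_cell hF' p).symm.trans hp
  rw [cellWeightEquiv_symm_apply hF' _ p hp ((PoicComplex.cls_mem_classesOfDim_iff Υ').2 hk),
    PoicComplex.Hom.pullback_cls]
  refine Eq.trans ?_ (pullback_apply _ _ (⟨cell hF (Q.obj p), _, rfl⟩ : (cellComplex hF).cones)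
    (isSubcone_cell_comp hF hF' p) (openCellPts_subset _ p hx)
    (openCellPts_subset_relintPts_cell hF _ (openCellPts_comp_subset p hx))).symm
  by_cases hd : (Υ.cone (Q.obj p)).dim = k
  · rw [dif_pos hd, dif_pos ((dim_cell hF _).trans hd), cellWeightEquiv_symm_apply]
  · rw [dif_neg hd, dif_neg fun h => hd ((dim_cell hF _).symm.trans h)]

/-- A weight on `Υ` is the pullback along `Υ → p(Σ')` of the corresponding weight on the cells. -/
theorem toCells_pullback {k : ℕ} (ω : Υ.Weights k) :
    (toCells hF).pullback ((cellComplex hF).weightEquiv k ((cellWeightEquiv hF k).symm ω)) = ω := by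
  classical
  funext ⟨_, p, hp, rfl⟩
  have hd : (cell hF p).dim = k := (dim_cell hF p).trans hp
  refine ((toCells hF).pullback_cls _ p _).trans ((dif_pos hd).trans ?_)
  refine (weightEquiv_cls (cellComplex hF) _ ⟨⟨cell hF p, p, rfl⟩, hd⟩ _).trans ?_
  exact cellWeightEquiv_symm_apply hF ω p hd _

end Refinement

section Identity

variable {S' : ConeComplex X} {F : PoicComplex.Hom S'.toPoic S.toPoic} (hF : F.IsSubdivision)

theorem OverIdentity.isSubcone_cell (hover : OverIdentity F) (h : S'.IsProperSubdivision S) (σ : S'.cones) :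
    (cell hF σ).IsSubcone σ.1 := by
  obtain rfl := hover.unique (overIdentity_subdivisionHom h)
  refine (ConeComplex.isSubcone_cell hF σ).of_subset (isSubcone_minimalCone h σ) ?_
  rintro x ⟨v, ⟨y, hy⟩, hx⟩
  rw [hx.point_unique (hover.isPoint hy)]
  exact y.2

/-- The cell complex of `p(Σ')` has the same cones as `Σ'`; that it refines `Σ'` is all that the
colimit needs. -/
theorem OverIdentity.cellComplex_isProperSubdivision (hover : OverIdentity F)
    (h : S'.IsProperSubdivision S) : (cellComplex hF).IsProperSubdivision S' := by
  rintro _ ⟨σ, rfl⟩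
  exact ⟨_, (σ : S'.cones).2, hover.isSubcone_cell hF h σ⟩

theorem OverIdentity.cellWeightEquiv_symm_weightEquiv (hover : OverIdentity F)
    (h : S'.IsProperSubdivision S) {k : ℕ} (c : S'.Weights k) :
    (cellWeightEquiv hF k).symm (S'.weightEquiv k c) = pullback c (cellComplex hF) := by
  classical
  funext ⟨⟨_, p, rfl⟩, hp⟩
  change S'.cones at p
  obtain ⟨x, hx⟩ := openCellPts_nonempty (F := F) p
  have hk : p.1.dim = k := (dim_cell hF p).symm.trans hp
  refine (cellWeightEquiv_symm_apply hF _ p hp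
    ((PoicComplex.cls_mem_classesOfDim_iff S'.toPoic).2 hk)).trans ?_
  refine (weightEquiv_cls S' c ⟨p, hk⟩ _).trans ?_
  refine Eq.trans ?_ (pullback_apply c _ p (hover.isSubcone_cell hF h p)
    (openCellPts_subset F p hx) ((hover.openCellPts_eq p).subset hx)).symm
  rw [dif_pos hk]

end Identity

/-! ### The comparison of tropical cycles -/

variable (φ : WeakEmbedding S N) (k : ℕ)

theorem exists_cyclesToPoic : ∃ f : Cycles φ k →+ PoicComplex.Cycles φ.toPoic k,
    ∀ S' c, f (Cycles.mk φ k S' c) =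
      PoicComplex.Cycles.mk φ.toPoic k (toSubd S') (minkowskiToPoic φ k S' c) := by
  refine Cycles.exists_lift (fun S' => (PoicComplex.Cycles.mkHom φ.toPoic k (toSubd S')).comp
    (minkowskiToPoic φ k S')) fun S' S'' c c'' h hc => ?_
  refine PoicComplex.Cycles.mk_eq φ.toPoic k (toSubd S') (toSubd S'') (subdivisionHom h)
    (isSubdivision_subdivisionHom h) (subdivisionHom_comp h S'.2 S''.2) _ _ ?_
  refine Eq.trans ?_ (weightEquiv_pullback h c.1)
  exact congrArg (S''.1.weightEquiv k) hc

theorem exists_cyclesOfPoic : ∃ g : PoicComplex.Cycles φ.toPoic k →+ Cycles φ k,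
    ∀ T ω, g (PoicComplex.Cycles.mk φ.toPoic k T ω) =
      Cycles.mk φ k (ofSubd T) (minkowskiOfPoic φ k T ω) := by
  refine PoicComplex.Cycles.exists_lift (fun T => (Cycles.mkHom φ k (ofSubd T)).comp
    (minkowskiOfPoic φ k T)) fun T T' Q ω ω' hQ h hω => ?_
  obtain ⟨Υ, F, hF⟩ := T
  obtain ⟨Υ', F', hF'⟩ := T'
  dsimp only at Q h
  subst h
  refine Cycles.mk_eq φ k _ _ (cellComplex_comp hF hF') _ _ ?_
  refine Eq.trans ?_ (cellWeightEquiv_symm_pullback hF hF' ω.1)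
  exact congrArg (cellWeightEquiv hF' k).symm hω

/-- Passing to poic-complexes and passing to cells are inverse to each other on tropical cycles. -/
theorem exists_cyclesEquiv : ∃ e : Cycles φ k ≃+ PoicComplex.Cycles φ.toPoic k,
    ∀ S' c, e (Cycles.mk φ k S' c) =
      PoicComplex.Cycles.mk φ.toPoic k (toSubd S') (minkowskiToPoic φ k S' c) := by
  obtain ⟨f, hf⟩ := exists_cyclesToPoic φ k
  obtain ⟨g, hg⟩ := exists_cyclesOfPoic φ k
  refine ⟨f.toAddEquiv g (Cycles.hom_ext fun S' c => ?_)
    (PoicComplex.Cycles.hom_ext fun T ω => ?_), hf⟩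
  · change g (f _) = _
    rw [hf, hg]
    have hover := overIdentity_subdivisionHom S'.2
    exact (Cycles.mk_eq φ k S' _ (hover.cellComplex_isProperSubdivision _ S'.2) c _
      (hover.cellWeightEquiv_symm_weightEquiv _ S'.2 c.1)).symm
  · change f (g _) = _
    rw [hg, hf]
    exact PoicComplex.Cycles.mk_eq φ.toPoic k _ T (toCells T.isSubdivision)
      (isSubdivision_toCells _) (comp_toCells _ (overIdentity_subdivisionHom _)) _ ω
      (toCells_pullback T.isSubdivision ω.1).symm

end ConeComplex

end Trop

theorem mainTheorem10 {X : Type u} [TopologicalSpace X] (S : Trop.ConeComplex X)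
    {N : Type u} [AddCommGroup N] [Module.Free ℤ N] [Module.Finite ℤ N]
    (φ : Trop.WeakEmbedding S N) (k : ℕ) :
    (∀ S' : S.ProperSubd, ∃! F : Trop.PoicComplex.Hom S'.1.toPoic S.toPoic,
      F.IsSubdivision ∧ Trop.ConeComplex.OverIdentity F) ∧
    (∀ (S' : S.ProperSubd) (F : Trop.PoicComplex.Hom S'.1.toPoic S.toPoic), F.IsSubdivision →
      Trop.ConeComplex.OverIdentity F → ∀ c : S'.1.Weights k,
        c ∈ Trop.ConeComplex.minkowski (φ.ofSubdivision S'.2) k ↔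
          S'.1.weightEquiv k c ∈ Trop.PoicComplex.minkowski (φ.toPoic.comp F) k) ∧
    ∃! e : Trop.ConeComplex.Cycles φ k ≃+ Trop.PoicComplex.Cycles φ.toPoic k,
      ∀ (S' : S.ProperSubd) (F : Trop.PoicComplex.Hom S'.1.toPoic S.toPoic)
        (hF : F.IsSubdivision), Trop.ConeComplex.OverIdentity F →
        ∀ (c : Trop.ConeComplex.minkowski (φ.ofSubdivision S'.2) k)
          (hc : S'.1.weightEquiv k c.1 ∈ Trop.PoicComplex.minkowski (φ.toPoic.comp F) k),
          e (Trop.ConeComplex.Cycles.mk φ k S' c) =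
            Trop.PoicComplex.Cycles.mk φ.toPoic k ⟨S'.1.toPoic, F, hF⟩
              ⟨S'.1.weightEquiv k c.1, hc⟩ := by
  refine ⟨fun S' => ⟨Trop.ConeComplex.subdivisionHom S'.2,
    ⟨Trop.ConeComplex.isSubdivision_subdivisionHom S'.2,
      Trop.ConeComplex.overIdentity_subdivisionHom S'.2⟩,
    fun F hF => hF.2.unique (Trop.ConeComplex.overIdentity_subdivisionHom S'.2)⟩,
    fun S' F _ hF c => Trop.ConeComplex.mem_minkowski_iff_weightEquiv φ S'.2 hF c, ?_⟩
  obtain ⟨e, he⟩ := Trop.ConeComplex.exists_cyclesEquiv φ k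
  refine ⟨e, fun S' F hF hover c hc => ?_, fun e' he' => ?_⟩
  · obtain rfl := hover.unique (Trop.ConeComplex.overIdentity_subdivisionHom S'.2)
    exact he S' c
  · refine AddEquiv.toAddMonoidHom_injective (Trop.ConeComplex.Cycles.hom_ext fun S' c => ?_)
    exact (he' S' _ (Trop.ConeComplex.isSubdivision_subdivisionHom S'.2)
      (Trop.ConeComplex.overIdentity_subdivisionHom S'.2) c
      (Trop.ConeComplex.minkowskiToPoic φ k S' c).2).trans (he S' c).symm
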